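/- For real $p\ge 0$ and $\theta\in\{e,o\}$ let $$\Lambda_p^e(z)=\frac1{\sqrt{2\pi}}\sum_{n\ge0}\frac{(-1)^n z^{2n}}{(2n)!}\prod_{j=0}^{n-1}(p+2j+1),\qquad \Lambda_p^o(z)=\frac1{\sqrt{2\pi}}\sum_{n\ge0}\frac{(-1)^n z^{2n+1}}{(2n+1)!}\prod_{j=0}^{n}(p+2j).$$ For an integrable signal $f:\mathbb R\to\mathbb R$ and $\rho>0$ let $\phi_p^\theta(x,\rho)=\int_{\mathbb R} f(x-\nu)\,\rho^{p+1}\Lambda_p^\theta(\rho\nu)\,d\nu$, and define $\Psi=\Psi_p^\theta$ on the $(x,\sigma)$ plane by $\Psi(x,\sigma)=\phi_p^\theta(x,1/|\sigma|)$ for $\sigma\ne0$ and $\Psi(x,0)=\lim_{\rho\to\infty}\phi_p^\theta(x,\rho)$. Let $k\ge0$ be an integer and $r\in\{1,2,\dots\}\cup\{\infty\}$. If $r<\infty$, assume that for some integer $m>p+k+r$ the function $f$ is $m$ times continuously differentiable and $f,f',\dots,f^{(m)}$ are absolutely integrable on $\mathbb R$; if $r=\infty$, assume that $f$ is $C^\infty$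 and that all its derivatives $f,f',f'',\dots$ are absolutely integrable. Assume the generic condition that there is no point $(x,\sigma)\in\mathbb R^2$ at which $$\frac{\partial^k\Psi}{\partial x^k}=\frac{\partial^{k+1}\Psi}{\partial x^{k+1}}=\frac{\partial^{k+1}\Psi}{\partial x^k\partial\sigma}=0 .$$ Then the zero set $M=\{(x,\sigma)\in\mathbb R^2:\partial^k\Psi/\partial x^k(x,\sigma)=0\}$ is the union of two families of curves, each curve being a connected component of $M$: (i) smooth simple closed curves (diffeomorphic images of a circle), each symmetric with respect to the $x$-axis $\{\sigma=0\}$ and meeting it in exactly two points; (ii) embedded curves diffeomorphic to $\mathbb R$, each symmetric with respect to the $x$-axis and meeting it in exactly one point. Either family may be empty. Smoothness and diffeomorphisms are understood in the class $C^r$, with regular (nowhere vanishing derivative) parametrizations, which moreover can be chosen to be $C^\infty$ at all points off the $x$-axis. -/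

import Mathlib

open Filter Topology MeasureTheory
open scoped ContDiff

noncomputable section

/-- The two parities `θ = e, o` of the scale-space kernels. -/
inductive KernelParity
  | even
  | odd

/-- The kernel `Λ_p^θ(z)`, given by its (everywhere convergent) power series:
`Λ_p^e(z) = (2π)^{-1/2} ∑ₙ (-1)ⁿ z^{2n}/(2n)! ∏_{j=0}^{n-1} (p + 2j + 1)` and
`Λ_p^o(z) = (2π)^{-1/2} ∑ₙ (-1)ⁿ z^{2n+1}/(2n+1)! ∏_{j=0}^{n} (p + 2j)`. -/
def scaleKernel (θ : KernelParity) (p z : ℝ) : ℝ :=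
  match θ with
  | KernelParity.even =>
      1 / Real.sqrt (2 * Real.pi) *
        ∑' n : ℕ, z ^ (2 * n) / ((2 * n).factorial : ℝ) * (-1) ^ n *
          ∏ j ∈ Finset.range n, (p + 2 * (j : ℝ) + 1)
  | KernelParity.odd =>
      1 / Real.sqrt (2 * Real.pi) *
        ∑' n : ℕ, z ^ (2 * n + 1) / ((2 * n + 1).factorial : ℝ) * (-1) ^ n *
          ∏ j ∈ Finset.range (n + 1), (p + 2 * (j : ℝ))

/-- The convolution `φ_p^θ(x, ρ)` of the signal `f` with `ρ^{p+1} Λ_p^θ(ρ ·)`, for `ρ > 0`. -/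
def scaleConv (f : ℝ → ℝ) (θ : KernelParity) (p x ρ : ℝ) : ℝ :=
  ∫ ν : ℝ, f (x - ν) * (ρ ^ (p + 1) * scaleKernel θ p (ν * ρ))

/-- The function `Ψ_p^θ(x, σ)` on the whole plane: `φ_p^θ(x, 1/|σ|)` for `σ ≠ 0`, and the limit
function `f_p^θ(x) = lim_{ρ → ∞} φ_p^θ(x, ρ)` for `σ = 0`. -/
def scalePsi (f : ℝ → ℝ) (θ : KernelParity) (p x σ : ℝ) : ℝ :=
  if σ = 0 then limUnder atTop (fun ρ : ℝ => scaleConv f θ p x ρ)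
  else scaleConv f θ p x (1 / |σ|)

/-- The derivative `∂^k Ψ_p^θ / ∂x^k` at `(x, σ)`. -/
def scalePsiDx (f : ℝ → ℝ) (θ : KernelParity) (p : ℝ) (k : ℕ) (x σ : ℝ) : ℝ :=
  iteratedDeriv k (fun y : ℝ => scalePsi f θ p y σ) x

/-- The mixed derivative `∂^{k+1} Ψ_p^θ / ∂x^k ∂σ` at `(x, σ)`. -/
def scalePsiDxDsigma (f : ℝ → ℝ) (θ : KernelParity) (p : ℝ) (k : ℕ) (x σ : ℝ) : ℝ :=
  deriv (fun τ : ℝ => scalePsiDx f θ p k x τ) σ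

/-- The zero set `{(x, σ) : ∂^k Ψ_p^θ / ∂x^k (x, σ) = 0}`. -/
def zeroContour (f : ℝ → ℝ) (θ : KernelParity) (p : ℝ) (k : ℕ) : Set (ℝ × ℝ) :=
  {z | scalePsiDx f θ p k z.1 z.2 = 0}

/-- `f` is `m` times continuously differentiable and `f, f', …, f^{(m)}` are absolutely
integrable on the real line. -/
def IsIntegrableSignal (m : ℕ) (f : ℝ → ℝ) : Prop :=
  ContDiff ℝ m f ∧ ∀ i : ℕ, i ≤ m → Integrable (iteratedDeriv i f)

/-- A regular parametrization of class `C^r`, which is `C^∞` wherever the curve is off the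
`x`-axis `{σ = 0}`. -/
def IsRegularParam (r : ℕ∞) (γ : ℝ → ℝ × ℝ) : Prop :=
  ContDiff ℝ (r : WithTop ℕ∞) γ ∧ (∀ t, deriv γ t ≠ 0) ∧
    ∀ t, (γ t).2 ≠ 0 → ContDiffAt ℝ ∞ γ t

/-- `K` is a smooth simple closed curve (the diffeomorphic image of a circle). -/
def IsSmoothClosedCurve (r : ℕ∞) (K : Set (ℝ × ℝ)) : Prop :=
  ∃ (γ : ℝ → ℝ × ℝ) (T : ℝ), 0 < T ∧ IsRegularParam r γ ∧ Function.Periodic γ T ∧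
    Set.InjOn γ (Set.Ico 0 T) ∧ Set.range γ = K

/-- `K`, as an embedded curve in the plane, is diffeomorphic to the real line. -/
def IsSmoothLine (r : ℕ∞) (K : Set (ℝ × ℝ)) : Prop :=
  ∃ γ : ℝ → ℝ × ℝ, IsRegularParam r γ ∧ IsEmbedding γ ∧ Set.range γ = K

/-- `K` is symmetric with respect to the `x`-axis `{σ = 0}`. -/
def IsSymmXAxis (K : Set (ℝ × ℝ)) : Prop :=
  ∀ x σ : ℝ, (x, σ) ∈ K → (x, -σ) ∈ K

end

/-! Analysis. The products in the two power series are quotients of Gaussian moments, so each kernel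
is the real part of a constant times `∫₀^∞ ξ^p e^{-ξ²/2} e^{iξz} dξ` (`scaleKernel_eq`). By Fubini,
`u = ∂ₓᵏΨ` is then the real part of a constant times `∫₀^∞ ξ^{p+k} e^{-(σξ)²/2} e^{iξx} f̂(ξ) dξ`
(`scaleConv_eq`, `scalePsiDx_eq`). Hence `u` is even in `σ`, smooth off the axis, vanishes at
infinity and solves `u_σ = σ u_xx` for `σ > 0` (`isScaleField_scalePsiDx`). The delicate point is
`C^r` regularity across the axis: with only `m > p + k + r`, the decay `f̂ = O(ξ^{-m})` need not
make the top derivatives absolutely convergent at `σ = 0`. Those integrals are rewritten as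
convolutions of `f^{(m)}` with kernels having a locally integrable singularity, uniformly in `σ`
(`exists_continuous_gaussTransform`).

Geometry. The generic condition says that zero is a regular value of `u`. The components of `M` are
the orbits of a bounded field tangent to the level set; an orbit is either injective, hence an
embedded line, or periodic, hence a circle (`exists_flowBox`, `exists_flowLine`,
`connectedComponentIn_eq_range`, `injective_or_periodic`).

Every component meets the axis. If one stayed in the upper half plane, a function vanishing exactly
on it would single out the side away from the axis. There `u` has zero boundary values, so the
maximum principle gives `u = 0`, although `u` changes sign across a regular zero
(`exists_separating_function`, `nonpos_of_heat`, `exists_axis_of_pos`). Finally, reflection in the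
axis reverses the flow, so an orbit started on the axis satisfies `R γ(t) = γ(-t)`. It is therefore
symmetric, and meets the axis exactly when `2t` is a period: once for a line, twice for a circle
(`component_cases`). -/

/-! ### Hermite–Gauss factors and their bounds. -/

/-- The function `w ↦ wⁿ exp(-w²/2)`. -/
noncomputable def hermiteGauss (n : ℕ) (w : ℝ) : ℝ := w ^ n * Real.exp (-w ^ 2 / 2)

lemma continuous_hermiteGauss (n : ℕ) : Continuous (hermiteGauss n) := by
  unfold hermiteGauss; fun_prop

/-- A bound for the constant in `abs_hermiteGauss_le`. -/
noncomputable def hermiteBound (n : ℕ) : ℝ := n.factorial * Real.exp 1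

lemma hermiteBound_pos (n : ℕ) : 0 < hermiteBound n := by
  unfold hermiteBound; positivity

/-- Half of the Gaussian is spent on absorbing the power: `|w|ⁿ ≤ n! e^{|w|}`, and `|w| - w²/2 ≤ 1 -
w²/4` is `(|w| - 2)² ≥ 0`. -/
lemma abs_hermiteGauss_le (n : ℕ) (w : ℝ) :
    |hermiteGauss n w| ≤ hermiteBound n * Real.exp (-(1 / 4) * w ^ 2) := by
  have h1 : |w| ^ n ≤ n.factorial * Real.exp |w| := by
    have := Real.pow_div_factorial_le_exp |w| (abs_nonneg _) n
    rwa [div_le_iff₀ (by positivity), mul_comm] at this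
  have h2 : Real.exp |w| * Real.exp (-w ^ 2 / 2) ≤
      Real.exp 1 * Real.exp (-(1 / 4) * w ^ 2) := by
    rw [← Real.exp_add, ← Real.exp_add]
    apply Real.exp_le_exp.2
    nlinarith [sq_nonneg (|w| - 2), sq_abs w]
  unfold hermiteGauss hermiteBound
  rw [abs_mul, abs_pow, abs_of_pos (Real.exp_pos _)]
  calc |w| ^ n * Real.exp (-w ^ 2 / 2)
      ≤ (n.factorial * Real.exp |w|) * Real.exp (-w ^ 2 / 2) := by gcongr
    _ = n.factorial * (Real.exp |w| * Real.exp (-w ^ 2 / 2)) := by ring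
    _ ≤ n.factorial * (Real.exp 1 * Real.exp (-(1 / 4) * w ^ 2)) := by gcongr
    _ = _ := by ring

lemma abs_hermiteGauss_le_bound (n : ℕ) (w : ℝ) : |hermiteGauss n w| ≤ hermiteBound n := by
  refine (abs_hermiteGauss_le n w).trans ?_
  have : Real.exp (-(1 / 4) * w ^ 2) ≤ 1 := Real.exp_le_one_iff.2 (by nlinarith [sq_nonneg w])
  nlinarith [hermiteBound_pos n]

lemma hasDerivAt_hermiteGauss (n : ℕ) (w : ℝ) :
    HasDerivAt (hermiteGauss n) (n * hermiteGauss (n - 1) w - hermiteGauss (n + 1) w) w := by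
  have h := (hasDerivAt_pow n w).mul (((hasDerivAt_pow 2 w).neg.div_const 2).exp)
  refine (h.congr_deriv ?_)
  simp only [hermiteGauss]
  push_cast
  simp
  ring

/-! ### Gaussian moments and the integral form of the kernels. -/

/-- The half-line moment `∫₀^∞ ξ^q exp(-ξ²/2) dξ`. -/
noncomputable def gaussMoment (q : ℝ) : ℝ :=
  ∫ ξ in Set.Ioi (0 : ℝ), ξ ^ q * Real.exp (-(1 / 2) * ξ ^ (2 : ℝ))

lemma gaussMoment_eq {q : ℝ} (hq : -1 < q) : gaussMoment q =
    (1 / 2 : ℝ) ^ (-(q + 1) / 2) * (1 / 2) * Real.Gamma ((q + 1) / 2) :=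
  integral_rpow_mul_exp_neg_mul_rpow (by norm_num) hq (by norm_num)

lemma gaussMoment_pos {q : ℝ} (hq : -1 < q) : 0 < gaussMoment q := by
  rw [gaussMoment_eq hq]
  have := Real.Gamma_pos_of_pos (show 0 < (q + 1) / 2 by linarith)
  positivity

/-- The functional equation of `Γ`; iterated, it produces the products in the coefficients of the
kernels. -/
lemma gaussMoment_add_two {q : ℝ} (hq : -1 < q) :
    gaussMoment (q + 2) = (q + 1) * gaussMoment q := by
  rw [gaussMoment_eq hq, gaussMoment_eq (by linarith),
    show (q + 2 + 1) / 2 = (q + 1) / 2 + 1 by ring, Real.Gamma_add_one (by linarith),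
    show -(q + 2 + 1) / 2 = -(q + 1) / 2 - 1 by ring, Real.rpow_sub_one (by norm_num)]
  ring

lemma gaussMoment_even {p : ℝ} (hp : 0 ≤ p) (n : ℕ) : gaussMoment (p + (2 * n : ℕ)) =
    gaussMoment p * ∏ j ∈ Finset.range n, (p + 2 * (j : ℝ) + 1) := by
  induction n with
  | zero => simp
  | succ n ih =>
    rw [Finset.prod_range_succ, ← mul_assoc, ← ih,
      show p + ((2 * (n + 1) : ℕ) : ℝ) = (p + (2 * n : ℕ)) + 2 by push_cast; ring,
      gaussMoment_add_two (by have : (0 : ℝ) ≤ (2 * n : ℕ) := by positivity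
                              linarith)]
    push_cast; ring

/-- The recursion started at `p + 1` yields only the factors `p + 2, p + 4, …`. The missing factor
`p` is put on the left, so that `p = 0` needs no division. -/
lemma gaussMoment_odd {p : ℝ} (hp : 0 ≤ p) (n : ℕ) : p * gaussMoment (p + (2 * n + 1 : ℕ)) =
    gaussMoment (p + 1) * ∏ j ∈ Finset.range (n + 1), (p + 2 * (j : ℝ)) := by
  induction n with
  | zero => simp; ring
  | succ n ih =>
    rw [Finset.prod_range_succ, ← mul_assoc, ← ih,
      show p + ((2 * (n + 1) + 1 : ℕ) : ℝ) = (p + (2 * n + 1 : ℕ)) + 2 by push_cast; ring,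
      gaussMoment_add_two (by have : (0 : ℝ) ≤ (2 * n + 1 : ℕ) := by positivity
                              linarith)]
    push_cast; ring

lemma integrableOn_rpow_mul_gauss {p b : ℝ} (hp : -1 < p) (hb : 0 < b) :
    IntegrableOn (fun ξ : ℝ => ξ ^ p * Real.exp (-b * ξ ^ 2)) (Set.Ioi 0) :=
  integrableOn_rpow_mul_exp_neg_mul_sq hb hp

lemma integral_rpow_pow_gauss (p : ℝ) (n : ℕ) :
    ∫ ξ in Set.Ioi (0 : ℝ), ξ ^ p * Real.exp (-ξ ^ 2 / 2) * ξ ^ n = gaussMoment (p + n) := by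
  unfold gaussMoment
  refine setIntegral_congr_fun measurableSet_Ioi fun ξ (hξ : 0 < ξ) => ?_
  rw [Real.rpow_add hξ, Real.rpow_natCast, Real.rpow_two,
    show -(1 / 2) * ξ ^ 2 = -ξ ^ 2 / 2 by ring]
  ring

/-- Term-by-term integration, stated so as to cover cosine and sine at once: `g` is the alternating
series and `G` the hyperbolic series of its absolute values, which supplies the dominating function.
-/
lemma hasSum_integral_gauss {p : ℝ} (hp : 0 ≤ p) (z : ℝ) (e : ℕ → ℕ) (g G : ℝ → ℝ)
    (hg : ∀ r, HasSum (fun n => (-1) ^ n * r ^ e n / ((e n).factorial : ℝ)) (g r))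
    (hG : ∀ r, HasSum (fun n => r ^ e n / ((e n).factorial : ℝ)) (G r)) (hGc : Continuous G)
    (hGe : ∀ r, |G r| ≤ Real.exp |r|) :
    HasSum (fun n => (-1) ^ n * z ^ e n / ((e n).factorial : ℝ) * gaussMoment (p + e n))
      (∫ ξ in Set.Ioi (0 : ℝ), ξ ^ p * Real.exp (-ξ ^ 2 / 2) * g (ξ * z)) := by
  have key := hasSum_integral_of_dominated_convergence (μ := volume.restrict (Set.Ioi (0 : ℝ)))
    (F := fun (n : ℕ) (ξ : ℝ) => ξ ^ p * Real.exp (-ξ ^ 2 / 2) *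
      ((-1) ^ n * (ξ * z) ^ e n / ((e n).factorial : ℝ)))
    (f := fun ξ => ξ ^ p * Real.exp (-ξ ^ 2 / 2) * g (ξ * z))
    (fun n ξ => |ξ ^ p * Real.exp (-ξ ^ 2 / 2)| * (|ξ * z| ^ e n / ((e n).factorial : ℝ)))
    ?_ ?_ ?_ ?_ ?_
  · refine (congrArg (fun F => HasSum F _) (funext fun n => ?_)).mp key
    symm
    rw [← integral_rpow_pow_gauss, ← integral_const_mul]
    refine integral_congr_ae (Eventually.of_forall fun ξ => ?_)
    simp only [mul_pow]; ring
  · intro n; exact Measurable.aestronglyMeasurable (by fun_prop)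
  · refine fun n => Eventually.of_forall fun ξ => ?_
    rw [norm_mul, Real.norm_eq_abs, Real.norm_eq_abs, abs_div,
      abs_mul ((-1) ^ n), abs_pow, abs_pow]
    simp
  · exact Eventually.of_forall fun ξ => (hG _).summable.mul_left _
  · have : (fun ξ : ℝ => ∑' n, |ξ ^ p * Real.exp (-ξ ^ 2 / 2)| *
        (|ξ * z| ^ e n / ((e n).factorial : ℝ))) =
        fun ξ => |ξ ^ p * Real.exp (-ξ ^ 2 / 2)| * G |ξ * z| := by
      ext ξ; rw [tsum_mul_left, (hG _).tsum_eq]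
    rw [this]
    refine Integrable.mono' ((integrableOn_rpow_mul_gauss (by linarith : -1 < p)
      (by norm_num : (0 : ℝ) < 1 / 4)).integrable.const_mul (Real.exp (z ^ 2)))
      (Measurable.aestronglyMeasurable (by fun_prop)) ?_
    filter_upwards [ae_restrict_mem measurableSet_Ioi] with ξ hξ
    have hξ' : (0 : ℝ) < ξ := hξ
    have hx : (0 : ℝ) < ξ ^ p := Real.rpow_pos_of_pos hξ' _
    rw [norm_mul, Real.norm_eq_abs, abs_abs, abs_of_pos (by positivity), Real.norm_eq_abs]
    calc ξ ^ p * Real.exp (-ξ ^ 2 / 2) * abs (G (abs (ξ * z)))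
        ≤ ξ ^ p * Real.exp (-ξ ^ 2 / 2) * Real.exp |ξ * z| := by
          gcongr; simpa using hGe (abs (ξ * z))
      _ = ξ ^ p * (Real.exp (-ξ ^ 2 / 2) * Real.exp |ξ * z|) := by ring
      _ ≤ ξ ^ p * (Real.exp (z ^ 2) * Real.exp (-(1 / 4) * ξ ^ 2)) := by
          refine mul_le_mul_of_nonneg_left ?_ hx.le
          rw [← Real.exp_add, ← Real.exp_add]
          apply Real.exp_le_exp.2
          rw [abs_mul, abs_of_pos hξ']
          -- The exponents compare as `ξ|z| - ξ²/2 ≤ z² - ξ²/4`, which is `(|z| - ξ/2)² ≥ 0`.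
          nlinarith [sq_nonneg (|z| - ξ / 2), sq_abs z]
      _ = _ := by ring
  · exact Eventually.of_forall fun ξ => (hg _).mul_left _

/-- The complex kernel `∫₀^∞ ξ^p exp(-ξ²/2) exp(iξz) dξ`. -/
noncomputable def halfKernel (p z : ℝ) : ℂ :=
  ∫ ξ in Set.Ioi (0 : ℝ), ((ξ ^ p * Real.exp (-ξ ^ 2 / 2) : ℝ) : ℂ) *
    Complex.exp ((ξ * z : ℝ) * Complex.I)

lemma integrable_halfKernel {p : ℝ} (hp : 0 ≤ p) (z : ℝ) :
    IntegrableOn (fun ξ : ℝ => ((ξ ^ p * Real.exp (-ξ ^ 2 / 2) : ℝ) : ℂ) *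
      Complex.exp ((ξ * z : ℝ) * Complex.I)) (Set.Ioi 0) := by
  refine Integrable.mono' (integrableOn_rpow_mul_gauss (by linarith : -1 < p)
      (by norm_num : (0 : ℝ) < 1 / 2)).integrable
      (Measurable.aestronglyMeasurable (by fun_prop)) ?_
  filter_upwards [ae_restrict_mem measurableSet_Ioi] with ξ hξ
  have hx : (0 : ℝ) < ξ ^ p := Real.rpow_pos_of_pos hξ _
  rw [norm_mul, Complex.norm_exp_ofReal_mul_I, mul_one, Complex.norm_real, Real.norm_eq_abs,
    abs_of_pos (by positivity), show -(1 / 2) * ξ ^ 2 = -ξ ^ 2 / 2 by ring]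

lemma re_halfKernel {p : ℝ} (hp : 0 ≤ p) (z : ℝ) : (halfKernel p z).re =
    ∫ ξ in Set.Ioi (0 : ℝ), ξ ^ p * Real.exp (-ξ ^ 2 / 2) * Real.cos (ξ * z) := by
  rw [halfKernel, ← RCLike.re_eq_complex_re, ← integral_re (integrable_halfKernel hp z)]
  refine integral_congr_ae (Eventually.of_forall fun ξ => ?_)
  simp only [RCLike.re_eq_complex_re, Complex.re_ofReal_mul, Complex.exp_ofReal_mul_I_re]

lemma im_halfKernel {p : ℝ} (hp : 0 ≤ p) (z : ℝ) : (halfKernel p z).im =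
    ∫ ξ in Set.Ioi (0 : ℝ), ξ ^ p * Real.exp (-ξ ^ 2 / 2) * Real.sin (ξ * z) := by
  rw [halfKernel, ← RCLike.im_eq_complex_im, ← integral_im (integrable_halfKernel hp z)]
  refine integral_congr_ae (Eventually.of_forall fun ξ => ?_)
  simp only [RCLike.im_eq_complex_im, Complex.im_ofReal_mul, Complex.exp_ofReal_mul_I_im]

/-- The complex constant `c` with `Λ_p^θ = Re (c ∫₀^∞ ξ^p exp(-ξ²/2) exp(iξz) dξ)`. -/
noncomputable def kernelConst (θ : KernelParity) (p : ℝ) : ℂ :=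
  match θ with
  | KernelParity.even => ((1 / Real.sqrt (2 * Real.pi) / gaussMoment p : ℝ) : ℂ)
  | KernelParity.odd =>
      ((1 / Real.sqrt (2 * Real.pi) * p / gaussMoment (p + 1) : ℝ) : ℂ) * (-Complex.I)

lemma scaleKernel_eq (θ : KernelParity) {p : ℝ} (hp : 0 ≤ p) (z : ℝ) :
    scaleKernel θ p z = (kernelConst θ p * halfKernel p z).re := by
  cases θ with
  | even =>
    have hM := (gaussMoment_pos (show -1 < p by linarith)).ne'
    have h := hasSum_integral_gauss hp z (fun n => 2 * n) Real.cos Real.cosh Real.hasSum_cos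
      Real.hasSum_cosh Real.continuous_cosh (fun r => by
        rw [Real.cosh_eq, abs_of_pos (by positivity)]
        have h1 := Real.exp_le_exp.2 (le_abs_self r)
        have h2 := Real.exp_le_exp.2 (neg_le_abs r)
        linarith)
    rw [← re_halfKernel hp] at h
    simp only [scaleKernel, kernelConst]
    rw [Complex.re_ofReal_mul, div_eq_mul_inv (1 / Real.sqrt (2 * Real.pi)), mul_assoc,
      inv_mul_eq_div]
    congr 1
    rw [← (h.div_const (gaussMoment p)).tsum_eq]
    refine tsum_congr fun n => ?_
    rw [gaussMoment_even hp]
    field_simp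
  | odd =>
    have hM := (gaussMoment_pos (show -1 < p + 1 by linarith)).ne'
    have h := hasSum_integral_gauss hp z (fun n => 2 * n + 1) Real.sin Real.sinh Real.hasSum_sin
      Real.hasSum_sinh Real.continuous_sinh (fun r => by
        rw [Real.sinh_eq, abs_le]
        have h1 := Real.exp_le_exp.2 (le_abs_self r)
        have h2 := Real.exp_le_exp.2 (neg_le_abs r)
        have h3 := Real.exp_pos r
        have h4 := Real.exp_pos (-r)
        constructor <;> linarith)
    rw [← im_halfKernel hp] at h
    simp only [scaleKernel, kernelConst]
    rw [mul_assoc, Complex.re_ofReal_mul, show (-Complex.I * halfKernel p z).re =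
      (halfKernel p z).im by simp, mul_div_assoc, mul_assoc]
    congr 1
    rw [← (h.mul_left (p / gaussMoment (p + 1))).tsum_eq]
    refine tsum_congr fun n => ?_
    have := gaussMoment_odd hp n
    rw [show p / gaussMoment (p + 1) * ((-1) ^ n * z ^ (2 * n + 1) / ((2 * n + 1).factorial : ℝ) *
      gaussMoment (p + (2 * n + 1 : ℕ))) = (-1) ^ n * z ^ (2 * n + 1) / ((2 * n + 1).factorial : ℝ) *
      (p * gaussMoment (p + (2 * n + 1 : ℕ))) / gaussMoment (p + 1) by ring, this]
    field_simp

/-! ### Half-line Fourier integrals with a Gaussian factor, and their smoothness off the axis. -/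

/-- The continuous linear map on the plane with prescribed partial derivatives. -/
noncomputable def ofPartials (a b : ℂ) : ℝ × ℝ →L[ℝ] ℂ :=
  (ContinuousLinearMap.fst ℝ ℝ ℝ).smulRight a + (ContinuousLinearMap.snd ℝ ℝ ℝ).smulRight b

lemma ofPartials_apply (a b : ℂ) (v : ℝ × ℝ) :
    ofPartials a b v = (v.1 : ℂ) * a + (v.2 : ℂ) * b := by
  simp [ofPartials]

/-- `ofPartials` as a continuous linear map. -/
noncomputable def ofPartialsCLM : ℂ × ℂ →L[ℝ] (ℝ × ℝ →L[ℝ] ℂ) :=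
  ((ContinuousLinearMap.smulRightL ℝ (ℝ × ℝ) ℂ (ContinuousLinearMap.fst ℝ ℝ ℝ)).comp
    (ContinuousLinearMap.fst ℝ ℂ ℂ)) +
  ((ContinuousLinearMap.smulRightL ℝ (ℝ × ℝ) ℂ (ContinuousLinearMap.snd ℝ ℝ ℝ)).comp
    (ContinuousLinearMap.snd ℝ ℂ ℂ))

lemma ofPartialsCLM_apply (a b : ℂ) : ofPartialsCLM (a, b) = ofPartials a b := by
  ext <;> simp [ofPartialsCLM, ofPartials]

lemma norm_ofPartials_le (a b : ℂ) : ‖ofPartials a b‖ ≤ ‖a‖ + ‖b‖ := by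
  refine ContinuousLinearMap.opNorm_le_bound _ (by positivity) fun v => ?_
  rw [ofPartials_apply]
  calc ‖(v.1 : ℂ) * a + (v.2 : ℂ) * b‖ ≤ ‖(v.1 : ℂ) * a‖ + ‖(v.2 : ℂ) * b‖ := norm_add_le _ _
    _ = ‖v.1‖ * ‖a‖ + ‖v.2‖ * ‖b‖ := by simp
    _ ≤ ‖v‖ * ‖a‖ + ‖v‖ * ‖b‖ := by
        gcongr
        · exact norm_fst_le v
        · exact norm_snd_le v
    _ = _ := by ring

/-- The integrand of `gaussTransform`. -/
noncomputable def gaussIntegrand (h : ℝ → ℂ) (Q : ℝ) (n : ℕ) (z : ℝ × ℝ) (ξ : ℝ) : ℂ :=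
  ((ξ ^ Q : ℝ) : ℂ) * ((hermiteGauss n (z.2 * ξ) : ℝ) : ℂ) *
    Complex.exp ((ξ * z.1 : ℝ) * Complex.I) * h ξ

/-- The half-line Fourier integral
`∫₀^∞ ξ^Q (σξ)ⁿ exp(-(σξ)²/2) exp(iξx) h(ξ) dξ` as a function of `(x, σ)`. -/
noncomputable def gaussTransform (h : ℝ → ℂ) (Q : ℝ) (n : ℕ) (z : ℝ × ℝ) : ℂ :=
  ∫ ξ in Set.Ioi (0 : ℝ), gaussIntegrand h Q n z ξ

lemma measurable_gaussIntegrand {h : ℝ → ℂ} (hh : Continuous h) (Q : ℝ) (n : ℕ) (z : ℝ × ℝ) :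
    Measurable (gaussIntegrand h Q n z) := by
  have h1 : Continuous fun ξ : ℝ => hermiteGauss n (z.2 * ξ) :=
    (continuous_hermiteGauss n).comp (by fun_prop)
  have h2 := h1.measurable
  have h3 := hh.measurable
  unfold gaussIntegrand
  fun_prop

lemma continuous_gaussIntegrand (h : ℝ → ℂ) (Q : ℝ) (n : ℕ) (ξ : ℝ) :
    Continuous fun z => gaussIntegrand h Q n z ξ := by
  have h1 : Continuous fun z : ℝ × ℝ => hermiteGauss n (z.2 * ξ) :=
    (continuous_hermiteGauss n).comp (by fun_prop)
  unfold gaussIntegrand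
  fun_prop

lemma norm_gaussIntegrand (h : ℝ → ℂ) (Q : ℝ) (n : ℕ) (z : ℝ × ℝ) {ξ : ℝ} (hξ : 0 < ξ) :
    ‖gaussIntegrand h Q n z ξ‖ = ξ ^ Q * |hermiteGauss n (z.2 * ξ)| * ‖h ξ‖ := by
  unfold gaussIntegrand
  rw [norm_mul, norm_mul, norm_mul, Complex.norm_exp_ofReal_mul_I, Complex.norm_real,
    Complex.norm_real, Real.norm_eq_abs, Real.norm_eq_abs,
    abs_of_pos (Real.rpow_pos_of_pos hξ _), mul_one]

/-- Either partial derivative costs one power of `ξ` and stays in the same family, which is what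
lets the smoothness proofs run by induction. The truncated `n - 1` at `n = 0` is harmless, its
coefficient being zero. -/
lemma hasFDerivAt_gaussIntegrand (h : ℝ → ℂ) (Q : ℝ) (n : ℕ) (z : ℝ × ℝ) {ξ : ℝ} (hξ : 0 < ξ) :
    HasFDerivAt (fun z => gaussIntegrand h Q n z ξ)
      (ofPartials (Complex.I * gaussIntegrand h (Q + 1) n z ξ)
        (n * gaussIntegrand h (Q + 1) (n - 1) z ξ - gaussIntegrand h (Q + 1) (n + 1) z ξ)) z := by
  have hs : HasFDerivAt (fun z : ℝ × ℝ => z.2) (ContinuousLinearMap.snd ℝ ℝ ℝ) z := hasFDerivAt_snd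
  have hf : HasFDerivAt (fun z : ℝ × ℝ => z.1) (ContinuousLinearMap.fst ℝ ℝ ℝ) z := hasFDerivAt_fst
  have h1 := (hasDerivAt_hermiteGauss n (z.2 * ξ)).comp_hasFDerivAt z (hs.mul_const ξ)
  have h1' := (Complex.ofRealCLM.hasFDerivAt (x := hermiteGauss n (z.2 * ξ))).comp z h1
  have h2 : HasFDerivAt (fun z : ℝ × ℝ => ((ξ * z.1 : ℝ) : ℂ) * Complex.I) _ z :=
    ((Complex.ofRealCLM.hasFDerivAt (x := ξ * z.1)).comp z
      (hf.const_mul ξ)).mul_const Complex.I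
  have h3 := ((h1'.mul h2.cexp).const_mul ((ξ ^ Q : ℝ) : ℂ)).mul_const (h ξ)
  have hQ : ξ ^ (Q + 1) = ξ ^ Q * ξ := by rw [Real.rpow_add hξ, Real.rpow_one]
  refine (h3.congr_fderiv ?_).congr_of_eventuallyEq ?_
  · ext <;> simp [ofPartials, gaussIntegrand, hQ] <;> ring
  · exact Eventually.of_forall fun w => by
      simp only [gaussIntegrand, Pi.mul_apply, Function.comp_apply, Complex.ofRealCLM_apply]; ring

/-- `h` is continuous, bounded and `O(ξ^{-m})` on the half line, with constant `B`. -/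
structure HasDecay (h : ℝ → ℂ) (m : ℕ) (B : ℝ) : Prop where
  cont : Continuous h
  bound : ∀ ξ, ‖h ξ‖ ≤ B
  decay : ∀ ξ, 0 < ξ → ξ ^ m * ‖h ξ‖ ≤ B

lemma HasDecay.integrableOn_rpow {h : ℝ → ℂ} {m : ℕ} {B Q : ℝ} (hh : HasDecay h m B)
    (hQ : -1 < Q) (hm : Q + 1 < m) :
    IntegrableOn (fun ξ => ξ ^ Q * ‖h ξ‖) (Set.Ioi 0) := by
  have hmeas : Measurable h := hh.cont.measurable
  have hB : 0 ≤ B := (norm_nonneg _).trans (hh.bound 0)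
  rw [← Set.Ioc_union_Ioi_eq_Ioi zero_le_one]
  refine IntegrableOn.union ?_ ?_
  · have h1 : IntegrableOn (fun ξ : ℝ => ξ ^ Q) (Set.Ioc 0 1) :=
      (intervalIntegrable_iff_integrableOn_Ioc_of_le zero_le_one).1
        (intervalIntegral.intervalIntegrable_rpow' hQ)
    refine Integrable.mono' (h1.integrable.mul_const B)
      (Measurable.aestronglyMeasurable (by fun_prop)) ?_
    filter_upwards [ae_restrict_mem measurableSet_Ioc] with ξ hξ
    have : (0 : ℝ) < ξ ^ Q := Real.rpow_pos_of_pos hξ.1 _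
    rw [norm_mul, norm_norm, Real.norm_eq_abs, abs_of_pos this]
    gcongr
    exact hh.bound ξ
  · have h1 : IntegrableOn (fun ξ : ℝ => ξ ^ (Q - m)) (Set.Ioi 1) :=
      integrableOn_Ioi_rpow_of_lt (by linarith) one_pos
    refine Integrable.mono' (h1.integrable.mul_const B)
      (Measurable.aestronglyMeasurable (by fun_prop)) ?_
    filter_upwards [ae_restrict_mem measurableSet_Ioi] with ξ hξ
    have hξ0 : (0 : ℝ) < ξ := zero_lt_one.trans hξ
    have : (0 : ℝ) < ξ ^ Q := Real.rpow_pos_of_pos hξ0 _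
    rw [norm_mul, norm_norm, Real.norm_eq_abs, abs_of_pos this, Real.rpow_sub hξ0,
      Real.rpow_natCast, div_mul_eq_mul_div, mul_div_assoc]
    gcongr
    rw [le_div_iff₀ (by positivity), mul_comm]
    exact hh.decay ξ hξ0

/-- On the region `|σ| ≥ a > 0` with `h` bounded the integrands are uniformly dominated. -/
lemma norm_gaussIntegrand_le {h : ℝ → ℂ} {B : ℝ} (hB : ∀ ξ, ‖h ξ‖ ≤ B) (Q : ℝ) (n : ℕ) {a : ℝ}
    (ha : 0 < a) {z : ℝ × ℝ} (hz : a ≤ |z.2|) {ξ : ℝ} (hξ : 0 < ξ) :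
    ‖gaussIntegrand h Q n z ξ‖ ≤
      hermiteBound n * B * (ξ ^ Q * Real.exp (-(a ^ 2 / 4) * ξ ^ 2)) := by
  rw [norm_gaussIntegrand h Q n z hξ]
  have h0 : (0 : ℝ) < ξ ^ Q := Real.rpow_pos_of_pos hξ _
  have h1 := abs_hermiteGauss_le n (z.2 * ξ)
  have h2 : Real.exp (-(1 / 4) * (z.2 * ξ) ^ 2) ≤ Real.exp (-(a ^ 2 / 4) * ξ ^ 2) := by
    apply Real.exp_le_exp.2
    have : a ^ 2 ≤ z.2 ^ 2 := by rw [← sq_abs z.2]; gcongr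
    nlinarith [mul_le_mul_of_nonneg_right this (sq_nonneg ξ)]
  have h3 := hermiteBound_pos n
  calc ξ ^ Q * |hermiteGauss n (z.2 * ξ)| * ‖h ξ‖
      ≤ ξ ^ Q * (hermiteBound n * Real.exp (-(a ^ 2 / 4) * ξ ^ 2)) * B := by
        gcongr
        · exact h1.trans (by gcongr)
        · exact hB ξ
    _ = _ := by ring

lemma integrable_gaussBound {Q a : ℝ} (hQ : -1 < Q) (ha : 0 < a) (C : ℝ) :
    IntegrableOn (fun ξ : ℝ => C * (ξ ^ Q * Real.exp (-(a ^ 2 / 4) * ξ ^ 2))) (Set.Ioi 0) :=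
  ((integrableOn_rpow_mul_gauss hQ (by positivity)).integrable.const_mul C)

lemma integrable_gaussIntegrand_offAxis {h : ℝ → ℂ} {B : ℝ} (hc : Continuous h)
    (hB : ∀ ξ, ‖h ξ‖ ≤ B) {Q : ℝ} (hQ : -1 < Q) (n : ℕ) {z : ℝ × ℝ} (hz : z.2 ≠ 0) :
    IntegrableOn (gaussIntegrand h Q n z) (Set.Ioi 0) := by
  refine Integrable.mono' (integrable_gaussBound hQ (abs_pos.2 hz) (hermiteBound n * B)).integrable
    (measurable_gaussIntegrand hc Q n z).aestronglyMeasurable ?_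
  filter_upwards [ae_restrict_mem measurableSet_Ioi] with ξ hξ
  exact norm_gaussIntegrand_le hB Q n (abs_pos.2 hz) le_rfl hξ

lemma HasDecay.integrable_gaussIntegrand {h : ℝ → ℂ} {m : ℕ} {B Q : ℝ} (hh : HasDecay h m B)
    (hQ : -1 < Q) (hm : Q + 1 < m) (n : ℕ) (z : ℝ × ℝ) :
    IntegrableOn (gaussIntegrand h Q n z) (Set.Ioi 0) := by
  refine Integrable.mono' ((hh.integrableOn_rpow hQ hm).integrable.const_mul (hermiteBound n))
    (measurable_gaussIntegrand hh.cont Q n z).aestronglyMeasurable ?_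
  filter_upwards [ae_restrict_mem measurableSet_Ioi] with ξ hξ
  have h0 : (0 : ℝ) < ξ ^ Q := Real.rpow_pos_of_pos hξ _
  rw [norm_gaussIntegrand h Q n z hξ]
  calc _ ≤ ξ ^ Q * hermiteBound n * ‖h ξ‖ := by gcongr; exact abs_hermiteGauss_le_bound n _
    _ = _ := by ring

/-- Here the Hermite factor is merely bounded, so the axis is included, at the price of the absolute
convergence condition `Q + 1 < m`. -/
lemma HasDecay.continuous_gaussTransform {h : ℝ → ℂ} {m : ℕ} {B Q : ℝ} (hh : HasDecay h m B)
    (hQ : -1 < Q) (hm : Q + 1 < m) (n : ℕ) : Continuous (gaussTransform h Q n) := by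
  refine continuous_of_dominated (bound := fun ξ => hermiteBound n * (ξ ^ Q * ‖h ξ‖))
    (fun z => (measurable_gaussIntegrand hh.cont Q n z).aestronglyMeasurable) (fun z => ?_)
    ((hh.integrableOn_rpow hQ hm).integrable.const_mul (hermiteBound n))
    (Eventually.of_forall fun ξ => continuous_gaussIntegrand h Q n ξ)
  filter_upwards [ae_restrict_mem measurableSet_Ioi] with ξ hξ
  have h0 : (0 : ℝ) < ξ ^ Q := Real.rpow_pos_of_pos hξ _
  rw [norm_gaussIntegrand h Q n z hξ]
  calc _ ≤ ξ ^ Q * hermiteBound n * ‖h ξ‖ := by gcongr; exact abs_hermiteGauss_le_bound n _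
    _ = _ := by ring

/-- On the neighbourhood `|τ| > |σ|/2` of a point with `σ ≠ 0` one fixed Gaussian dominates all the
integrands, so boundedness of `h` suffices. -/
lemma hasFDerivAt_gaussTransform_offAxis {h : ℝ → ℂ} {B : ℝ} (hc : Continuous h)
    (hB : ∀ ξ, ‖h ξ‖ ≤ B) {Q : ℝ} (hQ : -1 < Q) (n : ℕ) {z : ℝ × ℝ} (hz : z.2 ≠ 0) :
    HasFDerivAt (gaussTransform h Q n)
      (ofPartials (Complex.I * gaussTransform h (Q + 1) n z)
        (n * gaussTransform h (Q + 1) (n - 1) z - gaussTransform h (Q + 1) (n + 1) z)) z := by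
  have hQ1 : -1 < Q + 1 := by linarith
  have ha : 0 < |z.2| / 2 := by have := abs_pos.2 hz; linarith
  have hint : ∀ n, IntegrableOn (gaussIntegrand h (Q + 1) n z) (Set.Ioi 0) := fun n =>
    integrable_gaussIntegrand_offAxis hc hB hQ1 n hz
  have hs : {w : ℝ × ℝ | |z.2| / 2 < |w.2|} ∈ 𝓝 z :=
    (isOpen_lt continuous_const (by fun_prop)).mem_nhds (by
      have := abs_pos.2 hz; simp only [Set.mem_ofPred_eq]; linarith)
  have hB0 : 0 ≤ B := (norm_nonneg _).trans (hB 0)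
  have hsub : Integrable (fun ξ => (n : ℂ) * gaussIntegrand h (Q + 1) (n - 1) z ξ -
      gaussIntegrand h (Q + 1) (n + 1) z ξ) (volume.restrict (Set.Ioi (0 : ℝ))) :=
    ((hint (n - 1)).integrable.const_mul _).sub (hint (n + 1)).integrable
  have hpair : Integrable (fun ξ => (Complex.I * gaussIntegrand h (Q + 1) n z ξ,
      (n : ℂ) * gaussIntegrand h (Q + 1) (n - 1) z ξ - gaussIntegrand h (Q + 1) (n + 1) z ξ))
      (volume.restrict (Set.Ioi (0 : ℝ))) :=
    ((hint n).integrable.const_mul _).prodMk hsub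
  have key := hasFDerivAt_integral_of_dominated_of_fderiv_le (𝕜 := ℝ)
    (μ := volume.restrict (Set.Ioi (0 : ℝ)))
    (F := fun z ξ => gaussIntegrand h Q n z ξ)
    (F' := fun z ξ => ofPartials (Complex.I * gaussIntegrand h (Q + 1) n z ξ)
        (n * gaussIntegrand h (Q + 1) (n - 1) z ξ - gaussIntegrand h (Q + 1) (n + 1) z ξ))
    (x₀ := z)
    (bound := fun ξ => (hermiteBound n * B + n * (hermiteBound (n - 1) * B) +
      hermiteBound (n + 1) * B) * (ξ ^ (Q + 1) * Real.exp (-((|z.2| / 2) ^ 2 / 4) * ξ ^ 2)))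
    hs (Eventually.of_forall fun w => (measurable_gaussIntegrand hc Q n w).aestronglyMeasurable)
    (integrable_gaussIntegrand_offAxis hc hB hQ n hz) ?_ ?_
    (integrable_gaussBound hQ1 ha _).integrable ?_
  · refine key.congr_fderiv ?_
    have h2 := ContinuousLinearMap.integral_comp_comm ofPartialsCLM hpair
    simp only [ofPartialsCLM_apply] at h2
    rw [h2, integral_pair ((hint n).integrable.const_mul _) hsub,
      ofPartialsCLM_apply, integral_const_mul,
      integral_sub ((hint (n - 1)).integrable.const_mul _) (hint (n + 1)).integrable,
      integral_const_mul]
    rfl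
  · have := (ofPartialsCLM.integrable_comp hpair).aestronglyMeasurable
    simpa only [ofPartialsCLM_apply] using this
  · filter_upwards [ae_restrict_mem measurableSet_Ioi] with ξ hξ w hw
    have hb := fun n => norm_gaussIntegrand_le hB (Q + 1) n ha (le_of_lt hw) hξ
    refine (norm_ofPartials_le _ _).trans ?_
    rw [norm_mul, Complex.norm_I, one_mul]
    have h1 := norm_sub_le ((n : ℂ) * gaussIntegrand h (Q + 1) (n - 1) w ξ)
      (gaussIntegrand h (Q + 1) (n + 1) w ξ)
    rw [norm_mul, Complex.norm_natCast] at h1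
    have h2 := mul_le_mul_of_nonneg_left (hb (n - 1)) (Nat.cast_nonneg (α := ℝ) n)
    have h3 := hb n
    have h4 := hb (n + 1)
    linarith
  · filter_upwards [ae_restrict_mem measurableSet_Ioi] with ξ hξ w hw
    exact hasFDerivAt_gaussIntegrand h Q n w hξ

lemma isOpen_offAxis : IsOpen {z : ℝ × ℝ | z.2 ≠ 0} :=
  isOpen_ne_fun continuous_snd continuous_const

lemma contDiffOn_gaussTransform_offAxis {h : ℝ → ℂ} {B : ℝ} (hc : Continuous h)
    (hB : ∀ ξ, ‖h ξ‖ ≤ B) (j : ℕ) : ∀ {Q : ℝ}, -1 < Q → ∀ n : ℕ,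
    ContDiffOn ℝ j (gaussTransform h Q n) {z | z.2 ≠ 0} := by
  induction j with
  | zero =>
    intro Q hQ n
    refine contDiffOn_zero.2 fun z hz => ?_
    exact (hasFDerivAt_gaussTransform_offAxis hc hB hQ n hz).continuousAt.continuousWithinAt
  | succ j ih =>
    intro Q hQ n
    rw [Nat.cast_succ, contDiffOn_succ_iff_fderiv_of_isOpen isOpen_offAxis]
    refine ⟨fun z hz => (hasFDerivAt_gaussTransform_offAxis hc hB hQ n
      hz).differentiableAt.differentiableWithinAt, by simp, ?_⟩
    have hQ1 : -1 < Q + 1 := by linarith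
    refine ContDiffOn.congr (f := fun z => ofPartialsCLM
      (Complex.I * gaussTransform h (Q + 1) n z, n * gaussTransform h (Q + 1) (n - 1) z -
        gaussTransform h (Q + 1) (n + 1) z)) ?_ fun z hz => ?_
    · exact ofPartialsCLM.contDiff.comp_contDiffOn ((contDiffOn_const.mul (ih hQ1 n)).prodMk
        ((contDiffOn_const.mul (ih hQ1 (n - 1))).sub (ih hQ1 (n + 1))))
    · rw [ofPartialsCLM_apply]
      exact (hasFDerivAt_gaussTransform_offAxis hc hB hQ n hz).fderiv

/-- On each open half plane the derivative has the limit `L z` at `z`, so it extends to the closed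
half plane; the two closed half planes cover the plane. -/
lemma hasFDerivAt_of_offAxis {F : ℝ × ℝ → ℂ} {L : ℝ × ℝ → (ℝ × ℝ →L[ℝ] ℂ)} (hF : Continuous F)
    (hL : Continuous L) (h : ∀ z : ℝ × ℝ, z.2 ≠ 0 → HasFDerivAt F (L z) z) (z : ℝ × ℝ) :
    HasFDerivAt F (L z) z := by
  have main : ∀ s : Set (ℝ × ℝ), IsOpen s → Convex ℝ s → (∀ w ∈ s, w.2 ≠ 0) →
      HasFDerivWithinAt F (L z) (closure s) z := by
    intro s ho hcv hs
    refine hasFDerivWithinAt_closure_of_tendsto_fderiv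
      (fun w hw => (h w (hs w hw)).differentiableAt.differentiableWithinAt) hcv ho
      (fun w _ => hF.continuousWithinAt) ?_
    refine ((hL.tendsto z).mono_left nhdsWithin_le_nhds).congr' ?_
    filter_upwards [self_mem_nhdsWithin] with w hw
    exact (h w (hs w hw)).fderiv.symm
  have h1 := main (Set.univ ×ˢ Set.Ioi 0) (isOpen_univ.prod isOpen_Ioi)
    (convex_univ.prod (convex_Ioi 0)) (fun w hw => ne_of_gt hw.2)
  have h2 := main (Set.univ ×ˢ Set.Iio 0) (isOpen_univ.prod isOpen_Iio)
    (convex_univ.prod (convex_Iio 0)) (fun w hw => ne_of_lt hw.2)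
  rw [closure_prod_eq, closure_univ, closure_Ioi] at h1
  rw [closure_prod_eq, closure_univ, closure_Iio] at h2
  have h3 := h1.union h2
  rw [← Set.prod_union, Set.Ici_union_Iic, Set.univ_prod_univ] at h3
  exact hasFDerivWithinAt_univ.1 h3

/-! ### Oscillatory kernels, with bounds uniform up to `σ = 0`. -/

/-- The amplitude `ξ^{-s} ηₙ(σξ)`. -/
noncomputable def gaussAmp (s : ℝ) (n : ℕ) (σ ξ : ℝ) : ℝ := ξ ^ (-s) * hermiteGauss n (σ * ξ)

/-- The `ξ`-derivative of `gaussAmp`. -/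
noncomputable def gaussAmpDeriv (s : ℝ) (n : ℕ) (σ ξ : ℝ) : ℝ :=
  ξ ^ (-s - 1) * ((n - s) * hermiteGauss n (σ * ξ) - hermiteGauss (n + 2) (σ * ξ))

lemma hasDerivAt_gaussAmp (s : ℝ) (n : ℕ) (σ : ℝ) {ξ : ℝ} (hξ : 0 < ξ) :
    HasDerivAt (gaussAmp s n σ) (gaussAmpDeriv s n σ ξ) ξ := by
  have h1 := (hasDerivAt_hermiteGauss n (σ * ξ)).comp ξ ((hasDerivAt_id ξ).const_mul σ)
  have h2 := (Real.hasDerivAt_rpow_const (p := -s) (Or.inl hξ.ne')).mul h1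
  refine (h2.congr_deriv ?_)
  have e1 : ξ ^ (-s) = ξ ^ (-s - 1) * ξ := by
    rw [Real.rpow_sub_one hξ.ne']; field_simp
  have e2 : (n : ℝ) * hermiteGauss n (σ * ξ) = (σ * ξ) * (n * hermiteGauss (n - 1) (σ * ξ)) := by
    cases n with
    | zero => simp
    | succ n => simp only [hermiteGauss, Nat.add_sub_cancel, pow_succ]; ring
  have e3 : hermiteGauss (n + 2) (σ * ξ) = (σ * ξ) * hermiteGauss (n + 1) (σ * ξ) := by
    simp only [hermiteGauss, pow_succ]; ring
  simp only [gaussAmpDeriv, Function.comp_apply]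
  rw [e3, e1]
  linear_combination (-(ξ ^ (-s - 1))) * e2

lemma measurable_gaussAmp (s : ℝ) (n : ℕ) (σ : ℝ) : Measurable (gaussAmp s n σ) := by
  have h1 : Continuous fun ξ : ℝ => hermiteGauss n (σ * ξ) :=
    (continuous_hermiteGauss n).comp (by fun_prop)
  have h2 := h1.measurable
  unfold gaussAmp; fun_prop

lemma measurable_gaussAmpDeriv (s : ℝ) (n : ℕ) (σ : ℝ) : Measurable (gaussAmpDeriv s n σ) := by
  have h1 : ∀ n, Measurable fun ξ : ℝ => hermiteGauss n (σ * ξ) := fun n =>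
    ((continuous_hermiteGauss n).comp (by fun_prop)).measurable
  have h2 := h1 n
  have h3 := h1 (n + 2)
  unfold gaussAmpDeriv; fun_prop

/-- For `ξ ≥ 1` the exponent `s` may be lowered to any `s' ≤ s`. This is used to bring it below `1`,
where the kernel bounds have the form `|v|^{s' - 1}`. -/
lemma abs_gaussAmp_le {s s' : ℝ} (hs : s' ≤ s) (n : ℕ) (σ : ℝ) {ξ : ℝ} (hξ : 1 ≤ ξ) :
    |gaussAmp s n σ ξ| ≤ hermiteBound n * ξ ^ (-s') := by
  have h0 : (0 : ℝ) < ξ ^ (-s) := Real.rpow_pos_of_pos (by linarith) _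
  have h1 : ξ ^ (-s) ≤ ξ ^ (-s') := Real.rpow_le_rpow_of_exponent_le hξ (by linarith)
  rw [gaussAmp, abs_mul, abs_of_pos h0, mul_comm]
  have := abs_hermiteGauss_le_bound n (σ * ξ)
  have := hermiteBound_pos n
  gcongr

/-- The constant in `abs_gaussAmpDeriv_le`. -/
noncomputable def ampDerivBound (s : ℝ) (n : ℕ) : ℝ :=
  |(n : ℝ) - s| * hermiteBound n + hermiteBound (n + 2)

lemma ampDerivBound_pos (s : ℝ) (n : ℕ) : 0 < ampDerivBound s n := by
  have := hermiteBound_pos n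
  have := hermiteBound_pos (n + 2)
  unfold ampDerivBound; positivity

lemma abs_gaussAmpDeriv_le {s s' : ℝ} (hs : s' ≤ s) (n : ℕ) (σ : ℝ) {ξ : ℝ} (hξ : 1 ≤ ξ) :
    |gaussAmpDeriv s n σ ξ| ≤ ampDerivBound s n * ξ ^ (-s' - 1) := by
  have h0 : (0 : ℝ) < ξ ^ (-s - 1) := Real.rpow_pos_of_pos (by linarith) _
  have h1 : ξ ^ (-s - 1) ≤ ξ ^ (-s' - 1) := Real.rpow_le_rpow_of_exponent_le hξ (by linarith)
  rw [gaussAmpDeriv, abs_mul, abs_of_pos h0, mul_comm]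
  have h2 : |(n - s) * hermiteGauss n (σ * ξ) - hermiteGauss (n + 2) (σ * ξ)| ≤
      ampDerivBound s n := by
    refine (abs_sub _ _).trans ?_
    rw [abs_mul]
    have := abs_hermiteGauss_le_bound n (σ * ξ)
    have := abs_hermiteGauss_le_bound (n + 2) (σ * ξ)
    unfold ampDerivBound
    gcongr
  have := ampDerivBound_pos s n
  gcongr

lemma integrableOn_rpow_Ioi {c N : ℝ} (hc : 0 < c) (hN : 1 ≤ N) :
    IntegrableOn (fun ξ : ℝ => ξ ^ (-c - 1)) (Set.Ioi N) :=
  integrableOn_Ioi_rpow_of_lt (by linarith) (by linarith)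

lemma integrable_gaussAmpDeriv {s : ℝ} (hs : 0 < s) (n : ℕ) (σ v : ℝ) {N : ℝ} (hN : 1 ≤ N) :
    IntegrableOn (fun ξ => ((gaussAmpDeriv s n σ ξ : ℝ) : ℂ) *
      Complex.exp ((ξ * v : ℝ) * Complex.I)) (Set.Ioi N) := by
  have hm := measurable_gaussAmpDeriv s n σ
  refine Integrable.mono' ((integrableOn_rpow_Ioi hs hN).integrable.const_mul (ampDerivBound s n))
    (Measurable.aestronglyMeasurable (by fun_prop)) ?_
  filter_upwards [ae_restrict_mem measurableSet_Ioi] with ξ hξ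
  rw [norm_mul, Complex.norm_exp_ofReal_mul_I, Complex.norm_real, mul_one]
  exact abs_gaussAmpDeriv_le le_rfl n σ (hN.trans (le_of_lt hξ))

lemma integrable_gaussAmp {s : ℝ} (hs : 0 < s) (n : ℕ) {σ : ℝ} (hσ : σ ≠ 0) (v : ℝ) {N : ℝ}
    (hN : 1 ≤ N) :
    IntegrableOn (fun ξ => ((gaussAmp s n σ ξ : ℝ) : ℂ) *
      Complex.exp ((ξ * v : ℝ) * Complex.I)) (Set.Ioi N) := by
  have hm := measurable_gaussAmp s n σ
  have hb : IntegrableOn (fun ξ : ℝ => hermiteBound n * Real.exp (-(σ ^ 2 / 4) * ξ ^ 2))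
      (Set.Ioi N) := by
    have : 0 < σ ^ 2 / 4 := by positivity
    exact ((integrable_exp_neg_mul_sq this).const_mul _).integrableOn
  refine Integrable.mono' hb.integrable (Measurable.aestronglyMeasurable (by fun_prop)) ?_
  filter_upwards [ae_restrict_mem measurableSet_Ioi] with ξ hξ
  have hξ1 : 1 ≤ ξ := hN.trans (le_of_lt hξ)
  have h0 : (0 : ℝ) < ξ ^ (-s) := Real.rpow_pos_of_pos (by linarith) _
  have h1 : ξ ^ (-s) ≤ 1 := Real.rpow_le_one_of_one_le_of_nonpos hξ1 (by linarith)
  have h2 := abs_hermiteGauss_le n (σ * ξ)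
  rw [norm_mul, Complex.norm_exp_ofReal_mul_I, Complex.norm_real, mul_one, gaussAmp,
    Real.norm_eq_abs, abs_mul, abs_of_pos h0]
  calc ξ ^ (-s) * |hermiteGauss n (σ * ξ)| ≤ 1 * |hermiteGauss n (σ * ξ)| := by gcongr
    _ ≤ hermiteBound n * Real.exp (-(1 / 4) * (σ * ξ) ^ 2) := by rw [one_mul]; exact h2
    _ = _ := by congr 2; ring

/-- The integral of `gaussAmpDeriv` against `exp(iξv)`. -/
noncomputable def oscTail (s : ℝ) (n : ℕ) (N : ℝ) (v σ : ℝ) : ℂ :=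
  ∫ ξ in Set.Ioi N, ((gaussAmpDeriv s n σ ξ : ℝ) : ℂ) * Complex.exp ((ξ * v : ℝ) * Complex.I)

lemma norm_oscTail_le {s s' : ℝ} (hs' : 0 < s') (hs : s' ≤ s) (n : ℕ) {N : ℝ} (hN : 1 ≤ N)
    (v σ : ℝ) : ‖oscTail s n N v σ‖ ≤ ampDerivBound s n * (N ^ (-s') / s') := by
  have h1 : ∫ ξ in Set.Ioi N, ampDerivBound s n * ξ ^ (-s' - 1) =
      ampDerivBound s n * (N ^ (-s') / s') := by
    rw [integral_const_mul, integral_Ioi_rpow_of_lt (by linarith) (by linarith)]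
    congr 1
    rw [show -s' - 1 + 1 = -s' by ring]
    field_simp
  rw [← h1]
  refine norm_integral_le_of_norm_le
    ((integrableOn_rpow_Ioi hs' hN).integrable.const_mul (ampDerivBound s n)) ?_
  filter_upwards [ae_restrict_mem measurableSet_Ioi] with ξ hξ
  rw [norm_mul, Complex.norm_exp_ofReal_mul_I, Complex.norm_real, mul_one]
  exact abs_gaussAmpDeriv_le hs n σ (hN.trans (le_of_lt hξ))

lemma continuous_oscTail {s : ℝ} (hs : 0 < s) (n : ℕ) :
    Continuous fun w : ℝ × ℝ => oscTail s n 1 w.1 w.2 := by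
  refine continuous_of_dominated (bound := fun ξ => ampDerivBound s n * ξ ^ (-s - 1))
    (fun w => ?_) (fun w => ?_)
    ((integrableOn_rpow_Ioi hs le_rfl).integrable.const_mul (ampDerivBound s n))
    (Eventually.of_forall fun ξ => ?_)
  · have hm := measurable_gaussAmpDeriv s n w.2
    exact Measurable.aestronglyMeasurable (by fun_prop)
  · filter_upwards [ae_restrict_mem measurableSet_Ioi] with ξ hξ
    rw [norm_mul, Complex.norm_exp_ofReal_mul_I, Complex.norm_real, mul_one]
    exact abs_gaussAmpDeriv_le le_rfl n _ (le_of_lt hξ)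
  · have h1 : ∀ n, Continuous fun w : ℝ × ℝ => hermiteGauss n (w.2 * ξ) := fun n =>
      (continuous_hermiteGauss n).comp (by fun_prop)
    have h2 := h1 n
    have h3 := h1 (n + 2)
    unfold gaussAmpDeriv
    fun_prop

lemma tendsto_gaussAmp {s : ℝ} (hs : 0 < s) (n : ℕ) (σ : ℝ) :
    Tendsto (gaussAmp s n σ) atTop (𝓝 0) := by
  have h1 : Tendsto (fun ξ : ℝ => hermiteBound n * ξ ^ (-s)) atTop (𝓝 0) := by
    simpa using (tendsto_rpow_neg_atTop hs).const_mul (hermiteBound n)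
  refine squeeze_zero_norm' ?_ h1
  filter_upwards [eventually_ge_atTop 1] with ξ hξ
  exact abs_gaussAmp_le le_rfl n σ hξ

/-- The left side relies on the Gaussian for absolute convergence. On the right the amplitude decays
like `ξ^{-s-1}` uniformly in `σ`, so that side keeps its meaning at `σ = 0`. -/
lemma integral_gaussAmp_by_parts {s : ℝ} (hs : 0 < s) (n : ℕ) {σ : ℝ} (hσ : σ ≠ 0) {v : ℝ}
    (hv : v ≠ 0) {N : ℝ} (hN : 1 ≤ N) :
    ∫ ξ in Set.Ioi N, ((gaussAmp s n σ ξ : ℝ) : ℂ) * Complex.exp ((ξ * v : ℝ) * Complex.I) =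
      Complex.I / v * ((gaussAmp s n σ N : ℂ) * Complex.exp ((N * v : ℝ) * Complex.I) +
        oscTail s n N v σ) := by
  have hd : ∀ ξ : ℝ, 0 < ξ → HasDerivAt (fun ξ : ℝ => ((gaussAmp s n σ ξ : ℝ) : ℂ) *
      Complex.exp ((ξ * v : ℝ) * Complex.I))
      (((gaussAmpDeriv s n σ ξ : ℝ) : ℂ) * Complex.exp ((ξ * v : ℝ) * Complex.I) +
        (v * Complex.I) * (((gaussAmp s n σ ξ : ℝ) : ℂ) *
          Complex.exp ((ξ * v : ℝ) * Complex.I))) ξ := by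
    intro ξ hξ
    have h1 := (hasDerivAt_gaussAmp s n σ hξ).ofReal_comp
    have h2 := ((((hasDerivAt_id ξ).mul_const v).ofReal_comp).mul_const Complex.I).cexp
    refine (h1.mul h2).congr_deriv ?_
    simp only [id, one_mul]
    ring
  have hi1 := integrable_gaussAmpDeriv hs n σ v hN
  have hi2 := integrable_gaussAmp hs n hσ v hN
  have key := integral_Ioi_of_hasDerivAt_of_tendsto (m := 0)
    (hd N (by linarith)).continuousAt.continuousWithinAt
    (fun ξ hξ => hd ξ (lt_of_lt_of_le (by linarith : (0 : ℝ) < N) (le_of_lt hξ)))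
    (hi1.add (hi2.integrable.const_mul _)) ?_
  · rw [integral_add hi1 (hi2.integrable.const_mul _), integral_const_mul] at key
    have hv' : (v : ℂ) ≠ 0 := by exact_mod_cast hv
    rw [oscTail]
    set X := ∫ ξ in Set.Ioi N, ((gaussAmp s n σ ξ : ℝ) : ℂ) *
      Complex.exp ((ξ * v : ℝ) * Complex.I)
    have e : (gaussAmp s n σ N : ℂ) * Complex.exp ((N * v : ℝ) * Complex.I) +
        ∫ ξ in Set.Ioi N, ((gaussAmpDeriv s n σ ξ : ℝ) : ℂ) *
          Complex.exp ((ξ * v : ℝ) * Complex.I) = -(v * Complex.I * X) := by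
      linear_combination key
    rw [e, show Complex.I / v * -(v * Complex.I * X) =
      -(Complex.I * Complex.I) * X * (v / v) by ring, Complex.I_mul_I, div_self hv']
    ring
  · refine squeeze_zero_norm (fun ξ => ?_) (tendsto_norm_zero.comp (tendsto_gaussAmp hs n σ))
    rw [norm_mul, Complex.norm_exp_ofReal_mul_I, Complex.norm_real, mul_one]
    rfl

/-- The kernel `∫₁^∞ ξ^{-s} ηₙ(σξ) exp(iξv) dξ`, integrated by parts so that it makes sense
for `σ = 0`. -/
noncomputable def oscKernel (s : ℝ) (n : ℕ) (v σ : ℝ) : ℂ :=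
  Complex.I / v * ((gaussAmp s n σ 1 : ℂ) * Complex.exp ((1 * v : ℝ) * Complex.I) +
    oscTail s n 1 v σ)

lemma continuous_gaussAmp_one (s : ℝ) (n : ℕ) : Continuous fun σ => gaussAmp s n σ 1 := by
  have h1 : Continuous fun σ : ℝ => hermiteGauss n (σ * 1) :=
    (continuous_hermiteGauss n).comp (by fun_prop)
  unfold gaussAmp; fun_prop

lemma continuousAt_oscKernel {s : ℝ} (hs : 0 < s) (n : ℕ) {w : ℝ × ℝ} (hw : w.1 ≠ 0) :
    ContinuousAt (fun w : ℝ × ℝ => oscKernel s n w.1 w.2) w := by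
  have h1 : Continuous fun w : ℝ × ℝ => (gaussAmp s n w.2 1 : ℂ) *
      Complex.exp ((1 * w.1 : ℝ) * Complex.I) + oscTail s n 1 w.1 w.2 := by
    have := continuous_oscTail hs n
    have := (continuous_gaussAmp_one s n).comp (continuous_snd (X := ℝ) (Y := ℝ))
    simp only [Function.comp_def] at this
    fun_prop
  refine ContinuousAt.mul (ContinuousAt.div continuousAt_const ?_ ?_) h1.continuousAt
  · exact (Complex.continuous_ofReal.comp continuous_fst).continuousAt
  · exact_mod_cast hw

lemma measurable_oscKernel {s : ℝ} (hs : 0 < s) (n : ℕ) (σ : ℝ) :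
    Measurable fun v => oscKernel s n v σ := by
  have h1 : Continuous fun v : ℝ => oscTail s n 1 v σ :=
    (continuous_oscTail hs n).comp (by fun_prop : Continuous fun v : ℝ => (v, σ))
  have h2 := h1.measurable
  unfold oscKernel
  fun_prop

/-- The constant in `norm_oscKernel_le`. -/
noncomputable def oscBound (s s' : ℝ) (n : ℕ) : ℝ :=
  hermiteBound n / (1 - s') + hermiteBound n + ampDerivBound s n / s'

/-- The integral is cut at `N = max(1, 1/|v|)`. Below `N` absolute values give `∫ ξ^{-s'} ≲
N^{1-s'}`; above `N`, integration by parts gains `1/|v| ≤ N` against an amplitude of size `N^{-s'}`.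
-/
lemma norm_oscKernel_le_of_ne {s s' : ℝ} (hs' : 0 < s') (hs : s' ≤ s) (hs1 : s' < 1) (n : ℕ)
    {v : ℝ} (hv : v ≠ 0) {σ : ℝ} (hσ : σ ≠ 0) :
    ‖oscKernel s n v σ‖ ≤ oscBound s s' n * (max 1 |v|⁻¹) ^ (1 - s') := by
  have hs0 : 0 < s := hs'.trans_le hs
  set N : ℝ := max 1 |v|⁻¹ with hNdef
  have hN : 1 ≤ N := le_max_left _ _
  have hN0 : 0 < N := by linarith
  have hvN : |v|⁻¹ ≤ N := le_max_right _ _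
  have hHB := hermiteBound_pos n
  have hAB := ampDerivBound_pos s n
  have e1 := integral_gaussAmp_by_parts hs0 n hσ hv (le_refl 1)
  have e2 := integral_gaussAmp_by_parts hs0 n hσ hv hN
  have hsplit := setIntegral_union (μ := volume) (f := fun ξ => ((gaussAmp s n σ ξ : ℝ) : ℂ) *
    Complex.exp ((ξ * v : ℝ) * Complex.I)) (Set.Ioc_disjoint_Ioi (le_refl N) : Disjoint
      (Set.Ioc 1 N) (Set.Ioi N)) measurableSet_Ioi
    ((integrable_gaussAmp hs0 n hσ v (le_refl 1)).mono_set Set.Ioc_subset_Ioi_self)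
    (integrable_gaussAmp hs0 n hσ v hN)
  rw [Set.Ioc_union_Ioi_eq_Ioi hN, e1, e2] at hsplit
  have hpow : N ^ (1 - s') = N * N ^ (-s') := by
    rw [sub_eq_add_neg, Real.rpow_add hN0, Real.rpow_one]
  have hNs : 0 < N ^ (-s') := Real.rpow_pos_of_pos hN0 _
  have b1 : ‖∫ ξ in Set.Ioc 1 N, ((gaussAmp s n σ ξ : ℝ) : ℂ) *
      Complex.exp ((ξ * v : ℝ) * Complex.I)‖ ≤ hermiteBound n / (1 - s') * N ^ (1 - s') := by
    have hint : IntervalIntegrable (fun ξ : ℝ => hermiteBound n * ξ ^ (-s')) volume 1 N :=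
      (intervalIntegral.intervalIntegrable_rpow' (by linarith)).const_mul _
    have h2 : ∫ ξ in Set.Ioc 1 N, hermiteBound n * ξ ^ (-s') ≤
        hermiteBound n / (1 - s') * N ^ (1 - s') := by
      rw [integral_const_mul, ← intervalIntegral.integral_of_le hN,
        integral_rpow (Or.inl (by linarith)), Real.one_rpow, show -s' + 1 = 1 - s' by ring,
        div_mul_eq_mul_div, ← mul_div_assoc]
      have : 0 < 1 - s' := by linarith
      gcongr
      linarith
    refine le_trans (norm_integral_le_of_norm_le
      ((intervalIntegrable_iff_integrableOn_Ioc_of_le hN).1 hint) ?_) h2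
    filter_upwards [ae_restrict_mem measurableSet_Ioc] with ξ hξ
    rw [norm_mul, Complex.norm_exp_ofReal_mul_I, Complex.norm_real, mul_one]
    exact abs_gaussAmp_le hs n σ hξ.1.le
  have b2 : ‖Complex.I / v * ((gaussAmp s n σ N : ℂ) * Complex.exp ((N * v : ℝ) * Complex.I) +
        oscTail s n N v σ)‖ ≤ N * (hermiteBound n * N ^ (-s') +
          ampDerivBound s n * (N ^ (-s') / s')) := by
    rw [norm_mul, norm_div, Complex.norm_I, Complex.norm_real, one_div, Real.norm_eq_abs]
    have h3 := norm_oscTail_le hs' hs n hN v σ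
    have h4 := abs_gaussAmp_le hs n σ hN
    gcongr
    refine (norm_add_le _ _).trans (add_le_add ?_ h3)
    rw [norm_mul, Complex.norm_exp_ofReal_mul_I, Complex.norm_real, mul_one]
    exact h4
  have hk : oscKernel s n v σ = Complex.I / v * ((gaussAmp s n σ 1 : ℂ) *
    Complex.exp ((1 * v : ℝ) * Complex.I) + oscTail s n 1 v σ) := rfl
  rw [hk, hsplit]
  refine (norm_add_le _ _).trans ((add_le_add b1 b2).trans (le_of_eq ?_))
  rw [oscBound, hpow]
  field_simp
  ring

lemma norm_oscKernel_le {s s' : ℝ} (hs' : 0 < s') (hs : s' ≤ s) (hs1 : s' < 1) (n : ℕ)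
    {v : ℝ} (hv : v ≠ 0) (σ : ℝ) :
    ‖oscKernel s n v σ‖ ≤ oscBound s s' n * (max 1 |v|⁻¹) ^ (1 - s') := by
  rcases ne_or_eq σ 0 with hσ | rfl
  · exact norm_oscKernel_le_of_ne hs' hs hs1 n hv hσ
  · have hc : ContinuousAt (fun σ : ℝ => oscKernel s n v σ) 0 :=
      (continuousAt_oscKernel (hs'.trans_le hs) n (w := (v, 0)) hv).comp
        (f := fun σ : ℝ => (v, σ)) (by fun_prop)
    refine le_of_tendsto (f := fun σ : ℝ => ‖oscKernel s n v σ‖) (x := 𝓝[≠] (0 : ℝ))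
      (hc.norm.tendsto.mono_left nhdsWithin_le_nhds) ?_
    filter_upwards [self_mem_nhdsWithin] with σ hσ
    exact norm_oscKernel_le_of_ne hs' hs hs1 n hv hσ

/-! ### Fourier transform of the signal. -/

/-- The Fourier transform `ξ ↦ ∫ f(y) exp(-iξy) dy` of a real signal. -/
noncomputable def signalHat (f : ℝ → ℝ) (ξ : ℝ) : ℂ :=
  ∫ y : ℝ, (f y : ℂ) * Complex.exp ((-(ξ * y) : ℝ) * Complex.I)

lemma integrable_signalHat {f : ℝ → ℝ} (hf : Integrable f) (ξ : ℝ) :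
    Integrable fun y : ℝ => (f y : ℂ) * Complex.exp ((-(ξ * y) : ℝ) * Complex.I) := by
  refine hf.ofReal.mul_bdd (c := 1) (Measurable.aestronglyMeasurable (by fun_prop))
    (Eventually.of_forall fun y => ?_)
  rw [Complex.norm_exp_ofReal_mul_I]

lemma continuous_signalHat {f : ℝ → ℝ} (hf : Integrable f) : Continuous (signalHat f) := by
  refine continuous_of_dominated (bound := fun y => |f y|)
    (fun ξ => (integrable_signalHat hf ξ).aestronglyMeasurable) (fun ξ => ?_) hf.abs
    (Eventually.of_forall fun y => by fun_prop)
  refine Eventually.of_forall fun y => ?_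
  rw [norm_mul, Complex.norm_exp_ofReal_mul_I, Complex.norm_real, mul_one]
  rfl

lemma norm_signalHat_le {f : ℝ → ℝ} (hf : Integrable f) (ξ : ℝ) :
    ‖signalHat f ξ‖ ≤ ∫ y, |f y| := by
  refine norm_integral_le_of_norm_le hf.abs (Eventually.of_forall fun y => ?_)
  rw [norm_mul, Complex.norm_exp_ofReal_mul_I, Complex.norm_real, mul_one]
  rfl

lemma signalHat_deriv {f : ℝ → ℝ} (hd : Differentiable ℝ f) (hf : Integrable f)
    (hf' : Integrable (deriv f)) (ξ : ℝ) :
    signalHat (deriv f) ξ = Complex.I * ξ * signalHat f ξ := by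
  have h := integral_mul_deriv_eq_deriv_mul_of_integrable
    (u := fun y : ℝ => Complex.exp ((-(ξ * y) : ℝ) * Complex.I))
    (u' := fun y : ℝ => Complex.exp ((-(ξ * y) : ℝ) * Complex.I) * ((-ξ : ℝ) * Complex.I))
    (v := fun y => (f y : ℂ)) (v' := fun y => ((deriv f y : ℝ) : ℂ)) (fun y _ => ?_)
    (fun y _ => (hd y).hasDerivAt.ofReal_comp) ?_ ?_ ?_
  · unfold signalHat
    rw [← integral_const_mul]
    simp only [mul_comm (Complex.exp _)] at h
    rw [h, ← integral_neg]
    refine integral_congr_ae (Eventually.of_forall fun y => ?_)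
    simp only
    push_cast
    ring
  · have h1 := ((((hasDerivAt_id y).const_mul ξ).neg.ofReal_comp).mul_const Complex.I).cexp
    refine h1.congr_deriv ?_
    simp
  · refine (integrable_signalHat hf' ξ).congr (Eventually.of_forall fun y => ?_)
    simp [mul_comm]
  · refine ((integrable_signalHat hf ξ).mul_const ((-ξ : ℝ) * Complex.I)).congr
      (Eventually.of_forall fun y => ?_)
    simp only [Pi.mul_apply]
    ring
  · refine (integrable_signalHat hf ξ).congr (Eventually.of_forall fun y => ?_)
    simp [mul_comm]

lemma IsIntegrableSignal.signalHat_iteratedDeriv {f : ℝ → ℝ} {m : ℕ}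
    (hf : IsIntegrableSignal m f) (ξ : ℝ) : ∀ i ≤ m,
    signalHat (iteratedDeriv i f) ξ = (Complex.I * ξ) ^ i * signalHat f ξ := by
  intro i
  induction i with
  | zero => simp
  | succ i ih =>
    intro hi
    have hd : Differentiable ℝ (iteratedDeriv i f) :=
      hf.1.differentiable_iteratedDeriv i (by exact_mod_cast hi)
    rw [iteratedDeriv_succ, signalHat_deriv hd (hf.2 i (by omega))
      (by rw [← iteratedDeriv_succ]; exact hf.2 (i + 1) hi), ih (by omega), pow_succ]
    ring

lemma IsIntegrableSignal.integrable {f : ℝ → ℝ} {m : ℕ} (hf : IsIntegrableSignal m f) :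
    Integrable f := by
  simpa using hf.2 0 (Nat.zero_le m)

lemma IsIntegrableSignal.hasDecay {f : ℝ → ℝ} {m : ℕ} (hf : IsIntegrableSignal m f) :
    ∃ B, HasDecay (signalHat f) m B := by
  refine ⟨max (∫ y, |f y|) (∫ y, |iteratedDeriv m f y|), continuous_signalHat hf.integrable,
    fun ξ => (norm_signalHat_le hf.integrable ξ).trans (le_max_left _ _), fun ξ hξ => ?_⟩
  have h := norm_signalHat_le (hf.2 m le_rfl) ξ
  rw [hf.signalHat_iteratedDeriv ξ m le_rfl, norm_mul, norm_pow, norm_mul, Complex.norm_I,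
    one_mul, Complex.norm_real, Real.norm_eq_abs, abs_of_pos hξ] at h
  exact h.trans (le_max_right _ _)

/-! ### Regularity of the transform across the axis. -/

/-- The cut-off `(1 - |v|)₊`. -/
noncomputable def tentCut (v : ℝ) : ℝ := 1 - min 1 |v|

lemma continuous_tentCut : Continuous tentCut := by unfold tentCut; fun_prop

/-- The kernel is `O(|v|^{s'-1})` near `v = 0`, hence locally integrable. The translation is carried
by the continuous `g`, so that for fixed `v ≠ 0` the singularity does not move with `z`. -/
lemma continuous_near {g : ℝ → ℝ} (hg : Continuous g) {s : ℝ} (hs : 0 < s) (n : ℕ) :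
    Continuous fun z : ℝ × ℝ =>
      ∫ v : ℝ, ((g (z.1 - v) * tentCut v : ℝ) : ℂ) * oscKernel s n v z.2 := by
  rw [continuous_iff_continuousAt]
  intro z₀
  -- Positivity makes `|v|^{s'-1}` locally integrable; `s' < 1` is required by `norm_oscKernel_le`.
  set s' : ℝ := min s (1 / 2)
  have hs' : 0 < s' := lt_min hs (by norm_num)
  have hs's : s' ≤ s := min_le_left _ _
  have hs1 : s' < 1 := (min_le_right s (1 / 2)).trans_lt (by norm_num)
  obtain ⟨A, hA⟩ := (isCompact_Icc (a := z₀.1 - 2) (b := z₀.1 + 2)).exists_bound_of_continuousOn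
    hg.continuousOn
  have hA0 : 0 ≤ A := (norm_nonneg _).trans (hA z₀.1 (by constructor <;> linarith))
  have htc := continuous_tentCut
  have hW : IntegrableOn (fun v : ℝ => |v| ^ (s' - 1)) (Set.Icc (-1) 1) := by
    have h1 : IntegrableOn (fun v : ℝ => |v| ^ (s' - 1)) (Set.Ioc 0 1) := by
      have := (intervalIntegrable_iff_integrableOn_Ioc_of_le zero_le_one).1
        (intervalIntegral.intervalIntegrable_rpow' (a := 0) (b := 1)
          (show -1 < s' - 1 by linarith))
      refine this.congr_fun (fun v hv => ?_) measurableSet_Ioc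
      simp only [abs_of_pos hv.1]
    have h2 : IntegrableOn (fun v : ℝ => |v| ^ (s' - 1)) (Set.Ico (-1) 0) := by
      have := h1.comp_neg
      simpa using this
    have h3 : IntegrableOn (fun v : ℝ => |v| ^ (s' - 1)) {0} := by simp
    refine ((h1.union h2).union h3).mono_set fun v hv => ?_
    rcases lt_trichotomy v 0 with h | h | h
    · exact Or.inl (Or.inr ⟨hv.1, h⟩)
    · exact Or.inr h
    · exact Or.inl (Or.inl ⟨h, hv.2⟩)
  have hbd : Integrable ((Set.Icc (-1 : ℝ) 1).indicator
      fun v : ℝ => A * (oscBound s s' n * |v| ^ (s' - 1))) :=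
    (integrable_indicator_iff measurableSet_Icc).2 ((hW.integrable.const_mul _).const_mul _)
  have hC0 : 0 ≤ oscBound s s' n := by
    have h1 := hermiteBound_pos n
    have h2 := ampDerivBound_pos s n
    have h3 : 0 < 1 - s' := by linarith
    unfold oscBound; positivity
  have hne : ∀ᵐ v : ℝ, v ≠ 0 := by simp [ae_iff]
  refine continuousAt_of_dominated ?_ ?_ hbd ?_
  · refine Eventually.of_forall fun z => ?_
    have := measurable_oscKernel hs n z.2
    exact Measurable.aestronglyMeasurable (by
      have := hg.measurable
      have := htc.measurable
      fun_prop)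
  · have hnb : ∀ᶠ z : ℝ × ℝ in 𝓝 z₀, |z.1 - z₀.1| < 1 := by
      have : ContinuousAt (fun z : ℝ × ℝ => |z.1 - z₀.1|) z₀ := by fun_prop
      exact this.eventually_lt continuousAt_const (by simp)
    filter_upwards [hnb] with z hz
    filter_upwards [hne] with v hv
    rw [norm_mul, Complex.norm_real, norm_mul]
    by_cases hv1 : v ∈ Set.Icc (-1 : ℝ) 1
    · rw [Set.indicator_of_mem hv1]
      have hva : |v| ≤ 1 := abs_le.2 hv1
      have hva0 : 0 < |v| := abs_pos.2 hv
      have h1 : ‖g (z.1 - v)‖ ≤ A := hA _ (by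
        rw [abs_lt] at hz
        constructor <;> linarith [hz.1, hz.2, hv1.1, hv1.2])
      have h2 : ‖tentCut v‖ ≤ 1 := by
        rw [tentCut, min_eq_right hva, Real.norm_eq_abs, abs_le]
        constructor <;> linarith
      have h3 := norm_oscKernel_le hs' hs's hs1 n hv z.2
      rw [max_eq_right ((one_le_inv₀ hva0).2 hva), Real.inv_rpow hva0.le,
        ← Real.rpow_neg hva0.le, neg_sub] at h3
      calc ‖g (z.1 - v)‖ * ‖tentCut v‖ * ‖oscKernel s n v z.2‖
          ≤ A * 1 * (oscBound s s' n * |v| ^ (s' - 1)) := by gcongr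
        _ = _ := by ring
    · rw [Set.indicator_of_notMem hv1]
      have : 1 ≤ |v| := by
        by_contra hcon
        exact hv1 (abs_le.1 (not_le.1 hcon).le)
      simp [tentCut, min_eq_left this]
  · filter_upwards [hne] with v hv
    have h1 : ContinuousAt (fun z : ℝ × ℝ => oscKernel s n v z.2) z₀ :=
      (continuousAt_oscKernel hs n (w := (v, z₀.2)) hv).comp
        (f := fun z : ℝ × ℝ => (v, z.2)) (by fun_prop)
    have h2 : Continuous fun z : ℝ × ℝ => ((g (z.1 - v) * tentCut v : ℝ) : ℂ) := by fun_prop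
    exact h2.continuousAt.mul h1

/-- The factor `1 - tentCut v = min(1, |v|)` cancels the bound `max(1, 1/|v|)` for the kernel, so
integrability of `g` alone gives domination. Here the translation falls on the kernel, continuous
away from `v = 0`. -/
lemma continuous_far {g : ℝ → ℝ} (hg : Integrable g) {s : ℝ} (hs : 0 < s) (n : ℕ) :
    Continuous fun z : ℝ × ℝ =>
      ∫ y : ℝ, ((g y * (1 - tentCut (z.1 - y)) : ℝ) : ℂ) * oscKernel s n (z.1 - y) z.2 := by
  rw [continuous_iff_continuousAt]
  intro z₀
  set s' : ℝ := min s (1 / 2)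
  have hs' : 0 < s' := lt_min hs (by norm_num)
  have hs's : s' ≤ s := min_le_left _ _
  have hs1 : s' < 1 := (min_le_right s (1 / 2)).trans_lt (by norm_num)
  have htc := continuous_tentCut
  have hC0 : 0 ≤ oscBound s s' n := by
    have h1 := hermiteBound_pos n
    have h2 := ampDerivBound_pos s n
    have h3 : 0 < 1 - s' := by linarith
    unfold oscBound; positivity
  have hne : ∀ x : ℝ, ∀ᵐ y : ℝ, x - y ≠ 0 := fun x => by
    have : ∀ᵐ y : ℝ, y ≠ x := by simp [ae_iff]
    filter_upwards [this] with y hy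
    exact sub_ne_zero.2 hy.symm
  refine continuousAt_of_dominated (bound := fun y => oscBound s s' n * |g y|) ?_ ?_
    (hg.abs.const_mul _) ?_
  · refine Eventually.of_forall fun z => ?_
    have h1 : AEStronglyMeasurable (fun y : ℝ => (1 - tentCut (z.1 - y))) volume :=
      (Continuous.aestronglyMeasurable (by fun_prop))
    have h2 : AEStronglyMeasurable (fun y : ℝ => oscKernel s n (z.1 - y) z.2) volume :=
      ((measurable_oscKernel hs n z.2).comp
        (measurable_const.sub measurable_id)).aestronglyMeasurable
    exact (Complex.continuous_ofReal.comp_aestronglyMeasurable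
      (hg.aestronglyMeasurable.mul h1)).mul h2
  · refine Eventually.of_forall fun z => ?_
    filter_upwards [hne z.1] with y hy
    rw [norm_mul, Complex.norm_real, norm_mul, Real.norm_eq_abs, Real.norm_eq_abs]
    have h3 := norm_oscKernel_le hs' hs's hs1 n hy z.2
    set v := z.1 - y
    have hv0 : 0 < |v| := abs_pos.2 hy
    have h4 : (max 1 |v|⁻¹) ^ (1 - s') ≤ max 1 |v|⁻¹ :=
      (Real.rpow_le_rpow_of_exponent_le (le_max_left _ _) (by linarith)).trans
        (Real.rpow_one _).le
    have h5 : |1 - tentCut v| * max 1 |v|⁻¹ ≤ 1 := by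
      rw [tentCut, sub_sub_cancel, abs_of_nonneg (by positivity)]
      rcases le_total |v| 1 with h | h
      · rw [min_eq_right h, max_eq_right ((one_le_inv₀ hv0).2 h), mul_inv_cancel₀ hv0.ne']
      · rw [min_eq_left h, max_eq_left (inv_le_one_of_one_le₀ h), one_mul]
    calc |g y| * |1 - tentCut v| * ‖oscKernel s n v z.2‖
        ≤ |g y| * |1 - tentCut v| * (oscBound s s' n * max 1 |v|⁻¹) := by
          gcongr; exact h3.trans (by gcongr)
      _ = oscBound s s' n * |g y| * (|1 - tentCut v| * max 1 |v|⁻¹) := by ring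
      _ ≤ oscBound s s' n * |g y| * 1 := by gcongr
      _ = _ := mul_one _
  · filter_upwards [hne z₀.1] with y hy
    have h1 : ContinuousAt (fun z : ℝ × ℝ => oscKernel s n (z.1 - y) z.2) z₀ :=
      (continuousAt_oscKernel hs n (w := (z₀.1 - y, z₀.2)) hy).comp
        (f := fun z : ℝ × ℝ => (z.1 - y, z.2)) (by fun_prop)
    have h2 : Continuous fun z : ℝ × ℝ => ((g y * (1 - tentCut (z.1 - y)) : ℝ) : ℂ) := by
      fun_prop
    exact h2.continuousAt.mul h1

lemma exists_bound_oscKernel {s : ℝ} (hs : 0 < s) (n : ℕ)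
    {z : ℝ × ℝ} (hz : z.2 ≠ 0) :
    ∃ C, ∀ v : ℝ, v ≠ 0 → ‖oscKernel s n v z.2‖ ≤ C := by
  refine ⟨∫ ξ in Set.Ioi 1, ‖((gaussAmp s n z.2 ξ : ℝ) : ℂ) *
    Complex.exp ((ξ * 0 : ℝ) * Complex.I)‖, fun v hv => ?_⟩
  rw [show oscKernel s n v z.2 = _ from (integral_gaussAmp_by_parts hs n hz hv le_rfl).symm]
  refine (norm_integral_le_integral_norm _).trans (le_of_eq ?_)
  refine integral_congr_ae (Eventually.of_forall fun ξ => ?_)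
  simp only [norm_mul, Complex.norm_exp_ofReal_mul_I]

lemma near_add_far {g : ℝ → ℝ} (hg : Integrable g) {s : ℝ} (hs : 0 < s)
    (n : ℕ) {z : ℝ × ℝ} (hz : z.2 ≠ 0) :
    (∫ v : ℝ, ((g (z.1 - v) * tentCut v : ℝ) : ℂ) * oscKernel s n v z.2) +
      ∫ y : ℝ, ((g y * (1 - tentCut (z.1 - y)) : ℝ) : ℂ) * oscKernel s n (z.1 - y) z.2 =
    ∫ y : ℝ, (g y : ℂ) * oscKernel s n (z.1 - y) z.2 := by
  have e := integral_sub_left_eq_self (μ := volume)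
    (fun v : ℝ => ((g (z.1 - v) * tentCut v : ℝ) : ℂ) * oscKernel s n v z.2) z.1
  simp only [sub_sub_cancel] at e
  obtain ⟨C, hC⟩ := exists_bound_oscKernel hs n hz
  have htc := continuous_tentCut
  have hne : ∀ᵐ y : ℝ, z.1 - y ≠ 0 := by
    have : ∀ᵐ y : ℝ, y ≠ z.1 := by simp [ae_iff]
    filter_upwards [this] with y hy
    exact sub_ne_zero.2 hy.symm
  have hK : AEStronglyMeasurable (fun y : ℝ => oscKernel s n (z.1 - y) z.2) volume :=
      ((measurable_oscKernel hs n z.2).comp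
        (measurable_const.sub measurable_id)).aestronglyMeasurable
  have hI : ∀ τ : ℝ → ℝ, Continuous τ → (∀ v, |τ v| ≤ 1) → Integrable fun y : ℝ =>
      ((g y * τ (z.1 - y) : ℝ) : ℂ) * oscKernel s n (z.1 - y) z.2 := by
    intro τ hτ hτ1
    refine Integrable.mul_bdd (c := C) ?_ hK ?_
    · refine Integrable.ofReal (𝕜 := ℂ) (hg.mul_bdd (c := 1)
        (Continuous.aestronglyMeasurable (by fun_prop)) (Eventually.of_forall fun y => hτ1 _))
    · filter_upwards [hne] with y hy using hC _ hy
  have ht1 : ∀ v, |tentCut v| ≤ 1 ∧ |1 - tentCut v| ≤ 1 := fun v => by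
    have h1 : min 1 |v| ≤ 1 := min_le_left _ _
    have h2 : 0 ≤ min 1 |v| := by positivity
    rw [tentCut, abs_le, abs_le]
    refine ⟨⟨?_, ?_⟩, ?_, ?_⟩ <;> linarith
  rw [← e, ← integral_add (hI tentCut htc fun v => (ht1 v).1)
    (hI (fun v => 1 - tentCut v) (by fun_prop) fun v => (ht1 v).2)]
  refine integral_congr_ae (Eventually.of_forall fun y => ?_)
  simp only
  push_cast
  ring

/-- Fubini, legitimate because for `σ ≠ 0` the amplitude is absolutely integrable; multiplication by
the amplitude becomes convolution with its oscillatory kernel. -/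
lemma highFreq_eq {g : ℝ → ℝ} (hg : Integrable g) {s : ℝ} (hs : 0 < s)
    (n : ℕ) {z : ℝ × ℝ} (hz : z.2 ≠ 0) :
    ∫ ξ in Set.Ioi (1 : ℝ), ((gaussAmp s n z.2 ξ : ℝ) : ℂ) *
      Complex.exp ((ξ * z.1 : ℝ) * Complex.I) * signalHat g ξ =
    ∫ y : ℝ, (g y : ℂ) * oscKernel s n (z.1 - y) z.2 := by
  have hne : ∀ᵐ y : ℝ, z.1 - y ≠ 0 := by
    have : ∀ᵐ y : ℝ, y ≠ z.1 := by simp [ae_iff]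
    filter_upwards [this] with y hy
    exact sub_ne_zero.2 hy.symm
  have hprod : Integrable (Function.uncurry fun (ξ y : ℝ) => ((gaussAmp s n z.2 ξ : ℝ) : ℂ) *
      Complex.exp ((ξ * z.1 : ℝ) * Complex.I) *
      ((g y : ℂ) * Complex.exp ((-(ξ * y) : ℝ) * Complex.I)))
      ((volume.restrict (Set.Ioi (1 : ℝ))).prod volume) := by
    have h1 := (integrable_gaussAmp hs n hz z.1 le_rfl).integrable.mul_prod
      (hg.ofReal (𝕜 := ℂ))
    refine (h1.mul_bdd (c := 1) (g := fun w : ℝ × ℝ =>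
      Complex.exp ((-(w.1 * w.2) : ℝ) * Complex.I)) ?_ ?_).congr ?_
    · exact Continuous.aestronglyMeasurable (by fun_prop)
    · exact Eventually.of_forall fun w => by rw [Complex.norm_exp_ofReal_mul_I]
    · refine Eventually.of_forall fun w => ?_
      simp only [Function.uncurry]
      simp only [mul_assoc]
      rfl
  have h2 := integral_integral_swap hprod
  simp only [integral_const_mul] at h2
  unfold signalHat
  rw [h2]
  refine integral_congr_ae ?_
  filter_upwards [hne] with y hy
  rw [show oscKernel s n (z.1 - y) z.2 = _ from
    (integral_gaussAmp_by_parts hs n hz hy le_rfl).symm, ← integral_const_mul]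
  refine integral_congr_ae (Eventually.of_forall fun ξ => ?_)
  have : Complex.exp ((ξ * (z.1 - y) : ℝ) * Complex.I) =
      Complex.exp ((ξ * z.1 : ℝ) * Complex.I) * Complex.exp ((-(ξ * y) : ℝ) * Complex.I) := by
    rw [← Complex.exp_add]; congr 1; push_cast; ring
  simp only [this]
  ring

/-- Off the axis, `gaussTransform` is the restriction of a function continuous on the plane, as
soon as the signal has more than `Q` integrable derivatives. -/
lemma exists_continuous_gaussTransform {f : ℝ → ℝ} {m : ℕ} (hf : IsIntegrableSignal m f) {Q : ℝ}
    (hQ : -1 < Q) (hm : Q < m) (n : ℕ) :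
    ∃ G : ℝ × ℝ → ℂ, Continuous G ∧ ∀ z : ℝ × ℝ, z.2 ≠ 0 →
      G z = gaussTransform (signalHat f) Q n z := by
  obtain ⟨B, hB⟩ := hf.hasDecay
  set g := iteratedDeriv m f with hgdef
  have hgi : Integrable g := hf.2 m le_rfl
  have hgc : Continuous g := hf.1.continuous_iteratedDeriv m le_rfl
  -- For `ξ > 0` one has `ξ^Q f̂(ξ) = i^{-m} ξ^{-s} ĝ(ξ)`. Thus the high frequencies become a
  -- convolution of `g` with `oscKernel s n`, for which any `s > 0` is enough.
  set s : ℝ := m - Q with hsdef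
  have hs : 0 < s := by rw [hsdef]; linarith
  have hB0 : 0 ≤ B := (norm_nonneg _).trans (hB.bound 0)
  have hlow : Continuous fun z : ℝ × ℝ =>
      ∫ ξ in Set.Ioc (0 : ℝ) 1, gaussIntegrand (signalHat f) Q n z ξ := by
    refine continuous_of_dominated (bound := fun ξ => hermiteBound n * B * ξ ^ Q)
      (fun z => (measurable_gaussIntegrand hB.cont Q n z).aestronglyMeasurable) (fun z => ?_)
      (((intervalIntegrable_iff_integrableOn_Ioc_of_le zero_le_one).1
        (intervalIntegral.intervalIntegrable_rpow' hQ)).integrable.const_mul _)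
      (Eventually.of_forall fun ξ => continuous_gaussIntegrand _ Q n ξ)
    filter_upwards [ae_restrict_mem measurableSet_Ioc] with ξ hξ
    have h0 : (0 : ℝ) < ξ ^ Q := Real.rpow_pos_of_pos hξ.1 _
    rw [norm_gaussIntegrand _ Q n z hξ.1]
    have h1 := hB.bound ξ
    have h2 := abs_hermiteGauss_le_bound n (z.2 * ξ)
    have h3 := hermiteBound_pos n
    calc _ ≤ ξ ^ Q * hermiteBound n * B := by gcongr
      _ = _ := by ring
  refine ⟨fun z => (∫ ξ in Set.Ioc (0 : ℝ) 1, gaussIntegrand (signalHat f) Q n z ξ) +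
    (Complex.I ^ m)⁻¹ *
      ((∫ v : ℝ, ((g (z.1 - v) * tentCut v : ℝ) : ℂ) * oscKernel s n v z.2) +
      ∫ y : ℝ, ((g y * (1 - tentCut (z.1 - y)) : ℝ) : ℂ) * oscKernel s n (z.1 - y) z.2),
    hlow.add (continuous_const.mul ((continuous_near hgc hs n).add (continuous_far hgi hs n))),
    fun z hz => ?_⟩
  simp only
  rw [near_add_far hgi hs n hz, ← highFreq_eq hgi hs n hz, gaussTransform,
    ← Set.Ioc_union_Ioi_eq_Ioi (zero_le_one (α := ℝ)),
    setIntegral_union (Set.Ioc_disjoint_Ioi le_rfl) measurableSet_Ioi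
      ((integrable_gaussIntegrand_offAxis hB.cont hB.bound hQ n hz).mono_set
        Set.Ioc_subset_Ioi_self)
      ((integrable_gaussIntegrand_offAxis hB.cont hB.bound hQ n hz).mono_set
        (Set.Ioi_subset_Ioi zero_le_one)), ← integral_const_mul]
  congr 1
  refine setIntegral_congr_fun measurableSet_Ioi fun ξ (hξ : 1 < ξ) => ?_
  have hξ0 : 0 < ξ := by linarith
  have hI : Complex.I ^ m ≠ 0 := pow_ne_zero _ Complex.I_ne_zero
  have hp : ξ ^ Q = ξ ^ (-s) * ξ ^ m := by
    rw [← Real.rpow_natCast, ← Real.rpow_add hξ0, hsdef]; congr 1; ring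
  simp only [gaussIntegrand, gaussAmp]
  rw [hgdef, hf.signalHat_iteratedDeriv ξ m le_rfl, hp]
  push_cast
  rw [mul_pow]
  field_simp

lemma dense_offAxis : Dense {z : ℝ × ℝ | z.2 ≠ 0} := by
  have h : {z : ℝ × ℝ | z.2 ≠ 0} = Set.univ ×ˢ {0}ᶜ := by ext; simp
  rw [h]
  exact dense_univ.prod (dense_compl_singleton 0)

/-- The induction carries an extension `G` rather than the transform itself: at the top order the
defining integral need not converge absolutely on the axis. -/
lemma exists_contDiff_gaussTransform {f : ℝ → ℝ} {m : ℕ} (hf : IsIntegrableSignal m f) (j : ℕ) :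
    ∀ {Q : ℝ}, -1 < Q → Q + j < m → ∀ n, ∃ G : ℝ × ℝ → ℂ, ContDiff ℝ j G ∧
      ∀ z : ℝ × ℝ, z.2 ≠ 0 → G z = gaussTransform (signalHat f) Q n z := by
  obtain ⟨B, hB⟩ := hf.hasDecay
  induction j with
  | zero =>
    intro Q hQ hm n
    obtain ⟨G, hG, hG'⟩ := exists_continuous_gaussTransform hf hQ (by simpa using hm) n
    exact ⟨G, contDiff_zero.2 hG, hG'⟩
  | succ j ih =>
    intro Q hQ hm n
    push_cast at hm
    have hQ1 : -1 < Q + 1 := by linarith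
    have hj : (0 : ℝ) ≤ j := Nat.cast_nonneg j
    obtain ⟨G, hG, hG'⟩ := exists_continuous_gaussTransform hf hQ (by linarith) n
    obtain ⟨G₀, hG₀, hG₀'⟩ := ih hQ1 (by linarith) n
    obtain ⟨G₁, hG₁, hG₁'⟩ := ih hQ1 (by linarith) (n - 1)
    obtain ⟨G₂, hG₂, hG₂'⟩ := ih hQ1 (by linarith) (n + 1)
    have hL : ContDiff ℝ j fun z => ofPartials (Complex.I * G₀ z) (n * G₁ z - G₂ z) := by
      have := ofPartialsCLM.contDiff.comp ((contDiff_const (c := Complex.I) |>.mul hG₀).prodMk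
        ((contDiff_const (c := (n : ℂ)) |>.mul hG₁).sub hG₂))
      simpa only [Function.comp_def, ofPartialsCLM_apply] using this
    have hd : ∀ z, HasFDerivAt G (ofPartials (Complex.I * G₀ z) (n * G₁ z - G₂ z)) z := by
      refine hasFDerivAt_of_offAxis hG hL.continuous fun z hz => ?_
      rw [hG₀' z hz, hG₁' z hz, hG₂' z hz]
      refine (hasFDerivAt_gaussTransform_offAxis hB.cont hB.bound hQ n hz).congr_of_eventuallyEq ?_
      filter_upwards [isOpen_offAxis.mem_nhds hz] with w hw using hG' w hw
    refine ⟨G, ?_, hG'⟩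
    rw [Nat.cast_succ, contDiff_succ_iff_fderiv]
    refine ⟨fun z => (hd z).differentiableAt, by simp, ?_⟩
    rw [show fderiv ℝ G = _ from funext fun z => (hd z).fderiv]
    exact hL

/-- With `Q + 1 < m` the transform is itself continuous, so it equals its smooth extension on the
axis too, by density of the complement. -/
lemma contDiff_gaussTransform {f : ℝ → ℝ} {m : ℕ} (hf : IsIntegrableSignal m f) {j : ℕ} {Q : ℝ}
    (hQ : -1 < Q) (hm1 : Q + 1 < m) (hm : Q + j < m) (n : ℕ) :
    ContDiff ℝ j (gaussTransform (signalHat f) Q n) := by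
  obtain ⟨B, hB⟩ := hf.hasDecay
  obtain ⟨G, hG, hG'⟩ := exists_contDiff_gaussTransform hf j hQ hm n
  rwa [← hG.continuous.ext_on dense_offAxis (hB.continuous_gaussTransform hQ hm1 n) hG']

lemma hasDerivAt_gaussTransform_fst {f : ℝ → ℝ} {m : ℕ} (hf : IsIntegrableSignal m f) {Q : ℝ}
    (hQ : -1 < Q) (hm : Q + 2 < m) (n : ℕ) (x σ : ℝ) :
    HasDerivAt (fun y => gaussTransform (signalHat f) Q n (y, σ))
      (Complex.I * gaussTransform (signalHat f) (Q + 1) n (x, σ)) x := by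
  obtain ⟨B, hB⟩ := hf.hasDecay
  have hc := fun n => hB.continuous_gaussTransform (show -1 < Q + 1 by linarith)
    (show Q + 1 + 1 < m by linarith) n
  have hd := hasFDerivAt_of_offAxis (hB.continuous_gaussTransform hQ (by linarith) n)
    (L := fun z => ofPartials (Complex.I * gaussTransform (signalHat f) (Q + 1) n z)
      (n * gaussTransform (signalHat f) (Q + 1) (n - 1) z -
        gaussTransform (signalHat f) (Q + 1) (n + 1) z)) (by
      have h1 := hc n
      have h2 := hc (n - 1)
      have h3 := hc (n + 1)
      have := ofPartialsCLM.continuous.comp ((continuous_const (y := Complex.I) |>.mul h1).prodMk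
        ((continuous_const (y := (n : ℂ)) |>.mul h2).sub h3))
      refine this.congr fun z => ?_
      rw [Function.comp_apply, ofPartialsCLM_apply]
      rfl)
    (fun z hz => hasFDerivAt_gaussTransform_offAxis hB.cont hB.bound hQ n hz) (x, σ)
  have h2 : HasDerivAt (fun y : ℝ => (y, σ)) ((1 : ℝ), (0 : ℝ)) x :=
    (hasDerivAt_id x).prodMk (hasDerivAt_const x σ)
  have h3 := hd.comp_hasDerivAt x h2
  refine h3.congr_deriv ?_
  simp [ofPartials_apply]

/-! ### Identification of `Ψ` and its `x`-derivatives with the transform. -/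

/-- `ρ^{p+1} K(νρ)` as an oscillatory integral. -/
lemma rescaled_halfKernel (p : ℝ) {ρ : ℝ} (hρ : 0 < ρ) (ν : ℝ) :
    ((ρ ^ (p + 1) : ℝ) : ℂ) * halfKernel p (ν * ρ) =
      ∫ ξ in Set.Ioi (0 : ℝ), ((ξ ^ p : ℝ) : ℂ) * ((hermiteGauss 0 (1 / ρ * ξ) : ℝ) : ℂ) *
        Complex.exp ((ξ * ν : ℝ) * Complex.I) := by
  have h := integral_comp_mul_left_Ioi (fun ξ : ℝ => ((ξ ^ p : ℝ) : ℂ) *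
    ((hermiteGauss 0 (1 / ρ * ξ) : ℝ) : ℂ) * Complex.exp ((ξ * ν : ℝ) * Complex.I)) 0 hρ
  rw [mul_zero] at h
  have hρ' : (ρ : ℂ) ≠ 0 := by exact_mod_cast hρ.ne'
  rw [eq_inv_smul_iff₀ hρ.ne'] at h
  rw [← h, halfKernel, Real.rpow_add_one hρ.ne', Complex.real_smul, ← integral_const_mul,
    ← integral_const_mul]
  refine setIntegral_congr_fun measurableSet_Ioi fun ξ (hξ : 0 < ξ) => ?_
  simp only [hermiteGauss]
  rw [Real.mul_rpow hρ.le hξ.le, show 1 / ρ * (ρ * ξ) = ξ by field_simp,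
    show ξ * (ν * ρ) = ρ * ξ * ν by ring]
  push_cast
  ring

lemma integrable_scaleConv_prod {f : ℝ → ℝ} (hf : Integrable f) {p : ℝ} (hp : 0 ≤ p) (x : ℝ)
    {ρ : ℝ} (hρ : 0 < ρ) :
    Integrable (Function.uncurry fun (ν ξ : ℝ) => (f (x - ν) : ℂ) * (((ξ ^ p : ℝ) : ℂ) *
      ((hermiteGauss 0 (1 / ρ * ξ) : ℝ) : ℂ) * Complex.exp ((ξ * ν : ℝ) * Complex.I)))
      (volume.prod (volume.restrict (Set.Ioi (0 : ℝ)))) := by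
  have h0 : Integrable (fun ξ : ℝ => ((ξ ^ p : ℝ) : ℂ) *
      ((hermiteGauss 0 (1 / ρ * ξ) : ℝ) : ℂ)) (volume.restrict (Set.Ioi (0 : ℝ))) := by
    have := integrable_gaussIntegrand_offAxis (h := fun _ => 1) (B := 1) continuous_const
      (fun _ => by simp) (show -1 < p by linarith) 0 (z := (0, 1 / ρ)) (by positivity)
    refine this.integrable.congr (Eventually.of_forall fun ξ => ?_)
    simp [gaussIntegrand]
  have h1 := ((hf.comp_sub_left x).ofReal (𝕜 := ℂ)).mul_prod h0
  refine (h1.mul_bdd (c := 1) (g := fun w : ℝ × ℝ =>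
    Complex.exp ((w.2 * w.1 : ℝ) * Complex.I)) ?_ ?_).congr ?_
  · exact Continuous.aestronglyMeasurable (by fun_prop)
  · exact Eventually.of_forall fun w => by rw [Complex.norm_exp_ofReal_mul_I]
  · refine Eventually.of_forall fun w => ?_
    simp only [Function.uncurry, mul_assoc]
    rfl

/-- The rescaled kernel has half-line frequency density `ξ^p e^{-(ξ/ρ)²/2}`; Fubini turns
convolution with `f` into multiplication by `f̂`, with `σ = 1/ρ`. -/
lemma scaleConv_eq {f : ℝ → ℝ} (hf : Integrable f) (θ : KernelParity) {p : ℝ} (hp : 0 ≤ p) (x : ℝ)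
    {ρ : ℝ} (hρ : 0 < ρ) :
    scaleConv f θ p x ρ =
      (kernelConst θ p * gaussTransform (signalHat f) p 0 (x, 1 / ρ)).re := by
  have hprod := integrable_scaleConv_prod hf hp x hρ
  have hint := hprod.integral_prod_left
  simp only [Function.uncurry, integral_const_mul, ← rescaled_halfKernel p hρ] at hint
  have e1 : gaussTransform (signalHat f) p 0 (x, 1 / ρ) =
      ∫ ν : ℝ, (f (x - ν) : ℂ) * (((ρ ^ (p + 1) : ℝ) : ℂ) * halfKernel p (ν * ρ)) := by
    have h2 := integral_integral_swap hprod
    simp only [integral_const_mul, ← rescaled_halfKernel p hρ] at h2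
    rw [h2]
    refine integral_congr_ae (Eventually.of_forall fun ξ => ?_)
    have h3 := integral_sub_left_eq_self (μ := volume)
      (fun y : ℝ => (f y : ℂ) * Complex.exp ((-(ξ * y) : ℝ) * Complex.I)) x
    simp only [gaussIntegrand, signalHat]
    rw [← h3, ← integral_const_mul]
    refine integral_congr_ae (Eventually.of_forall fun ν => ?_)
    have : Complex.exp ((ξ * ν : ℝ) * Complex.I) =
        Complex.exp ((ξ * x : ℝ) * Complex.I) * Complex.exp ((-(ξ * (x - ν)) : ℝ) * Complex.I) := by
      rw [← Complex.exp_add]; congr 1; push_cast; ring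
    simp only [this]
    ring
  rw [e1, ← integral_const_mul, ← RCLike.re_eq_complex_re, ← integral_re (hint.const_mul _),
    scaleConv]
  refine integral_congr_ae (Eventually.of_forall fun ν => ?_)
  simp only [RCLike.re_eq_complex_re]
  rw [scaleKernel_eq θ hp, ← Complex.re_ofReal_mul, ← Complex.re_ofReal_mul]
  congr 1
  ring

lemma gaussTransform_neg_snd (h : ℝ → ℂ) (Q x σ : ℝ) :
    gaussTransform h Q 0 (x, -σ) = gaussTransform h Q 0 (x, σ) := by
  simp [gaussTransform, gaussIntegrand, hermiteGauss]

/-- One formula serves the whole plane: continuity of the transform identifies the limit at `σ = 0`,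
and its evenness in `σ` removes the absolute value. -/
lemma scalePsi_eq {f : ℝ → ℝ} {m : ℕ} (hf : IsIntegrableSignal m f) (θ : KernelParity) {p : ℝ}
    (hp : 0 ≤ p) (hm : p + 1 < m) (x σ : ℝ) :
    scalePsi f θ p x σ = (kernelConst θ p * gaussTransform (signalHat f) p 0 (x, σ)).re := by
  unfold scalePsi
  split_ifs with hσ
  · subst hσ
    obtain ⟨B, hB⟩ := hf.hasDecay
    have hc : Continuous fun ρ : ℝ =>
        (kernelConst θ p * gaussTransform (signalHat f) p 0 (x, ρ)).re := by
      have := hB.continuous_gaussTransform (show -1 < p by linarith) hm 0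
      fun_prop
    refine Tendsto.limUnder_eq (((hc.tendsto 0).comp tendsto_inv_atTop_zero).congr' ?_)
    filter_upwards [eventually_gt_atTop 0] with ρ hρ
    rw [scaleConv_eq hf.integrable θ hp x hρ, one_div]
    rfl
  · rw [scaleConv_eq hf.integrable θ hp x (by positivity), one_div_one_div]
    rcases abs_choice σ with h | h <;> rw [h]
    rw [gaussTransform_neg_snd]

lemma scalePsiDx_eq {f : ℝ → ℝ} {m : ℕ} (hf : IsIntegrableSignal m f) (θ : KernelParity) {p : ℝ}
    (hp : 0 ≤ p) (σ : ℝ) : ∀ k : ℕ, p + k + 1 < m → ∀ x,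
    scalePsiDx f θ p k x σ =
      (kernelConst θ p * Complex.I ^ k * gaussTransform (signalHat f) (p + k) 0 (x, σ)).re := by
  intro k
  induction k with
  | zero =>
    intro hm x
    simp only [scalePsiDx, iteratedDeriv_zero, pow_zero, mul_one, Nat.cast_zero, add_zero]
    exact scalePsi_eq hf θ hp (by simpa using hm) x σ
  | succ k ih =>
    intro hm x
    push_cast at hm
    have hk : (0 : ℝ) ≤ k := Nat.cast_nonneg k
    have h1 := hasDerivAt_gaussTransform_fst hf (show -1 < p + k by linarith)
      (show p + k + 2 < m by linarith) 0 x σ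
    have h2 := (Complex.reCLM.hasFDerivAt.comp_hasDerivAt x
      (h1.const_mul (kernelConst θ p * Complex.I ^ k)))
    rw [scalePsiDx, iteratedDeriv_succ]
    have e : iteratedDeriv k (fun y => scalePsi f θ p y σ) = fun y =>
        (kernelConst θ p * Complex.I ^ k * gaussTransform (signalHat f) (p + k) 0 (y, σ)).re :=
      funext fun y => ih (by linarith) y
    rw [e]
    refine h2.deriv.trans ?_
    rw [Complex.reCLM_apply]
    push_cast
    rw [pow_succ, add_assoc]
    congr 1
    ring

/-! ### Vanishing at infinity and the heat equation. -/

lemma tendsto_gaussTransform_fst (h : ℝ → ℂ) (Q : ℝ) (n : ℕ) (σ : ℝ) :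
    Tendsto (fun x => gaussTransform h Q n (x, σ)) (cocompact ℝ) (𝓝 0) := by
  have h1 := Real.tendsto_integral_exp_smul_cocompact
    -- Riemann–Lebesgue; the factor `-(2π)⁻¹` below converts `e^{iξx}` to the normalized character
    -- `e^{-2πiξw}`.
    ((Set.Ioi (0 : ℝ)).indicator fun ξ => gaussIntegrand h Q n (0, σ) ξ)
  have h2 : Tendsto (fun x : ℝ => -(2 * Real.pi)⁻¹ * x) (cocompact ℝ) (cocompact ℝ) :=
    Filter.tendsto_cocompact_mul_left₀ (by have := Real.pi_pos; simp [this.ne'])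
  refine (h1.comp h2).congr fun x => ?_
  rw [gaussTransform, ← integral_indicator measurableSet_Ioi, Function.comp_apply]
  refine integral_congr_ae (Eventually.of_forall fun ξ => ?_)
  by_cases hξ : ξ ∈ Set.Ioi (0 : ℝ)
  · simp only [Set.indicator_of_mem hξ]
    rw [Circle.smul_def, Real.fourierChar_apply, gaussIntegrand, gaussIntegrand, smul_eq_mul]
    have e : 2 * Real.pi * -(ξ * (-(2 * Real.pi)⁻¹ * x)) = ξ * x := by
      have := Real.pi_pos.ne'
      field_simp
    rw [e]
    simp only [mul_zero, Complex.ofReal_zero, zero_mul, Complex.exp_zero, mul_one]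
    ring
  · simp only [Set.indicator_of_notMem hξ, smul_zero]

/-- As `|σ| → ∞` the Gaussian kills the integral uniformly in `x`. For `σ` in a compact set
Riemann–Lebesgue applies, locally uniformly in `σ` because the weighted `L¹` distance between nearby
Gaussian factors is small. -/
lemma HasDecay.tendsto_gaussTransform {h : ℝ → ℂ} {m : ℕ} {B Q : ℝ} (hh : HasDecay h m B)
    (hQ : -1 < Q) (hm : Q + 1 < m) :
    Tendsto (gaussTransform h Q 0) (cocompact (ℝ × ℝ)) (𝓝 0) := by
  have hI := (hh.integrableOn_rpow hQ hm).integrable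
  have hmeas := hh.cont.measurable
  have hη := fun σ : ℝ => ((continuous_hermiteGauss 0).comp
    (continuous_const.mul continuous_id : Continuous fun ξ : ℝ => σ * ξ)).measurable
  simp only [Function.comp_def] at hη
  have hη1 : ∀ w, |hermiteGauss 0 w| ≤ 1 := fun w => by
    rw [hermiteGauss, pow_zero, one_mul, abs_of_pos (Real.exp_pos _), Real.exp_le_one_iff]
    nlinarith [sq_nonneg w]
  have hdom : Tendsto (fun σ => ∫ ξ in Set.Ioi (0 : ℝ), ξ ^ Q * ‖h ξ‖ * |hermiteGauss 0 (σ * ξ)|)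
      (cocompact ℝ) (𝓝 0) := by
    have : Tendsto (fun σ => ∫ ξ in Set.Ioi (0 : ℝ), ξ ^ Q * ‖h ξ‖ * |hermiteGauss 0 (σ * ξ)|)
        (cocompact ℝ) (𝓝 (∫ ξ in Set.Ioi (0 : ℝ), (0 : ℝ))) := by
      rw [cocompact_eq_atBot_atTop]
      refine tendsto_integral_filter_of_dominated_convergence (fun ξ => ξ ^ Q * ‖h ξ‖)
        (Eventually.of_forall fun σ => ?_) (Eventually.of_forall fun σ => ?_) hI ?_
      · have := hη σ
        exact Measurable.aestronglyMeasurable (by fun_prop)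
      · filter_upwards [ae_restrict_mem measurableSet_Ioi] with ξ hξ
        have h0 : (0 : ℝ) < ξ ^ Q := Real.rpow_pos_of_pos hξ _
        rw [norm_mul, Real.norm_eq_abs, Real.norm_eq_abs, abs_abs, abs_of_nonneg (by positivity)]
        exact mul_le_of_le_one_right (by positivity) (hη1 _)
      · filter_upwards [ae_restrict_mem measurableSet_Ioi] with ξ hξ
        have hξ0 : ξ ≠ 0 := ne_of_gt hξ
        rw [← cocompact_eq_atBot_atTop]
        have h1 : Tendsto (fun σ : ℝ => |hermiteGauss 0 (σ * ξ)|) (cocompact ℝ) (𝓝 0) := by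
          have h2 : Tendsto (fun w : ℝ => |hermiteGauss 0 w|) (cocompact ℝ) (𝓝 0) := by
            refine (tendsto_rpow_abs_mul_exp_neg_mul_sq_cocompact (a := 1 / 2)
              (by norm_num) 0).congr fun w => ?_
            simp only [hermiteGauss, Real.rpow_zero, pow_zero, one_mul]
            rw [abs_of_pos (Real.exp_pos _)]
            congr 1; ring
          exact h2.comp (Filter.tendsto_cocompact_mul_right₀ hξ0)
        simpa using h1.const_mul (ξ ^ Q * ‖h ξ‖)
    simpa using this
  have hbound : ∀ z, ‖gaussTransform h Q 0 z‖ ≤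
      ∫ ξ in Set.Ioi (0 : ℝ), ξ ^ Q * ‖h ξ‖ * |hermiteGauss 0 (z.2 * ξ)| := fun z => by
    refine (norm_integral_le_integral_norm _).trans (le_of_eq ?_)
    refine setIntegral_congr_fun measurableSet_Ioi fun ξ hξ => ?_
    rw [norm_gaussIntegrand h Q 0 z hξ]
    ring
  have hloc : ∀ σ₀ : ℝ, Tendsto (gaussTransform h Q 0) (cocompact ℝ ×ˢ 𝓝 σ₀) (𝓝 0) := by
    intro σ₀
    have hD : Tendsto (fun σ => ∫ ξ in Set.Ioi (0 : ℝ), ξ ^ Q * ‖h ξ‖ *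
        |hermiteGauss 0 (σ * ξ) - hermiteGauss 0 (σ₀ * ξ)|) (𝓝 σ₀) (𝓝 0) := by
      have hc : ContinuousAt (fun σ => ∫ ξ in Set.Ioi (0 : ℝ), ξ ^ Q * ‖h ξ‖ *
          |hermiteGauss 0 (σ * ξ) - hermiteGauss 0 (σ₀ * ξ)|) σ₀ := by
        refine continuousAt_of_dominated (bound := fun ξ => 2 * (ξ ^ Q * ‖h ξ‖))
          (Eventually.of_forall fun σ => ?_) (Eventually.of_forall fun σ => ?_) (hI.const_mul 2) ?_
        · have := hη σ
          have := hη σ₀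
          exact Measurable.aestronglyMeasurable (by fun_prop)
        · filter_upwards [ae_restrict_mem measurableSet_Ioi] with ξ hξ
          have h0 : (0 : ℝ) < ξ ^ Q := Real.rpow_pos_of_pos hξ _
          rw [norm_mul, Real.norm_eq_abs, Real.norm_eq_abs, abs_abs, abs_of_nonneg (by positivity),
            mul_comm 2]
          gcongr
          exact (abs_sub _ _).trans (by linarith [hη1 (σ * ξ), hη1 (σ₀ * ξ)])
        · refine Eventually.of_forall fun ξ => ?_
          have : Continuous fun σ : ℝ => hermiteGauss 0 (σ * ξ) :=
            (continuous_hermiteGauss 0).comp (by fun_prop)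
          exact (continuous_const.mul (this.sub continuous_const).abs).continuousAt
      simpa using hc.tendsto
    have hsum := ((tendsto_norm_zero.comp (tendsto_gaussTransform_fst h Q 0 σ₀)).comp
      (tendsto_fst (g := 𝓝 σ₀))).add (hD.comp (tendsto_snd (f := cocompact ℝ)))
    rw [zero_add] at hsum
    refine squeeze_zero_norm (fun z => ?_) hsum
    have hi := fun z => (hh.integrable_gaussIntegrand hQ hm 0 z).integrable
    have hsub : ‖gaussTransform h Q 0 z - gaussTransform h Q 0 (z.1, σ₀)‖ ≤
        ∫ ξ in Set.Ioi (0 : ℝ), ξ ^ Q * ‖h ξ‖ *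
          |hermiteGauss 0 (z.2 * ξ) - hermiteGauss 0 (σ₀ * ξ)| := by
      rw [gaussTransform, gaussTransform, ← integral_sub (hi _) (hi _)]
      refine (norm_integral_le_integral_norm _).trans (le_of_eq ?_)
      refine setIntegral_congr_fun measurableSet_Ioi fun ξ hξ => ?_
      have h0 : (0 : ℝ) < ξ ^ Q := Real.rpow_pos_of_pos hξ _
      have : gaussIntegrand h Q 0 z ξ - gaussIntegrand h Q 0 (z.1, σ₀) ξ =
          ((ξ ^ Q : ℝ) : ℂ) * ((hermiteGauss 0 (z.2 * ξ) - hermiteGauss 0 (σ₀ * ξ) : ℝ) : ℂ) *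
            Complex.exp ((ξ * z.1 : ℝ) * Complex.I) * h ξ := by
        simp only [gaussIntegrand]; push_cast; ring
      simp only [this]
      rw [norm_mul, norm_mul, norm_mul, Complex.norm_exp_ofReal_mul_I, Complex.norm_real,
        Complex.norm_real, Real.norm_eq_abs, Real.norm_eq_abs, abs_of_pos h0, mul_one]
      ring
    have := norm_add_le (gaussTransform h Q 0 z - gaussTransform h Q 0 (z.1, σ₀))
      (gaussTransform h Q 0 (z.1, σ₀))
    rw [sub_add_cancel] at this
    simp only [Function.comp_apply]
    linarith
  rw [← coprod_cocompact, Filter.coprod, tendsto_sup]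
  have hsnd : Tendsto (gaussTransform h Q 0) (comap Prod.snd (cocompact ℝ)) (𝓝 0) :=
    squeeze_zero_norm hbound (hdom.comp tendsto_comap)
  refine ⟨?_, hsnd⟩
  rw [Metric.tendsto_nhds]
  intro ε hε
  have h1 := (Metric.tendsto_nhds.1 hsnd) ε hε
  rw [eventually_comap] at h1
  obtain ⟨K, hK, hK'⟩ := mem_cocompact.1 h1
  -- Compactness of `K` makes the neighbourhoods of infinity in `x` uniform over `σ ∈ K`.
  have h2 := hK.mem_prod_nhdsSet_of_forall (l := cocompact ℝ)
    (s := {z | dist (gaussTransform h Q 0 z) 0 < ε})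
    fun σ₀ _ => (Metric.tendsto_nhds.1 (hloc σ₀)) ε hε
  obtain ⟨A, hA, V, hV, hAV⟩ := mem_prod_iff.1 h2
  refine eventually_comap.2 ?_
  filter_upwards [hA] with x hx z hz
  by_cases hzK : z.2 ∈ K
  · exact hAV ⟨hz ▸ hx, subset_of_mem_nhdsSet hV hzK⟩
  · exact hK' hzK z rfl

/-- A function on the `(x, σ)` plane that is of class `C^r`, smooth off the axis, even in `σ`,
vanishing at infinity, and satisfying `u_σ = σ u_xx` for `σ > 0`. -/
structure IsScaleField (r : ℕ∞) (u : ℝ × ℝ → ℝ) : Prop where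
  contDiff : ContDiff ℝ r u
  contDiffAt_offAxis : ∀ z : ℝ × ℝ, z.2 ≠ 0 → ContDiffAt ℝ ∞ u z
  even : ∀ x σ, u (x, -σ) = u (x, σ)
  tendsto_zero : Tendsto u (cocompact (ℝ × ℝ)) (𝓝 0)
  heat : ∀ x σ : ℝ, 0 < σ → ∃ d : ℝ, HasDerivAt (fun τ => u (x, τ)) (σ * d) σ ∧
    HasDerivAt (deriv fun y => u (y, σ)) d x

lemma hasDerivAt_gaussTransform_fst_offAxis {h : ℝ → ℂ} {B : ℝ} (hc : Continuous h)
    (hB : ∀ ξ, ‖h ξ‖ ≤ B) {Q : ℝ} (hQ : -1 < Q) (n : ℕ) (x : ℝ) {σ : ℝ} (hσ : σ ≠ 0) :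
    HasDerivAt (fun y => gaussTransform h Q n (y, σ))
      (Complex.I * gaussTransform h (Q + 1) n (x, σ)) x := by
  have h2 : HasDerivAt (fun y : ℝ => (y, σ)) ((1 : ℝ), (0 : ℝ)) x :=
    (hasDerivAt_id x).prodMk (hasDerivAt_const x σ)
  refine ((hasFDerivAt_gaussTransform_offAxis hc hB hQ n (z := (x, σ)) hσ).comp_hasDerivAt x
    h2).congr_deriv ?_
  simp [ofPartials_apply]

/-- The origin of the heat equation: the `σ`-derivative of the Gaussian brings down `-σξ²`, and
`-ξ²` is the multiplier of `∂ₓ²`. -/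
lemma gaussTransform_one (h : ℝ → ℂ) (Q x σ : ℝ) :
    gaussTransform h (Q + 1) 1 (x, σ) = σ * gaussTransform h (Q + 1 + 1) 0 (x, σ) := by
  rw [gaussTransform, gaussTransform, ← integral_const_mul]
  refine setIntegral_congr_fun measurableSet_Ioi fun ξ (hξ : 0 < ξ) => ?_
  simp only [gaussIntegrand, hermiteGauss]
  rw [Real.rpow_add_one hξ.ne' (Q + 1)]
  push_cast
  ring

lemma hasDerivAt_gaussTransform_snd_offAxis {h : ℝ → ℂ} {B : ℝ} (hc : Continuous h)
    (hB : ∀ ξ, ‖h ξ‖ ≤ B) {Q : ℝ} (hQ : -1 < Q) (x : ℝ) {σ : ℝ} (hσ : σ ≠ 0) :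
    HasDerivAt (fun τ => gaussTransform h Q 0 (x, τ))
      (-(σ * gaussTransform h (Q + 1 + 1) 0 (x, σ))) σ := by
  have h2 : HasDerivAt (fun τ : ℝ => (x, τ)) ((0 : ℝ), (1 : ℝ)) σ :=
    (hasDerivAt_const σ x).prodMk (hasDerivAt_id σ)
  refine ((hasFDerivAt_gaussTransform_offAxis hc hB hQ 0 (z := (x, σ)) hσ).comp_hasDerivAt σ
    h2).congr_deriv ?_
  simp [ofPartials_apply, gaussTransform_one]

lemma isScaleField_scalePsiDx {f : ℝ → ℝ} (θ : KernelParity) {p : ℝ} (hp : 0 ≤ p) (k : ℕ)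
    {r : ℕ∞} (hr : 1 ≤ r)
    (hf : ∀ j : ℕ, (j : ℕ∞) ≤ r →
      ∃ m : ℕ, p + (k : ℝ) + (j : ℝ) < (m : ℝ) ∧ IsIntegrableSignal m f) :
    IsScaleField r fun z => scalePsiDx f θ p k z.1 z.2 := by
  obtain ⟨m, hm, hfm⟩ := hf 1 (by exact_mod_cast hr)
  rw [Nat.cast_one] at hm
  obtain ⟨B, hB⟩ := hfm.hasDecay
  have hk : (0 : ℝ) ≤ k := Nat.cast_nonneg k
  have hQ : -1 < p + k := by linarith
  have hQ1 : -1 < p + k + 1 := by linarith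
  have hu : (fun z : ℝ × ℝ => scalePsiDx f θ p k z.1 z.2) = fun z =>
      (kernelConst θ p * Complex.I ^ k * gaussTransform (signalHat f) (p + k) 0 z).re :=
    funext fun z => scalePsiDx_eq hfm θ hp z.2 k hm z.1
  rw [hu]
  set C := kernelConst θ p * Complex.I ^ k
  refine ⟨?_, ?_, ?_, ?_, ?_⟩
  · rw [contDiff_iff_forall_nat_le]
    intro j hj
    -- The maximum with `1` secures the absolute convergence condition `p + k + 1 < m'` also when `j
    -- = 0`.
    obtain ⟨m', hm', hfm'⟩ := hf (max j 1) (by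
      exact max_le (by exact_mod_cast hj) hr)
    have h1 : (j : ℝ) ≤ (max j 1 : ℕ) := by exact_mod_cast le_max_left _ _
    have h2 : (1 : ℝ) ≤ (max j 1 : ℕ) := by exact_mod_cast le_max_right _ _
    have := contDiff_gaussTransform hfm' (j := j) hQ (by linarith) (by linarith) 0
    exact Complex.reCLM.contDiff.comp (contDiff_const.mul this)
  · intro z hz
    rw [contDiffAt_infty]
    intro j
    have := (contDiffOn_gaussTransform_offAxis hB.cont hB.bound j hQ 0).contDiffAt
      (isOpen_offAxis.mem_nhds hz)
    exact Complex.reCLM.contDiff.contDiffAt.comp z (contDiffAt_const.mul this)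
  · intro x σ
    simp only [gaussTransform_neg_snd]
  · have := ((hB.tendsto_gaussTransform hQ hm).const_mul C)
    rw [mul_zero] at this
    exact (Complex.continuous_re.tendsto 0).comp this
  · intro x σ hσ
    have hx : ∀ Q, -1 < Q → ∀ c : ℂ, ∀ y, HasDerivAt
        (fun y => (c * gaussTransform (signalHat f) Q 0 (y, σ)).re)
        (c * (Complex.I * gaussTransform (signalHat f) (Q + 1) 0 (y, σ))).re y := fun Q hQ c y =>
      Complex.reCLM.hasFDerivAt.comp_hasDerivAt y
        ((hasDerivAt_gaussTransform_fst_offAxis hB.cont hB.bound hQ 0 y hσ.ne').const_mul c)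
    refine ⟨-(C * gaussTransform (signalHat f) (p + k + 1 + 1) 0 (x, σ)).re, ?_, ?_⟩
    · refine (Complex.reCLM.hasFDerivAt.comp_hasDerivAt σ
        ((hasDerivAt_gaussTransform_snd_offAxis hB.cont hB.bound hQ x
          hσ.ne').const_mul C)).congr_deriv ?_
      rw [Complex.reCLM_apply, mul_neg, Complex.neg_re, mul_left_comm, Complex.re_ofReal_mul]
      ring
    · have e : (deriv fun y => (C * gaussTransform (signalHat f) (p + k) 0 (y, σ)).re) =
          fun y => (C * Complex.I * gaussTransform (signalHat f) (p + k + 1) 0 (y, σ)).re :=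
        funext fun y => by rw [(hx _ hQ C y).deriv, mul_assoc C]
      rw [e]
      refine (hx _ hQ1 (C * Complex.I) x).congr_deriv ?_
      rw [← mul_assoc, mul_assoc C, Complex.I_mul_I]
      simp

/-! ### The field tangent to the level sets, and flow boxes for it. -/

/-- The partial derivative in the first variable. -/
noncomputable def partialFst (u : ℝ × ℝ → ℝ) (z : ℝ × ℝ) : ℝ := fderiv ℝ u z (1, 0)

/-- The partial derivative in the second variable. -/
noncomputable def partialSnd (u : ℝ × ℝ → ℝ) (z : ℝ × ℝ) : ℝ := fderiv ℝ u z (0, 1)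

lemma fderiv_plane_apply (u : ℝ × ℝ → ℝ) (z v : ℝ × ℝ) :
    fderiv ℝ u z v = v.1 * partialFst u z + v.2 * partialSnd u z := by
  have : v = v.1 • ((1 : ℝ), (0 : ℝ)) + v.2 • ((0 : ℝ), (1 : ℝ)) := by ext <;> simp
  conv_lhs => rw [this]
  rw [map_add, map_smul, map_smul, smul_eq_mul, smul_eq_mul]
  rfl

/-- The squared gradient. -/
noncomputable def gradSq (u : ℝ × ℝ → ℝ) (z : ℝ × ℝ) : ℝ := partialFst u z ^ 2 + partialSnd u z ^ 2

lemma gradSq_pos {u : ℝ × ℝ → ℝ} {z : ℝ × ℝ} (h : fderiv ℝ u z ≠ 0) : 0 < gradSq u z := by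
  by_contra hcon
  apply h
  have h1 : partialFst u z = 0 := by
    unfold gradSq at hcon; nlinarith [sq_nonneg (partialFst u z), sq_nonneg (partialSnd u z)]
  have h2 : partialSnd u z = 0 := by
    unfold gradSq at hcon; nlinarith [sq_nonneg (partialFst u z), sq_nonneg (partialSnd u z)]
  ext <;> simp [fderiv_plane_apply, h1, h2]

/-- The rotated gradient `(-u_σ, u_x)`, normalized to have length less than one. -/
noncomputable def levelField (u : ℝ × ℝ → ℝ) (z : ℝ × ℝ) : ℝ × ℝ :=
  ((1 + gradSq u z)⁻¹ * (-partialSnd u z), (1 + gradSq u z)⁻¹ * partialFst u z)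

lemma gradSq_nonneg (u : ℝ × ℝ → ℝ) (z : ℝ × ℝ) : 0 ≤ gradSq u z := by unfold gradSq; positivity

lemma levelField_ne_zero {u : ℝ × ℝ → ℝ} {z : ℝ × ℝ} (h : fderiv ℝ u z ≠ 0) :
    levelField u z ≠ 0 := by
  intro h0
  have hg := gradSq_pos h
  have hi : (1 + gradSq u z)⁻¹ ≠ 0 := by positivity
  have h1 := congrArg Prod.fst h0
  have h2 := congrArg Prod.snd h0
  simp only [levelField, Prod.fst_zero, Prod.snd_zero, mul_eq_zero, hi, false_or,
    neg_eq_zero] at h1 h2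
  unfold gradSq at hg
  rw [h1, h2] at hg
  norm_num at hg

/-- Bounded speed keeps a flow line in a fixed ball over any bounded time, which gives existence for
all times. -/
lemma norm_levelField_le (u : ℝ × ℝ → ℝ) (z : ℝ × ℝ) : ‖levelField u z‖ ≤ 1 := by
  have h0 : 0 < 1 + gradSq u z := by have := gradSq_nonneg u z; linarith
  rw [Prod.norm_def, levelField, max_le_iff]
  constructor
  · rw [norm_mul, norm_neg, norm_inv, Real.norm_eq_abs, Real.norm_eq_abs, abs_of_pos h0,
      inv_mul_le_iff₀ h0]
    unfold gradSq
    nlinarith [sq_nonneg (|partialSnd u z| - 1), sq_abs (partialSnd u z),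
      sq_nonneg (partialFst u z), sq_nonneg (partialSnd u z)]
  · rw [norm_mul, norm_inv, Real.norm_eq_abs, Real.norm_eq_abs, abs_of_pos h0,
      inv_mul_le_iff₀ h0]
    unfold gradSq
    nlinarith [sq_nonneg (|partialFst u z| - 1), sq_abs (partialFst u z),
      sq_nonneg (partialFst u z), sq_nonneg (partialSnd u z)]

lemma continuous_partialFst {u : ℝ × ℝ → ℝ} (hu : ContDiff ℝ 1 u) : Continuous (partialFst u) :=
  (hu.continuous_fderiv one_ne_zero).clm_apply continuous_const

lemma continuous_partialSnd {u : ℝ × ℝ → ℝ} (hu : ContDiff ℝ 1 u) : Continuous (partialSnd u) :=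
  (hu.continuous_fderiv one_ne_zero).clm_apply continuous_const

lemma continuous_gradSq {u : ℝ × ℝ → ℝ} (hu : ContDiff ℝ 1 u) : Continuous (gradSq u) :=
  ((continuous_partialFst hu).pow 2).add ((continuous_partialSnd hu).pow 2)

/-- `γ` runs along the level set `{u = 0}` with velocity `levelField u` at all times in `s`. -/
def IsFlowLine (u : ℝ × ℝ → ℝ) (γ : ℝ → ℝ × ℝ) (s : Set ℝ) : Prop :=
  ∀ t ∈ s, u (γ t) = 0 ∧ HasDerivAt γ (levelField u (γ t)) t

lemma IsFlowLine.mono {u : ℝ × ℝ → ℝ} {γ : ℝ → ℝ × ℝ} {s s' : Set ℝ} (h : IsFlowLine u γ s)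
    (hs : s' ⊆ s) : IsFlowLine u γ s' := fun t ht => h t (hs ht)

lemma IsFlowLine.comp_add_const {u : ℝ × ℝ → ℝ} {γ : ℝ → ℝ × ℝ} {s : Set ℝ}
    (h : IsFlowLine u γ s) (c : ℝ) : IsFlowLine u (fun t => γ (t + c)) {t | t + c ∈ s} :=
  fun t ht => ⟨(h _ ht).1, (h _ ht).2.comp_add_const t c⟩

lemma IsFlowLine.congr {u : ℝ × ℝ → ℝ} {γ η : ℝ → ℝ × ℝ} {s : Set ℝ} (h : IsFlowLine u γ s)
    (he : ∀ t ∈ s, η =ᶠ[𝓝 t] γ) : IsFlowLine u η s := fun t ht => by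
  rw [(he t ht).eq_of_nhds]
  exact ⟨(h t ht).1, (h t ht).2.congr_of_eventuallyEq (he t ht)⟩

/-- The linear automorphism of the plane with invertible matrix `(a b; c d)`. -/
noncomputable def planeEquiv (a b c d : ℝ) (h : a * d - b * c ≠ 0) : (ℝ × ℝ) ≃L[ℝ] ℝ × ℝ :=
  ContinuousLinearEquiv.equivOfInverse
    ((a • ContinuousLinearMap.fst ℝ ℝ ℝ + b • ContinuousLinearMap.snd ℝ ℝ ℝ).prod
      (c • ContinuousLinearMap.fst ℝ ℝ ℝ + d • ContinuousLinearMap.snd ℝ ℝ ℝ))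
    (((a * d - b * c)⁻¹ • (d • ContinuousLinearMap.fst ℝ ℝ ℝ - b • ContinuousLinearMap.snd ℝ ℝ ℝ)).prod
      ((a * d - b * c)⁻¹ • (-c • ContinuousLinearMap.fst ℝ ℝ ℝ + a • ContinuousLinearMap.snd ℝ ℝ ℝ)))
    (fun v => by
      ext
      · simp only [ContinuousLinearMap.prod_apply, smul_apply,
          add_apply, sub_apply,
          ContinuousLinearMap.coe_fst', ContinuousLinearMap.coe_snd', smul_eq_mul]
        field_simp
        ring
      · simp only [ContinuousLinearMap.prod_apply, smul_apply,
          add_apply, sub_apply,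
          ContinuousLinearMap.coe_fst', ContinuousLinearMap.coe_snd', smul_eq_mul]
        field_simp
        ring)
    (fun v => by
      ext
      · simp only [ContinuousLinearMap.prod_apply, smul_apply,
          add_apply, sub_apply,
          ContinuousLinearMap.coe_fst', ContinuousLinearMap.coe_snd', smul_eq_mul]
        field_simp
        ring
      · simp only [ContinuousLinearMap.prod_apply, smul_apply,
          add_apply, sub_apply,
          ContinuousLinearMap.coe_fst', ContinuousLinearMap.coe_snd', smul_eq_mul]
        rw [show c * ((a * d - b * c)⁻¹ * (d * v.1 - b * v.2)) +
          d * ((a * d - b * c)⁻¹ * (-c * v.1 + a * v.2)) =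
          (a * d - b * c)⁻¹ * (a * d - b * c) * v.2 by ring, inv_mul_cancel₀ h, one_mul])

lemma planeEquiv_apply (a b c d : ℝ) (h : a * d - b * c ≠ 0) (v : ℝ × ℝ) :
    planeEquiv a b c d h v = (a * v.1 + b * v.2, c * v.1 + d * v.2) := rfl

lemma planeEquiv_symm_apply (a b c d : ℝ) (h : a * d - b * c ≠ 0) (v : ℝ × ℝ) :
    (planeEquiv a b c d h).symm v = ((a * d - b * c)⁻¹ * (d * v.1 - b * v.2),
      (a * d - b * c)⁻¹ * (-c * v.1 + a * v.2)) := rfl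

/-- Near a regular zero `z₀` of `u`, the level set is a flow line `b`, and time along flow lines is
measured by a function `a`. -/
theorem exists_flowBox {u : ℝ × ℝ → ℝ} (hu : ContDiff ℝ 1 u) {z₀ : ℝ × ℝ} (h₀ : u z₀ = 0)
    (hreg : fderiv ℝ u z₀ ≠ 0) :
    ∃ ε > 0, ∃ (a : ℝ × ℝ → ℝ) (b : ℝ → ℝ × ℝ), a z₀ = 0 ∧ ContinuousAt a z₀ ∧
      IsFlowLine u b (Set.Ioo (-ε) ε) ∧ (∀ᶠ z in 𝓝 z₀, u z = 0 → b (a z) = z) ∧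
      ∀ (γ : ℝ → ℝ × ℝ) (s : Set ℝ) (t₀ : ℝ), IsFlowLine u γ s → s ∈ 𝓝 t₀ → γ t₀ = z₀ →
        ∀ᶠ t in 𝓝 t₀, a (γ t) = t - t₀ := by
  -- For `u` of class `C¹` the field is merely continuous, and no Lipschitz uniqueness theorem
  -- applies. The inverse function theorem for `(L, u)` reduces the flow on `{u = 0}` to one
  -- dimension, where the equation is solved by quadrature.
  have hcp := continuous_partialFst hu
  have hcs := continuous_partialSnd hu
  have hcg := continuous_gradSq hu
  set P := partialFst u z₀ with hP
  set q := partialSnd u z₀ with hq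
  -- the transversal coordinate
  set L : ℝ × ℝ → ℝ := fun z => -q * (z.1 - z₀.1) + P * (z.2 - z₀.2) with hL
  -- `D` is the derivative of `L` along `(-u_σ, u_x)`, and also minus the Jacobian of `(L, u)`.
  set D : ℝ × ℝ → ℝ := fun z => q * partialSnd u z + P * partialFst u z with hD
  have hLz : L z₀ = 0 := by simp [hL]
  have hDc : Continuous D := by fun_prop
  have hLc : Continuous L := by fun_prop
  have hDz : 0 < D z₀ := by
    have := gradSq_pos hreg
    simp only [gradSq, ← hP, ← hq] at this
    simp only [hD, ← hP, ← hq]; nlinarith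
  have hdet : ∀ z, -q * partialSnd u z - P * partialFst u z = -D z := fun z => by
    simp only [hD]; ring
  have hdet' : ∀ z, D z ≠ 0 → -q * partialSnd u z - P * partialFst u z ≠ 0 := fun z hz => by
    rw [hdet]; exact neg_ne_zero.2 hz
  have hΦ : ∀ z (hz : D z ≠ 0), HasStrictFDerivAt (fun z => (L z, u z))
      (planeEquiv (-q) P (partialFst u z) (partialSnd u z) (hdet' z hz) : ℝ × ℝ →L[ℝ] ℝ × ℝ) z := by
    intro z hz
    have h1 : HasStrictFDerivAt L (-q • ContinuousLinearMap.fst ℝ ℝ ℝ +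
        P • ContinuousLinearMap.snd ℝ ℝ ℝ) z := by
      have hf : HasStrictFDerivAt (fun z : ℝ × ℝ => z.1) (ContinuousLinearMap.fst ℝ ℝ ℝ) z :=
        hasStrictFDerivAt_fst
      have hs : HasStrictFDerivAt (fun z : ℝ × ℝ => z.2) (ContinuousLinearMap.snd ℝ ℝ ℝ) z :=
        hasStrictFDerivAt_snd
      exact ((hf.sub_const _).const_mul _).add ((hs.sub_const _).const_mul _)
    have h2 := (hu.contDiffAt (x := z)).hasStrictFDerivAt one_ne_zero
    have h3 := h1.prodMk h2
    refine h3.congr_fderiv ?_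
    refine ContinuousLinearMap.ext fun v => ?_
    simp only [ContinuousLinearEquiv.coe_coe]
    rw [planeEquiv_apply, ContinuousLinearMap.prod_apply, fderiv_plane_apply]
    simp only [add_apply, smul_apply,
      ContinuousLinearMap.coe_fst', ContinuousLinearMap.coe_snd', smul_eq_mul]
    ext
    · rfl
    · simp only; ring
  set e := (hΦ z₀ hDz.ne').toOpenPartialHomeomorph with he
  have hez : z₀ ∈ e.source := (hΦ z₀ hDz.ne').mem_toOpenPartialHomeomorph_source
  have hecoe : ∀ z, e z = (L z, u z) := fun z => rfl
  set c : ℝ → ℝ × ℝ := fun s => e.symm (s, 0) with hc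
  have hc0 : c 0 = z₀ := by
    have := e.left_inv hez
    rwa [hecoe, hLz, h₀] at this
  have ht0 : ((0 : ℝ), (0 : ℝ)) ∈ e.target := by
    have := e.map_source hez
    rwa [hecoe, hLz, h₀] at this
  have hcc : ∀ s : ℝ, (s, (0 : ℝ)) ∈ e.target → ContinuousAt c s := fun s hs =>
    (e.continuousAt_symm hs).comp (f := fun s : ℝ => (s, (0 : ℝ))) (by fun_prop)
  obtain ⟨δ, hδ, hδS⟩ : ∃ δ > 0, ∀ s ∈ Set.Ioo (-δ) δ, (s, (0 : ℝ)) ∈ e.target ∧ 0 < D (c s) := by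
    have h1 : ∀ᶠ s : ℝ in 𝓝 0, (s, (0 : ℝ)) ∈ e.target :=
      (by fun_prop : ContinuousAt (fun s : ℝ => (s, (0 : ℝ))) 0).eventually_mem
        (e.open_target.mem_nhds ht0)
    have h2 : ∀ᶠ s : ℝ in 𝓝 0, 0 < D (c s) :=
      (hDc.continuousAt.comp (hcc 0 ht0)).eventually_const_lt (by simpa [hc0] using hDz)
    obtain ⟨δ, hδ, h⟩ := Metric.eventually_nhds_iff_ball.1 (h1.and h2)
    exact ⟨δ, hδ, fun s hs => h s (by rwa [Real.ball_eq_Ioo, zero_sub, zero_add])⟩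
  have hce : ∀ s ∈ Set.Ioo (-δ) δ, L (c s) = s ∧ u (c s) = 0 := fun s hs => by
    have := e.right_inv (hδS s hs).1
    rw [hecoe] at this
    exact ⟨congrArg Prod.fst this, congrArg Prod.snd this⟩
  have hcd : ∀ s ∈ Set.Ioo (-δ) δ, HasDerivAt c ((D (c s))⁻¹ * (-partialSnd u (c s)),
      (D (c s))⁻¹ * partialFst u (c s)) s := fun s hs => by
    have hDs := (hδS s hs).2
    have h1 := e.hasFDerivAt_symm (hδS s hs).1 (hΦ (c s) hDs.ne').hasFDerivAt
    have h2 : HasDerivAt (fun s : ℝ => (s, (0 : ℝ))) ((1 : ℝ), (0 : ℝ)) s :=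
      (hasDerivAt_id s).prodMk (hasDerivAt_const s 0)
    refine (h1.comp_hasDerivAt s h2).congr_deriv ?_
    simp only [ContinuousLinearEquiv.coe_coe]
    rw [planeEquiv_symm_apply, hdet, inv_neg]
    ext <;> simp
  -- the time function along the level set
  set ρ : ℝ → ℝ := fun s => (1 + gradSq u (c s)) / D (c s) with hρ
  have hρc : ContinuousOn ρ (Set.Ioo (-δ) δ) := fun s hs => by
    have h1 := hcc s (hδS s hs).1
    refine ContinuousAt.continuousWithinAt (ContinuousAt.div ?_ ?_ (hδS s hs).2.ne')
    · exact continuousAt_const.add (hcg.continuousAt.comp h1)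
    · exact hDc.continuousAt.comp h1
  have hρpos : ∀ s ∈ Set.Ioo (-δ) δ, 0 < ρ s := fun s hs => by
    have h1 := (hδS s hs).2
    have h2 := gradSq_nonneg u (c s)
    simp only [hρ]; positivity
  -- `ρ = dt/ds` is the reciprocal of the speed of `L` along the field, so `A` is elapsed time; its
  -- inverse reparametrizes `c` by time.
  set A : ℝ → ℝ := fun s => ∫ x in (0 : ℝ)..s, ρ x with hA
  have h0δ : (0 : ℝ) ∈ Set.Ioo (-δ) δ := ⟨by linarith, hδ⟩
  have hA0 : A 0 = 0 := by simp [hA]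
  have hAd : ∀ s ∈ Set.Ioo (-δ) δ, HasStrictDerivAt A (ρ s) s := fun s hs => by
    refine intervalIntegral.integral_hasStrictDerivAt_right ?_ ?_
      (hρc.continuousAt (isOpen_Ioo.mem_nhds hs))
    · exact (hρc.mono (Set.OrdConnected.uIcc_subset Set.ordConnected_Ioo h0δ hs)).intervalIntegrable
    · exact hρc.stronglyMeasurableAtFilter isOpen_Ioo s hs
  have hA0d := (hAd 0 h0δ).hasStrictFDerivAt_equiv (hρpos 0 h0δ).ne'
  set eA := hA0d.toOpenPartialHomeomorph with heA
  have h0A : (0 : ℝ) ∈ eA.source := hA0d.mem_toOpenPartialHomeomorph_source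
  have hAcoe : ∀ s, eA s = A s := fun s => rfl
  have h0At : (0 : ℝ) ∈ eA.target := by
    have := eA.map_source h0A
    rwa [hAcoe, hA0] at this
  have hB0 : eA.symm 0 = 0 := by
    have := eA.left_inv h0A
    rwa [hAcoe, hA0] at this
  obtain ⟨ε, hε, hεS⟩ : ∃ ε > 0, ∀ t ∈ Set.Ioo (-ε) ε, t ∈ eA.target ∧
      eA.symm t ∈ Set.Ioo (-δ) δ := by
    have h1 : ∀ᶠ t : ℝ in 𝓝 0, t ∈ eA.target := eA.open_target.mem_nhds h0At
    have h2 : ∀ᶠ t : ℝ in 𝓝 0, eA.symm t ∈ Set.Ioo (-δ) δ :=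
      (eA.continuousAt_symm h0At).eventually_mem (by rw [hB0]; exact isOpen_Ioo.mem_nhds h0δ)
    obtain ⟨ε, hε, h⟩ := Metric.eventually_nhds_iff_ball.1 (h1.and h2)
    exact ⟨ε, hε, fun s hs => h s (by rwa [Real.ball_eq_Ioo, zero_sub, zero_add])⟩
  have hLδ : ∀ᶠ z in 𝓝 z₀, L z ∈ Set.Ioo (-δ) δ :=
    hLc.continuousAt.eventually_mem (by rw [hLz]; exact isOpen_Ioo.mem_nhds h0δ)
  have hsrc : ∀ᶠ z in 𝓝 z₀, z ∈ e.source := e.open_source.mem_nhds hez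
  have hcL : ∀ z, z ∈ e.source → u z = 0 → c (L z) = z := fun z hz hz0 => by
    have := e.left_inv hz
    rwa [hecoe, hz0] at this
  refine ⟨ε, hε, A ∘ L, c ∘ eA.symm, ?_, ?_, ?_, ?_, ?_⟩
  · simp [hLz, hA0]
  · refine ContinuousAt.comp ?_ hLc.continuousAt
    rw [hLz]
    exact (hAd 0 h0δ).hasDerivAt.continuousAt
  · intro t ht
    have hB := (hεS t ht).2
    refine ⟨(hce _ hB).2, ?_⟩
    have h1 := eA.hasDerivAt_symm (hεS t ht).1 (hρpos _ hB).ne' (hAd _ hB).hasDerivAt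
    refine ((hcd _ hB).scomp t h1).congr_deriv ?_
    have hDs := (hδS _ hB).2
    have h2 := gradSq_nonneg u (c (eA.symm t))
    have h3 : 0 < 1 + gradSq u (c (eA.symm t)) := by linarith
    simp only [hρ, levelField, Function.comp_apply]
    ext
    · simp only [Prod.smul_mk, smul_eq_mul]; field_simp
    · simp only [Prod.smul_mk, smul_eq_mul]; field_simp
  · have h1 : ∀ᶠ z in 𝓝 z₀, L z ∈ eA.source :=
      hLc.continuousAt.eventually_mem (by rw [hLz]; exact eA.open_source.mem_nhds h0A)
    filter_upwards [hsrc, h1] with z hz1 hz2 hz3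
    have := eA.left_inv hz2
    rw [hAcoe] at this
    simp only [Function.comp_apply]
    rw [this, hcL z hz1 hz3]
  · intro γ s t₀ hγ hs hγ0
    have hγc : ContinuousAt γ t₀ := (hγ t₀ (mem_of_mem_nhds hs)).2.continuousAt
    have h1 : ∀ᶠ t in 𝓝 t₀, γ t ∈ e.source ∧ L (γ t) ∈ Set.Ioo (-δ) δ := by
      have := hsrc.and hLδ
      rw [← hγ0] at this
      exact hγc.eventually this
    obtain ⟨κ, hκ, hball⟩ := Metric.eventually_nhds_iff_ball.1 (h1.and hs)
    -- Along a flow line `L` moves at speed `1/ρ`, so `A ∘ L` advances at unit rate.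
    have hder : ∀ t ∈ Metric.ball t₀ κ, HasDerivAt (fun t => A (L (γ t)) - t) 0 t := by
      intro t ht
      obtain ⟨⟨ht1, ht2⟩, ht3⟩ := hball t ht
      obtain ⟨hγt, hγd⟩ := hγ t ht3
      have hcγ := hcL _ ht1 hγt
      have hf : HasDerivAt (fun t => (γ t).1) (levelField u (γ t)).1 t :=
        (hasFDerivAt_fst (𝕜 := ℝ) (p := γ t)).comp_hasDerivAt t hγd
      have hsn : HasDerivAt (fun t => (γ t).2) (levelField u (γ t)).2 t :=
        (hasFDerivAt_snd (𝕜 := ℝ) (p := γ t)).comp_hasDerivAt t hγd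
      have hLd : HasDerivAt (fun t => L (γ t)) (-q * (levelField u (γ t)).1 +
          P * (levelField u (γ t)).2) t :=
        ((hf.sub_const _).const_mul _).add ((hsn.sub_const _).const_mul _)
      refine (((hAd _ ht2).hasDerivAt.comp t hLd).sub (hasDerivAt_id t)).congr_deriv ?_
      have hDs := (hδS _ ht2).2
      simp only [hρ]
      rw [hcγ] at hDs ⊢
      have h2 := gradSq_nonneg u (γ t)
      have h3 : 0 < 1 + gradSq u (γ t) := by linarith
      have h4 : -q * (levelField u (γ t)).1 + P * (levelField u (γ t)).2 =
          (1 + gradSq u (γ t))⁻¹ * D (γ t) := by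
        simp only [levelField, hD]; ring
      rw [h4]
      field_simp
      ring
    have hconst : ∀ t ∈ Metric.ball t₀ κ, A (L (γ t)) - t = A (L (γ t₀)) - t₀ := fun t ht =>
      Metric.isOpen_ball.is_const_of_deriv_eq_zero (f := fun t => A (L (γ t)) - t)
        (convex_ball t₀ κ).isPreconnected
        (fun t ht => (hder t ht).differentiableAt.differentiableWithinAt)
        (fun t ht => (hder t ht).deriv) ht (Metric.mem_ball_self hκ)
    filter_upwards [Metric.ball_mem_nhds t₀ hκ] with t ht
    have := hconst t ht
    rw [hγ0, hLz, hA0] at this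
    simp only [Function.comp_apply]
    linarith

/-! ### Global flow lines and the components of a regular level set. -/

/-- Zero is a regular value of the `C¹` function `u`. -/
structure IsRegularLevel (u : ℝ × ℝ → ℝ) : Prop where
  contDiff : ContDiff ℝ 1 u
  fderiv_ne_zero : ∀ z, u z = 0 → fderiv ℝ u z ≠ 0

namespace IsRegularLevel

variable {u : ℝ × ℝ → ℝ}

/-- Both curves read the same time `t - t₀` on the clock `a`, and `b` recovers a point of the level
set from that reading. -/
lemma eventuallyEq_of_eq (hu : IsRegularLevel u) {γ η : ℝ → ℝ × ℝ} {s s' : Set ℝ} {t₀ : ℝ}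
    (hγ : IsFlowLine u γ s) (hη : IsFlowLine u η s') (hs : s ∈ 𝓝 t₀) (hs' : s' ∈ 𝓝 t₀)
    (h : γ t₀ = η t₀) : γ =ᶠ[𝓝 t₀] η := by
  have h0 := hγ t₀ (mem_of_mem_nhds hs)
  have h0' := hη t₀ (mem_of_mem_nhds hs')
  obtain ⟨ε, hε, a, b, ha0, hac, hb, hab, huniq⟩ :=
    exists_flowBox hu.contDiff h0.1 (hu.fderiv_ne_zero _ h0.1)
  have e1 := huniq γ s t₀ hγ hs rfl
  have e2 := huniq η s' t₀ hη hs' h.symm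
  have e3 := h0.2.continuousAt.eventually hab
  have e4 := h0'.2.continuousAt.eventually (h ▸ hab)
  filter_upwards [e1, e2, e3, e4, hs, hs'] with t h1 h2 h3 h4 h5 h6
  rw [← h3 (hγ t h5).1, ← h4 (hη t h6).1, h1, h2]

lemma eqOn_of_eq (hu : IsRegularLevel u) {γ η : ℝ → ℝ × ℝ} {s : Set ℝ} (hs : IsOpen s)
    (hsc : IsPreconnected s) {t₀ : ℝ} (ht₀ : t₀ ∈ s)
    (hγ : IsFlowLine u γ s) (hη : IsFlowLine u η s) (h : γ t₀ = η t₀) : Set.EqOn γ η s := by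
  have key : s ⊆ {t | γ =ᶠ[𝓝 t] η} := by
    refine hsc.subset_of_closure_inter_subset (isOpen_iff_eventually.2 fun t ht => ?_)
      ⟨t₀, ht₀, hu.eventuallyEq_of_eq hγ hη (hs.mem_nhds ht₀) (hs.mem_nhds ht₀) h⟩ ?_
    · exact eventually_eventually_nhds.2 ht
    · rintro t ⟨htc, hts⟩
      refine hu.eventuallyEq_of_eq hγ hη (hs.mem_nhds hts) (hs.mem_nhds hts) ?_
      have h1 := (hγ t hts).2.continuousAt
      have h2 := (hη t hts).2.continuousAt
      have hfr : ∃ᶠ t' in 𝓝 t, γ t' = η t' :=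
        (mem_closure_iff_frequently.1 htc).mono fun t' ht' => ht'.eq_of_nhds
      by_contra hne
      exact hfr ((h1.ne_iff_eventually_ne h2).1 hne)
  exact fun t ht => (key ht).eq_of_nhds

lemma glue (hu : IsRegularLevel u) {γ η : ℝ → ℝ × ℝ} {a b c d t₁ : ℝ}
    (hγ : IsFlowLine u γ (Set.Ioo a b)) (hη : IsFlowLine u η (Set.Ioo c d))
    (h1 : t₁ ∈ Set.Ioo a b) (h2 : t₁ ∈ Set.Ioo c d) (h : γ t₁ = η t₁) :
    ∃ ζ : ℝ → ℝ × ℝ, IsFlowLine u ζ (Set.Ioo a d) ∧ (∀ t ≤ t₁, ζ t = γ t) ∧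
      ∀ t ≥ t₁, ζ t = η t := by
  have heq := hu.eventuallyEq_of_eq hγ hη (isOpen_Ioo.mem_nhds h1) (isOpen_Ioo.mem_nhds h2) h
  have hle : ∀ t ≤ t₁, (if t ≤ t₁ then γ t else η t) = γ t := fun t ht => if_pos ht
  have hge : ∀ t ≥ t₁, (if t ≤ t₁ then γ t else η t) = η t := fun t ht => by
    split_ifs with h'
    · rw [le_antisymm h' ht, h]
    · rfl
  refine ⟨fun t => if t ≤ t₁ then γ t else η t, fun t ht => ?_, hle, hge⟩
  rcases lt_trichotomy t t₁ with h' | h' | h'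
  · have he : (fun t => if t ≤ t₁ then γ t else η t) =ᶠ[𝓝 t] γ := by
      filter_upwards [Iio_mem_nhds h'] with t' ht' using hle t' (le_of_lt ht')
    exact (hγ.mono (s' := {t}) (by
      rintro _ rfl; exact ⟨ht.1, h'.trans h1.2⟩)).congr (by rintro _ rfl; exact he) t rfl
  · have he : (fun t => if t ≤ t₁ then γ t else η t) =ᶠ[𝓝 t] γ := by
      rw [h']
      filter_upwards [heq] with t' ht'
      split_ifs
      · rfl
      · exact ht'.symm
    exact (hγ.mono (s' := {t}) (by
      rintro _ rfl; exact h' ▸ h1)).congr (by rintro _ rfl; exact he) t rfl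
  · have he : (fun t => if t ≤ t₁ then γ t else η t) =ᶠ[𝓝 t] η := by
      filter_upwards [Ioi_mem_nhds h'] with t' ht' using hge t' (le_of_lt ht')
    exact (hη.mono (s' := {t}) (by
      rintro _ rfl; exact ⟨h2.1.trans h', ht.2⟩)).congr (by rintro _ rfl; exact he) t rfl

lemma isFlowLine_shift {γ : ℝ → ℝ × ℝ} {a b c : ℝ} (h : IsFlowLine u γ (Set.Ioo a b)) :
    IsFlowLine u (fun t => γ (t - c)) (Set.Ioo (a + c) (b + c)) := by
  refine (h.comp_add_const (-c)).mono fun t ht => ?_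
  exact ⟨by linarith [ht.1], by linarith [ht.2]⟩

lemma exists_local (hu : IsRegularLevel u) (z₀ : ℝ × ℝ) :
    ∃ ε > 0, ∀ᶠ z in 𝓝 z₀, u z = 0 → ∃ γ : ℝ → ℝ × ℝ, γ 0 = z ∧
      IsFlowLine u γ (Set.Ioo (-ε) ε) := by
  by_cases h0 : u z₀ = 0
  · obtain ⟨ε, hε, a, b, ha0, hac, hb, hab, -⟩ :=
      exists_flowBox hu.contDiff h0 (hu.fderiv_ne_zero _ h0)
    have h1 : ∀ᶠ z in 𝓝 z₀, |a z| < ε / 2 := hac.abs.eventually_lt continuousAt_const (by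
      rw [ha0, abs_zero]; linarith)
    refine ⟨ε / 2, by linarith, ?_⟩
    filter_upwards [h1, hab] with z hz1 hz2 hz0
    refine ⟨fun t => b (t + a z), by simpa using hz2 hz0, (hb.comp_add_const (a z)).mono ?_⟩
    intro t ht
    have := abs_lt.1 hz1
    exact ⟨by linarith [ht.1], by linarith [ht.2]⟩
  · refine ⟨1, one_pos, ?_⟩
    filter_upwards [hu.contDiff.continuous.continuousAt.eventually_ne h0] with z hz hz0
    exact absurd hz0 hz

lemma exists_uniform (hu : IsRegularLevel u) {K : Set (ℝ × ℝ)} (hK : IsCompact K) :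
    ∃ ε > 0, ∀ z ∈ K, u z = 0 → ∃ γ : ℝ → ℝ × ℝ, γ 0 = z ∧
      IsFlowLine u γ (Set.Ioo (-ε) ε) := by
  refine hK.induction_on (p := fun K => ∃ ε > 0, ∀ z ∈ K, u z = 0 → ∃ γ : ℝ → ℝ × ℝ, γ 0 = z ∧
      IsFlowLine u γ (Set.Ioo (-ε) ε)) ⟨1, one_pos, by simp⟩ ?_ ?_ ?_
  · rintro s t hst ⟨ε, hε, h⟩
    exact ⟨ε, hε, fun z hz => h z (hst hz)⟩
  · rintro s t ⟨ε, hε, h⟩ ⟨ε', hε', h'⟩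
    refine ⟨min ε ε', lt_min hε hε', fun z hz hz0 => ?_⟩
    rcases hz with hz | hz
    · obtain ⟨γ, h1, h2⟩ := h z hz hz0
      exact ⟨γ, h1, h2.mono (Set.Ioo_subset_Ioo (neg_le_neg (min_le_left _ _)) (min_le_left _ _))⟩
    · obtain ⟨γ, h1, h2⟩ := h' z hz hz0
      exact ⟨γ, h1, h2.mono (Set.Ioo_subset_Ioo (neg_le_neg (min_le_right _ _))
        (min_le_right _ _))⟩
  · intro z _
    obtain ⟨ε, hε, h⟩ := hu.exists_local z
    exact ⟨_, mem_nhdsWithin_of_mem_nhds h, ε, hε, fun w hw => hw⟩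

lemma dist_flowLine_le {γ : ℝ → ℝ × ℝ} {a : ℝ} (hγ : IsFlowLine u γ (Set.Ioo (-a) a)) {t : ℝ}
    (ht : t ∈ Set.Ioo (-a) a) : dist (γ t) (γ 0) ≤ a := by
  have ha : 0 < a := by linarith [ht.1, ht.2]
  have h := (convex_Ioo (-a) a).norm_image_sub_le_of_norm_hasDerivWithin_le (f := γ) (C := 1)
    (fun t ht => (hγ t ht).2.hasDerivWithinAt) (fun t _ => norm_levelField_le u _)
    (x := 0) (y := t) ⟨by linarith, ha⟩ ht
  rw [dist_eq_norm]
  refine h.trans ?_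
  rw [one_mul, sub_zero, Real.norm_eq_abs, abs_le]
  exact ⟨ht.1.le, ht.2.le⟩

lemma exists_flowLine_Ioo (hu : IsRegularLevel u) {z : ℝ × ℝ} (hz : u z = 0) (R : ℝ) :
    ∃ γ : ℝ → ℝ × ℝ, γ 0 = z ∧ IsFlowLine u γ (Set.Ioo (-R) R) := by
  obtain ⟨ε, hε, hK⟩ := hu.exists_uniform (isCompact_closedBall z R)
  have key : ∀ n : ℕ, ∃ a > 0, (R ≤ a ∨ n * (ε / 2) ≤ a) ∧ ∃ γ : ℝ → ℝ × ℝ, γ 0 = z ∧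
      IsFlowLine u γ (Set.Ioo (-a) a) := by
    intro n
    induction n with
    | zero =>
      obtain ⟨ε', hε', h⟩ := hu.exists_local z
      exact ⟨ε', hε', Or.inr (by simpa using hε'.le), h.self_of_nhds hz⟩
    | succ n ih =>
      obtain ⟨a, ha, hor, γ, hγ0, hγ⟩ := ih
      by_cases haR : R ≤ a
      · exact ⟨a, ha, Or.inl haR, γ, hγ0, hγ⟩
      have hna := hor.resolve_left haR
      have haR' : a < R := not_le.1 haR
      -- Gluing at `±(a - δ)` reaches `a - δ + ε ≥ a + ε/2`. The bound `δ ≤ a/2` keeps the gluing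
      -- times on opposite sides of `0`, so the starting point is unchanged.
      set δ := min (ε / 2) (a / 2) with hδ
      have hδ0 : 0 < δ := lt_min (by linarith) (by linarith)
      have hδ1 : δ ≤ ε / 2 := min_le_left _ _
      have hδ2 : δ ≤ a / 2 := min_le_right _ _
      have ht1 : a - δ ∈ Set.Ioo (-a) a := ⟨by linarith, by linarith⟩
      have ht2 : -(a - δ) ∈ Set.Ioo (-a) a := ⟨by linarith, by linarith⟩
      obtain ⟨η₁, hη₁0, hη₁⟩ := hK (γ (a - δ)) (by
        rw [Metric.mem_closedBall]
        exact (hγ0 ▸ dist_flowLine_le hγ ht1).trans haR'.le) (hγ _ ht1).1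
      obtain ⟨η₂, hη₂0, hη₂⟩ := hK (γ (-(a - δ))) (by
        rw [Metric.mem_closedBall]
        exact (hγ0 ▸ dist_flowLine_le hγ ht2).trans haR'.le) (hγ _ ht2).1
      obtain ⟨ζ, hζ, hζl, -⟩ := hu.glue hγ (isFlowLine_shift (c := a - δ) hη₁) ht1
        ⟨by linarith, by linarith⟩ (by simp [hη₁0])
      obtain ⟨ξ, hξ, -, hξr⟩ := hu.glue (isFlowLine_shift (c := -(a - δ)) hη₂) hζ
        (t₁ := -(a - δ)) ⟨by linarith, by linarith⟩ ⟨by linarith, by linarith⟩ (by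
          rw [hζl _ (by linarith)]; simp [hη₂0])
      refine ⟨a + ε / 2, by linarith, Or.inr (by push_cast; linarith), ξ, ?_, hξ.mono ?_⟩
      · rw [hξr 0 (by linarith), hζl 0 (by linarith), hγ0]
      · exact Set.Ioo_subset_Ioo (by linarith) (by linarith)
  obtain ⟨n, hn⟩ := exists_nat_gt (R / (ε / 2))
  obtain ⟨a, -, hor, γ, h0, hγ⟩ := key n
  have hRa : R ≤ a := hor.elim id fun h => by
    rw [div_lt_iff₀ (by linarith)] at hn
    linarith
  exact ⟨γ, h0, hγ.mono (Set.Ioo_subset_Ioo (by linarith) hRa)⟩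

/-- Through every point of a regular level set there is a flow line defined for all times. -/
theorem exists_flowLine (hu : IsRegularLevel u) {z : ℝ × ℝ} (hz : u z = 0) :
    ∃ γ : ℝ → ℝ × ℝ, γ 0 = z ∧ IsFlowLine u γ Set.univ := by
  choose Γ hΓ0 hΓ using fun n : ℕ => hu.exists_flowLine_Ioo hz (n + 1)
  have hagree : ∀ n m : ℕ, n ≤ m → Set.EqOn (Γ n) (Γ m) (Set.Ioo (-(n + 1 : ℝ)) (n + 1)) := by
    intro n m hnm
    have h' : (n : ℝ) ≤ m := by exact_mod_cast hnm
    have hn : (0 : ℝ) ≤ n := Nat.cast_nonneg n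
    exact hu.eqOn_of_eq isOpen_Ioo isPreconnected_Ioo (t₀ := 0) ⟨by linarith, by linarith⟩ (hΓ n)
      ((hΓ m).mono (Set.Ioo_subset_Ioo (by linarith) (by linarith))) (by rw [hΓ0, hΓ0])
  have hval : ∀ (N : ℕ) (t : ℝ), |t| < N → Γ ⌈|t|⌉₊ t = Γ N t := fun N t ht => by
    refine hagree _ N (Nat.ceil_le.2 ht.le) (abs_lt.1 ?_)
    have := Nat.le_ceil |t|
    linarith
  -- `Γ n` lives on `|t| < n + 1`, so the index `⌈|t|⌉₊` is admissible even when `|t|` is an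
  -- integer.
  refine ⟨fun t => Γ ⌈|t|⌉₊ t, by simp [hΓ0], fun t _ => ?_⟩
  obtain ⟨N, hN⟩ := exists_nat_gt |t|
  have he : (fun t => Γ ⌈|t|⌉₊ t) =ᶠ[𝓝 t] Γ N := by
    have : ∀ᶠ t' : ℝ in 𝓝 t, |t'| < N :=
      continuous_abs.continuousAt.eventually_lt continuousAt_const hN
    filter_upwards [this] with t' ht' using hval N t' ht'
  refine (((hΓ N).mono (s' := {t}) ?_).congr (by rintro _ rfl; exact he)) t rfl
  rintro _ rfl
  exact abs_lt.1 (by linarith)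

lemma eq_of_eq (hu : IsRegularLevel u) {γ η : ℝ → ℝ × ℝ} (hγ : IsFlowLine u γ Set.univ)
    (hη : IsFlowLine u η Set.univ) {s t : ℝ} (h : γ s = η t) (τ : ℝ) : γ (s + τ) = η (t + τ) := by
  have h1 : IsFlowLine u (fun τ => γ (τ + s)) Set.univ := hγ.comp_add_const s
  have h2 : IsFlowLine u (fun τ => η (τ + t)) Set.univ := hη.comp_add_const t
  have := hu.eqOn_of_eq isOpen_univ isPreconnected_univ (t₀ := 0) trivial h1 h2 (by simpa using h)
    (Set.mem_univ τ)
  simpa [add_comm] using this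

lemma continuous_flowLine {γ : ℝ → ℝ × ℝ} (hγ : IsFlowLine u γ Set.univ) : Continuous γ :=
  continuous_iff_continuousAt.2 fun t => (hγ t trivial).2.continuousAt

/-- Near a point of a flow line the level set contains nothing but that flow line. Closedness of
orbits and of their complements, and the embedding property, all follow from this. -/
lemma eventually_eq_flowLine (hu : IsRegularLevel u) {γ : ℝ → ℝ × ℝ}
    (hγ : IsFlowLine u γ Set.univ) (t₀ : ℝ) :
    ∃ a : ℝ × ℝ → ℝ, a (γ t₀) = 0 ∧ ContinuousAt a (γ t₀) ∧
      ∀ᶠ w in 𝓝 (γ t₀), u w = 0 → w = γ (t₀ + a w) := by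
  have h0 := (hγ t₀ trivial).1
  obtain ⟨ε, hε, a, b, ha0, hac, hb, hab, -⟩ :=
      exists_flowBox hu.contDiff h0 (hu.fderiv_ne_zero _ h0)
  refine ⟨a, ha0, hac, ?_⟩
  have h1 : ∀ᶠ z in 𝓝 (γ t₀), |a z| < ε := hac.abs.eventually_lt continuousAt_const (by
      rw [ha0, abs_zero]; linarith)
  have hb0 : b 0 = γ t₀ := by
    have := hab.self_of_nhds h0
    rwa [ha0] at this
  have hγ' : IsFlowLine u (fun t => γ (t + t₀)) (Set.Ioo (-ε) ε) :=
    (hγ.comp_add_const t₀).mono fun _ _ => trivial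
  have heq := hu.eqOn_of_eq isOpen_Ioo isPreconnected_Ioo (t₀ := 0) ⟨by linarith, hε⟩ hb hγ'
    (by simpa using hb0)
  filter_upwards [h1, hab] with w hw1 hw2 hw0
  have := heq (abs_lt.1 hw1)
  rw [hw2 hw0] at this
  rw [add_comm]
  exact this

lemma isClosed_zero (hu : IsRegularLevel u) : IsClosed {z | u z = 0} :=
  isClosed_eq hu.contDiff.continuous continuous_const

lemma isClosed_range (hu : IsRegularLevel u) {γ : ℝ → ℝ × ℝ} (hγ : IsFlowLine u γ Set.univ) :
    IsClosed (Set.range γ) := by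
  have hsub : Set.range γ ⊆ {z | u z = 0} := by rintro _ ⟨t, rfl⟩; exact (hγ t trivial).1
  refine isClosed_of_closure_subset fun z hz => ?_
  have hz0 : u z = 0 := closure_minimal hsub hu.isClosed_zero hz
  obtain ⟨η, hη0, hη⟩ := hu.exists_flowLine hz0
  obtain ⟨a, ha0, hac, hw⟩ := hu.eventually_eq_flowLine hη 0
  rw [hη0] at hw
  obtain ⟨_, ⟨t, rfl⟩, hw1⟩ := ((mem_closure_iff_frequently.1 hz).and_eventually hw).exists
  have h1 := hw1 (hγ t trivial).1
  refine ⟨t + -(0 + a (γ t)), ?_⟩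
  rw [hu.eq_of_eq hγ hη h1, ← hη0]
  congr 1; ring

lemma isClosed_diff_range (hu : IsRegularLevel u) {γ : ℝ → ℝ × ℝ} (hγ : IsFlowLine u γ Set.univ) :
    IsClosed ({z | u z = 0} \ Set.range γ) := by
  refine isClosed_of_closure_subset fun z hz => ?_
  have hz0 : u z = 0 := closure_minimal Set.sdiff_subset hu.isClosed_zero hz
  refine ⟨hz0, ?_⟩
  rintro ⟨t, rfl⟩
  obtain ⟨a, ha0, hac, hw⟩ := hu.eventually_eq_flowLine hγ t
  obtain ⟨w, ⟨hw0, hw1⟩, hw2⟩ := ((mem_closure_iff_frequently.1 hz).and_eventually hw).exists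
  exact hw1 ⟨_, (hw2 hw0).symm⟩

/-- The orbit and the rest of the level set are both closed, so a connected subset meeting the orbit
lies in it. -/
lemma connectedComponentIn_eq_range (hu : IsRegularLevel u) {γ : ℝ → ℝ × ℝ}
    (hγ : IsFlowLine u γ Set.univ) (t : ℝ) :
    connectedComponentIn {z | u z = 0} (γ t) = Set.range γ := by
  have hsub : Set.range γ ⊆ {z | u z = 0} := by rintro _ ⟨t, rfl⟩; exact (hγ t trivial).1
  apply Set.Subset.antisymm
  · have hpre := isPreconnected_connectedComponentIn (F := {z | u z = 0}) (x := γ t)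
    have hmem : γ t ∈ connectedComponentIn {z | u z = 0} (γ t) :=
      mem_connectedComponentIn (hγ t trivial).1
    have hC := connectedComponentIn_subset {z | u z = 0} (γ t)
    have := isPreconnected_iff_subset_of_disjoint_closed.1 hpre (Set.range γ)
      ({z | u z = 0} \ Set.range γ) (hu.isClosed_range hγ) (hu.isClosed_diff_range hγ)
      (by rwa [Set.union_sdiff_cancel hsub]) (by simp)
    refine this.resolve_right fun h => (h hmem).2 ⟨t, rfl⟩
  · exact (isPreconnected_range (continuous_flowLine hγ)).subset_connectedComponentIn ⟨t, rfl⟩ hsub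

/-- The local clock gives a left inverse of `γ`, continuous at the point considered, so `γ` induces
the topology of the line. -/
lemma isEmbedding_of_injective (hu : IsRegularLevel u) {γ : ℝ → ℝ × ℝ}
    (hγ : IsFlowLine u γ Set.univ) (hinj : Function.Injective γ) : IsEmbedding γ := by
  refine ⟨isInducing_iff_nhds.2 fun t₀ => le_antisymm ?_ ?_, hinj⟩
  · exact (continuous_flowLine hγ).continuousAt.tendsto.le_comap
  · obtain ⟨a, ha0, hac, hw⟩ := hu.eventually_eq_flowLine hγ t₀
    have h1 : Tendsto (fun t => t₀ + a (γ t)) (comap γ (𝓝 (γ t₀))) (𝓝 t₀) := by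
      have : Tendsto (fun w => t₀ + a w) (𝓝 (γ t₀)) (𝓝 t₀) := by
        simpa [ha0] using hac.tendsto.const_add t₀
      exact this.comp tendsto_comap
    have h2 : (fun t => t₀ + a (γ t)) =ᶠ[comap γ (𝓝 (γ t₀))] id := by
      filter_upwards [tendsto_comap.eventually hw] with t ht
      exact (hinj (ht (hγ t trivial).1)).symm
    exact (tendsto_congr' h2).1 h1

/-- A flow line is injective or has a minimal period. -/
lemma injective_or_periodic (hu : IsRegularLevel u) {γ : ℝ → ℝ × ℝ}
    (hγ : IsFlowLine u γ Set.univ) :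
    Function.Injective γ ∨ ∃ T > 0, ∀ s t, γ s = γ t ↔ ∃ n : ℤ, s - t = n * T := by
  let G : AddSubgroup ℝ :=
    { carrier := {c | ∀ t, γ (t + c) = γ t}
      add_mem' := fun {a b} ha hb t => by rw [← add_assoc, hb, ha]
      zero_mem' := fun t => by rw [add_zero]
      neg_mem' := fun {a} ha t => by rw [← ha (t + -a), neg_add_cancel_right] }
  have hG : ∀ c, c ∈ G ↔ ∀ t, γ (t + c) = γ t := fun c => Iff.rfl
  have hper : ∀ s t, γ s = γ t ↔ s - t ∈ G := fun s t => by
    constructor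
    · intro h τ
      have := hu.eq_of_eq hγ hγ h (τ - t)
      rw [add_sub_cancel] at this
      rw [← this]; congr 1; ring
    · intro h
      have := h t
      rwa [add_sub_cancel] at this
  have hc := continuous_flowLine hγ
  -- A dense group of periods would make `γ` constant, whereas its velocity never vanishes.
  rcases AddSubgroup.dense_or_cyclic G with hd | ⟨T, hT⟩
  · exfalso
    have hconst : ∀ c, γ c = γ 0 := fun c => by
      have hcl : IsClosed {c | γ c = γ 0} := isClosed_eq hc continuous_const
      have : (G : Set ℝ) ⊆ {c | γ c = γ 0} := fun c hc => by simpa using hc 0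
      have := hcl.closure_subset_iff.2 this
      rw [hd.closure_eq] at this
      exact this trivial
    have h1 := (hγ 0 trivial).2
    have h2 : HasDerivAt γ 0 0 := by
      rw [show γ = fun _ => γ 0 from funext hconst]; exact hasDerivAt_const _ _
    exact levelField_ne_zero (hu.fderiv_ne_zero _ (hγ 0 trivial).1) (h1.unique h2)
  · by_cases hT0 : T = 0
    · left
      intro s t hst
      have := (hper s t).1 hst
      rw [hT, hT0, AddSubgroup.closure_singleton_zero, AddSubgroup.mem_bot] at this
      exact sub_eq_zero.1 this
    · right
      refine ⟨|T|, abs_pos.2 hT0, fun s t => ?_⟩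
      rw [hper, hT, AddSubgroup.mem_closure_singleton]
      constructor
      · rintro ⟨n, hn⟩
        rcases abs_choice T with h | h
        · exact ⟨n, by rw [h, ← hn, zsmul_eq_mul]⟩
        · exact ⟨-n, by rw [h, ← hn, zsmul_eq_mul]; push_cast; ring⟩
      · rintro ⟨n, hn⟩
        rcases abs_choice T with h | h
        · exact ⟨n, by rw [hn, h, zsmul_eq_mul]⟩
        · exact ⟨-n, by rw [hn, h, zsmul_eq_mul]; push_cast; ring⟩

end IsRegularLevel

/-! ### Smoothness of flow lines. -/

lemma contDiffOn_levelField {u : ℝ × ℝ → ℝ} {V : Set (ℝ × ℝ)} (hV : IsOpen V) {n : ℕ}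
    (h : ContDiffOn ℝ (n + 1) u V) : ContDiffOn ℝ n (levelField u) V := by
  have hd : ContDiffOn ℝ n (fderiv ℝ u) V := h.fderiv_of_isOpen hV le_rfl
  have h1 : ContDiffOn ℝ n (partialFst u) V := hd.clm_apply contDiffOn_const
  have h2 : ContDiffOn ℝ n (partialSnd u) V := hd.clm_apply contDiffOn_const
  have h3 : ContDiffOn ℝ n (fun z => (1 + gradSq u z)⁻¹) V := by
    refine ContDiffOn.inv (contDiffOn_const.add ((h1.pow 2).add (h2.pow 2))) fun z _ => ?_
    have := gradSq_nonneg u z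
    positivity
  exact (h3.mul h2.neg).prodMk (h3.mul h1)

/-- Bootstrapping in `γ' = X ∘ γ`: the field `X` loses one derivative against `u`, and the
integration restores it. -/
lemma contDiffOn_flowLine {u : ℝ × ℝ → ℝ} {γ : ℝ → ℝ × ℝ} (hγ : IsFlowLine u γ Set.univ)
    {V : Set (ℝ × ℝ)} (hV : IsOpen V) {S : Set ℝ} (hS : IsOpen S) (hSV : Set.MapsTo γ S V) {N : ℕ}
    (h : ContDiffOn ℝ N u V) : ∀ n ≤ N, ContDiffOn ℝ n γ S := by
  intro n
  induction n with
  | zero =>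
    exact fun _ => contDiffOn_zero.2 (IsRegularLevel.continuous_flowLine hγ).continuousOn
  | succ n ih =>
    intro hn
    rw [Nat.cast_succ, contDiffOn_succ_iff_deriv_of_isOpen hS]
    refine ⟨fun t _ => (hγ t trivial).2.differentiableAt.differentiableWithinAt, by simp, ?_⟩
    rw [show deriv γ = levelField u ∘ γ from funext fun t => (hγ t trivial).2.deriv]
    have h1 : ContDiffOn ℝ (n + 1) u V := h.of_le (by exact_mod_cast hn)
    exact (contDiffOn_levelField hV h1).comp (ih (by omega)) hSV

lemma isRegularParam_flowLine {u : ℝ × ℝ → ℝ} {r : ℕ∞} (hf : IsScaleField r u)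
    (hu : IsRegularLevel u) {γ : ℝ → ℝ × ℝ} (hγ : IsFlowLine u γ Set.univ) :
    IsRegularParam r γ := by
  refine ⟨?_, fun t => ?_, fun t ht => ?_⟩
  · rw [contDiff_iff_forall_nat_le]
    intro n hn
    rw [← contDiffOn_univ]
    exact contDiffOn_flowLine hγ isOpen_univ isOpen_univ (Set.mapsTo_univ _ _)
      (contDiffOn_univ.2 (hf.contDiff.of_le (by exact_mod_cast hn))) n le_rfl
  · rw [(hγ t trivial).2.deriv]
    exact levelField_ne_zero (hu.fderiv_ne_zero _ (hγ t trivial).1)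
  · rw [contDiffAt_infty]
    intro n
    have hS : IsOpen {t | (γ t).2 ≠ 0} :=
      isOpen_offAxis.preimage (IsRegularLevel.continuous_flowLine hγ)
    exact (contDiffOn_flowLine hγ isOpen_offAxis hS (fun t ht => ht)
      (fun z hz => ((hf.contDiffAt_offAxis z hz).of_le
        (by exact_mod_cast le_top)).contDiffWithinAt) n le_rfl).contDiffAt (hS.mem_nhds ht)

/-! ### A separating function and the maximum principle. -/

/-- A function on the plane whose zero set splits into disjoint closed sets `K` and `N`, with `K`
connected, agrees in sign near `K` with a function vanishing on `K` only. -/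
theorem exists_separating_function {u : ℝ × ℝ → ℝ} (hu : Continuous u) {K N : Set (ℝ × ℝ)}
    (hK : IsClosed K) (hN : IsClosed N) (hKN : Disjoint K N) (hz : {z | u z = 0} = K ∪ N)
    (hKc : IsPreconnected K) (hKne : K.Nonempty) :
    ∃ v : ℝ × ℝ → ℝ, Continuous v ∧ (∀ z, v z = 0 ↔ z ∈ K) ∧
      ∀ z ∈ K, ∀ᶠ w in 𝓝 z, (0 < u w → 0 < v w) ∧ (u w < 0 → v w < 0) := by
  obtain ⟨χ, hχN, hχK, -⟩ := exists_continuous_zero_one_of_isClosed hN hK hKN.symm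
  have hχc : Continuous χ := χ.continuous
  set s : ℝ × ℝ → ℝ := fun z => u z / max |u z| (2 * χ z - 1) with hs
  have hmax : ∀ z, 1 / 2 < χ z → 0 < max |u z| (2 * χ z - 1) := fun z h =>
    lt_max_of_lt_right (by linarith)
  have hsc : ∀ z, 1 / 2 < χ z → ContinuousAt s z := fun z h =>
    ContinuousAt.div hu.continuousAt (Continuous.continuousAt (by fun_prop)) (hmax z h).ne'
  have hs1 : ∀ z, 1 / 2 < χ z → |s z| ≤ 1 := fun z h => by
    rw [hs, abs_div, abs_of_pos (hmax z h), div_le_one (hmax z h)]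
    exact le_max_left _ _
  have hcoe2 : ∀ a b : ℝ, (a : AddCircle (2 : ℝ)) = b ↔ ∃ n : ℤ, a - b = n * 2 := fun a b => by
    rw [← sub_eq_zero, ← AddCircle.coe_sub, AddCircle.coe_eq_zero_iff]
    simp only [zsmul_eq_mul]
    exact exists_congr fun n => eq_comm
  -- Where `χ = 1/2` the weight `2χ - 1` vanishes and `s = ±1`. Both values are the same point of
  -- `ℝ/2ℤ`, so extending by `1` gives a continuous circle-valued map, whichever sign `u` has there.
  set F : ℝ × ℝ → AddCircle (2 : ℝ) := fun z => if χ z ≤ 1 / 2 then ((1 : ℝ) : AddCircle (2 : ℝ))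
    else (s z : AddCircle (2 : ℝ)) with hF
  have hFc : Continuous F := by
    rw [continuous_iff_continuousAt]
    intro z
    rcases lt_trichotomy (χ z) (1 / 2) with h | h | h
    · refine (continuousAt_const (y := ((1 : ℝ) : AddCircle (2 : ℝ)))).congr ?_
      filter_upwards [hχc.continuousAt.eventually_lt continuousAt_const h] with w hw
      rw [hF]; exact (if_pos (le_of_lt hw)).symm
    · refine (continuousAt_const (y := ((1 : ℝ) : AddCircle (2 : ℝ)))).congr ?_
      have huz : u z ≠ 0 := fun h0 => by
        have : z ∈ K ∪ N := hz ▸ h0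
        rcases this with h' | h'
        · have := hχK h'; simp only [Pi.one_apply] at this; linarith
        · have := hχN h'; simp only [Pi.zero_apply] at this; linarith
      have h1 : ∀ᶠ w in 𝓝 z, 2 * χ w - 1 < |u w| :=
        ContinuousAt.eventually_lt (by fun_prop) (by fun_prop) (by
          rw [h]; have := abs_pos.2 huz; linarith)
      filter_upwards [h1, hu.continuousAt.eventually_ne huz] with w hw hw0
      simp only [hF]
      split_ifs
      · rfl
      · rw [hcoe2, hs]
        simp only
        rw [max_eq_left hw.le]
        rcases lt_or_gt_of_ne hw0 with h' | h'
        · exact ⟨1, by rw [abs_of_neg h', div_neg, div_self hw0]; norm_num⟩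
        · exact ⟨0, by rw [abs_of_pos h', div_self hw0]; norm_num⟩
    · refine ContinuousAt.congr (f := fun w => (s w : AddCircle (2 : ℝ))) ?_ ?_
      · exact ContinuousAt.comp (g := fun x : ℝ => (x : AddCircle (2 : ℝ)))
          (AddCircle.continuous_mk' 2).continuousAt (hsc z h)
      · filter_upwards [hχc.continuousAt.eventually_const_lt h] with w hw
        rw [hF]; exact (if_neg (not_le.2 hw)).symm
  have hK1 : ∀ z ∈ K, χ z = 1 ∧ u z = 0 ∧ s z = 0 := fun z hzK => by
    have h0 : u z = 0 := (hz.symm ▸ Or.inl hzK : z ∈ {z | u z = 0})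
    exact ⟨hχK hzK, h0, by simp [hs, h0]⟩
  have hFK : ∀ z ∈ K, F z = ((0 : ℝ) : AddCircle (2 : ℝ)) := fun z hzK => by
    obtain ⟨h1, -, h3⟩ := hK1 z hzK
    simp only [hF]
    rw [if_neg (by rw [h1]; norm_num), h3]
  obtain ⟨z₀, hz₀⟩ := hKne
  -- The plane is simply connected, so `F` lifts to a real function.
  obtain ⟨v, ⟨hv0, hvF⟩, -⟩ := (AddCircle.isCoveringMap_coe (2 : ℝ)).existsUnique_continuousMap_lifts
    ⟨F, hFc⟩ z₀ (0 : ℝ) (hFK z₀ hz₀).symm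
  have hvF' : ∀ z, ((v z : ℝ) : AddCircle (2 : ℝ)) = F z := fun z => congrFun hvF z
  have hvc : Continuous v := v.continuous
  have hvK2 : ∀ z ∈ K, ∃ n : ℤ, v z = n * 2 := fun z hzK => by
    have := (hcoe2 _ _).1 ((hvF' z).trans (hFK z hzK))
    simpa using this
  -- On `K` the lift takes values in `2ℤ`; its image is an interval containing `0`, and a nonzero
  -- value would force `1` or `-1` into it.
  have hvK : ∀ z ∈ K, v z = 0 := fun z hzK => by
    have hord := (hKc.image v hvc.continuousOn).ordConnected
    have h0 : (0 : ℝ) ∈ v '' K := ⟨z₀, hz₀, hv0⟩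
    have hz' : v z ∈ v '' K := ⟨z, hzK, rfl⟩
    obtain ⟨n, hn⟩ := hvK2 z hzK
    have hint : ∀ c ∈ v '' K, ∃ n : ℤ, c = n * 2 := by
      rintro _ ⟨w, hw, rfl⟩; exact hvK2 w hw
    rcases lt_trichotomy n 0 with h | h | h
    · have h' : (n : ℝ) ≤ -1 := by exact_mod_cast (by omega : n ≤ -1)
      obtain ⟨m, hm⟩ := hint (-1) (hord.out hz' h0 ⟨by linarith, by norm_num⟩)
      have : (-1 : ℤ) = m * 2 := by exact_mod_cast hm
      omega
    · rw [hn, h]; simp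
    · have h' : (1 : ℝ) ≤ n := by exact_mod_cast (by omega : 1 ≤ n)
      obtain ⟨m, hm⟩ := hint 1 (hord.out h0 hz' ⟨by norm_num, by linarith⟩)
      have : (1 : ℤ) = m * 2 := by exact_mod_cast hm
      omega
  refine ⟨v, hvc, fun z => ⟨fun h => ?_, hvK z⟩, fun z hzK => ?_⟩
  · have h1 := hvF' z
    rw [h] at h1
    simp only [hF] at h1
    split_ifs at h1 with h2
    · obtain ⟨n, hn⟩ := (hcoe2 _ _).1 h1
      have : (0 - 1 : ℤ) = n * 2 := by exact_mod_cast hn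
      omega
    · have h2' := not_le.1 h2
      obtain ⟨n, hn⟩ := (hcoe2 _ _).1 h1
      have h3 := abs_le.1 (hs1 z h2')
      have h4 : n = 0 := by
        have h5 : (n : ℝ) < 1 := by linarith
        have h6 : (-1 : ℝ) < n := by linarith
        have h5' : n < 1 := by exact_mod_cast h5
        have h6' : -1 < n := by exact_mod_cast h6
        omega
      have h7 : s z = 0 := by rw [h4] at hn; simpa using hn
      have h8 : u z = 0 := by
        rcases div_eq_zero_iff.1 h7 with h | h
        · exact h
        · exact absurd h (hmax z h2').ne'
      have h9 : z ∈ K ∪ N := hz ▸ h8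
      refine h9.resolve_right fun hN' => ?_
      have := hχN hN'
      simp only [Pi.zero_apply] at this
      linarith
  · obtain ⟨h1, -, h3⟩ := hK1 z hzK
    have hχ : 1 / 2 < χ z := by rw [h1]; norm_num
    -- Near `K` the difference `v - s` lies in `2ℤ`, so being smaller than `2` makes it zero; and
    -- `s` has the sign of `u`.
    have e1 : ∀ᶠ w in 𝓝 z, |v w - s w| < 2 :=
      ContinuousAt.eventually_lt ((hvc.continuousAt.sub (hsc z hχ)).abs) continuousAt_const (by
        rw [hvK z hzK, h3]; norm_num)
    filter_upwards [e1, hχc.continuousAt.eventually_const_lt hχ] with w hw1 hw2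
    have h5 := hvF' w
    simp only [hF] at h5
    rw [if_neg (not_le.2 hw2), hcoe2] at h5
    obtain ⟨n, hn⟩ := h5
    have hn0 : n = 0 := by
      rw [hn, abs_lt] at hw1
      have h5' : n < 1 := by exact_mod_cast (by linarith [hw1.2] : (n : ℝ) < 1)
      have h6' : -1 < n := by exact_mod_cast (by linarith [hw1.1] : (-1 : ℝ) < n)
      omega
    have hvs : v w = s w := by rw [hn0] at hn; simp at hn; linarith
    rw [hvs]
    exact ⟨fun h => div_pos h (hmax w hw2), fun h => div_neg_of_neg_of_pos h (hmax w hw2)⟩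

/-- If `d > 0`, the second derivative test makes the point a local minimum as well, so `g` is
locally constant and `d = 0`. -/
lemma IsLocalMax.hasDerivAt_deriv_nonpos {g : ℝ → ℝ} {x d : ℝ} (h : IsLocalMax g x)
    (hg : ContinuousAt g x) (hd : HasDerivAt (deriv g) d x) : d ≤ 0 := by
  by_contra! hpos
  have hmin : IsLocalMin g x :=
    isLocalMin_of_deriv_deriv_pos (by rwa [hd.deriv]) h.deriv_eq_zero hg
  have hconst : g =ᶠ[𝓝 x] fun _ => g x := by
    filter_upwards [h, hmin] with y h1 h2 using le_antisymm h1 h2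
  have h0 : deriv g =ᶠ[𝓝 x] fun _ => 0 := by
    simpa using hconst.deriv
  have := (hd.congr_of_eventuallyEq h0.symm).unique (hasDerivAt_const x (0 : ℝ))
  linarith

lemma HasDerivAt.nonneg_of_eventually_le_left {g : ℝ → ℝ} {x d : ℝ} (hd : HasDerivAt g d x)
    (h : ∀ᶠ y in 𝓝[<] x, g y ≤ g x) : 0 ≤ d := by
  have h1 := (hasDerivAt_iff_tendsto_slope.1 hd).mono_left
    (nhdsWithin_mono x (show Set.Iio x ⊆ {x}ᶜ from fun y hy => ne_of_lt hy))
  refine ge_of_tendsto h1 ?_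
  filter_upwards [h, self_mem_nhdsWithin] with y hy hyx
  rw [slope_def_field]
  exact div_nonneg_of_nonpos (by linarith) (by have : y < x := hyx; linarith)

/-- Maximum principle for `u_σ = σ u_xx` on a region of the open upper half plane. -/
theorem nonpos_of_heat {u : ℝ × ℝ → ℝ} (hc : Continuous u)
    (h0 : Tendsto u (cocompact (ℝ × ℝ)) (𝓝 0))
    (hheat : ∀ x σ : ℝ, 0 < σ → ∃ d : ℝ, HasDerivAt (fun τ => u (x, τ)) (σ * d) σ ∧
      HasDerivAt (deriv fun y => u (y, σ)) d x)
    {W : Set (ℝ × ℝ)} (hW : IsOpen W) (hpos : ∀ z ∈ closure W, 0 < z.2)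
    (hbd : ∀ z ∈ closure W, z ∉ W → u z = 0) : ∀ z ∈ W, u z ≤ 0 := by
  intro z₁ hz₁
  by_contra! hm
  set m := u z₁ with hmdef
  -- The perturbation `u - εσ²` makes the inequality at the maximum strict; this `ε` costs at most
  -- `m/2` at `z₁`.
  set ε := m / (2 * (z₁.2 ^ 2 + 1)) with hε
  have hε0 : 0 < ε := by positivity
  have hε1 : ε * z₁.2 ^ 2 ≤ m / 2 := by
    rw [hε, div_mul_eq_mul_div, div_le_div_iff₀ (by positivity) (by norm_num)]
    nlinarith [sq_nonneg z₁.2]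
  -- Compact because `u` vanishes at infinity; the threshold `m/2 > 0` excludes boundary points of
  -- `W`.
  set S : Set (ℝ × ℝ) := closure W ∩ {z | z.2 ≤ z₁.2} ∩ {z | m / 2 ≤ u z} with hS
  have hScl : IsClosed S := (isClosed_closure.inter (isClosed_le continuous_snd
    continuous_const)).inter (isClosed_le continuous_const hc)
  have hScpt : IsCompact S := by
    have : ∀ᶠ z in cocompact (ℝ × ℝ), u z < m / 2 := h0.eventually_lt_const (by linarith)
    obtain ⟨K, hK, hK'⟩ := mem_cocompact.1 this
    refine hK.of_isClosed_subset hScl fun z hz => ?_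
    by_contra hzK
    have h1 : m / 2 ≤ u z := hz.2
    have h2 : u z < m / 2 := hK' hzK
    linarith
  have hz₁S : z₁ ∈ S := ⟨⟨subset_closure hz₁, le_refl z₁.2⟩, by
    simp only [Set.mem_ofPred_eq]; linarith⟩
  have hwc : Continuous fun z : ℝ × ℝ => u z - ε * z.2 ^ 2 := by fun_prop
  obtain ⟨z₂, hz₂, hmax⟩ := hScpt.exists_isMaxOn ⟨z₁, hz₁S⟩ hwc.continuousOn
  have hσ₂ : 0 < z₂.2 := hpos z₂ hz₂.1.1
  have hu₂ : m / 2 < u z₂ := by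
    have h1 : u z₁ - ε * z₁.2 ^ 2 ≤ u z₂ - ε * z₂.2 ^ 2 := hmax hz₁S
    have h2 : 0 < ε * z₂.2 ^ 2 := by positivity
    linarith
  have hz₂W : z₂ ∈ W := by
    by_contra hcon
    have := hbd z₂ hz₂.1.1 hcon
    linarith
  have hloc : ∀ᶠ z in 𝓝 z₂, z.2 ≤ z₂.2 → u z - ε * z.2 ^ 2 ≤ u z₂ - ε * z₂.2 ^ 2 := by
    filter_upwards [hW.mem_nhds hz₂W, hc.continuousAt.eventually_const_lt hu₂] with z h1 h2 h3
    exact hmax (a := z) ⟨⟨subset_closure h1, h3.trans hz₂.1.2⟩, h2.le⟩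
  obtain ⟨d, hd1, hd2⟩ := hheat z₂.1 z₂.2 hσ₂
  have hd : d ≤ 0 := by
    refine IsLocalMax.hasDerivAt_deriv_nonpos (g := fun y => u (y, z₂.2)) ?_
      (Continuous.continuousAt (by fun_prop)) hd2
    have : ContinuousAt (fun y : ℝ => (y, z₂.2)) z₂.1 := by fun_prop
    filter_upwards [this.eventually hloc] with y hy
    have h1 : u (y, z₂.2) - ε * z₂.2 ^ 2 ≤ u z₂ - ε * z₂.2 ^ 2 := hy le_rfl
    change u (y, z₂.2) ≤ u z₂
    linarith
  -- The maximum may lie on the top edge `σ = z₁.2`, so only the comparison from below in `σ` is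
  -- available; it already contradicts `u_σ = σ d ≤ 0`.
  have hd' : 0 ≤ z₂.2 * d - ε * (2 * z₂.2) := by
    have hder : HasDerivAt (fun τ => u (z₂.1, τ) - ε * τ ^ 2) (z₂.2 * d - ε * (2 * z₂.2)) z₂.2 := by
      have := hd1.sub ((hasDerivAt_pow 2 z₂.2).const_mul ε)
      refine this.congr_deriv ?_
      simp
    refine hder.nonneg_of_eventually_le_left ?_
    have : ContinuousAt (fun τ : ℝ => (z₂.1, τ)) z₂.2 := by fun_prop
    filter_upwards [nhdsWithin_le_nhds (this.eventually hloc), self_mem_nhdsWithin] with τ hτ hτ'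
    exact hτ (le_of_lt hτ')
  have : 0 < ε * (2 * z₂.2) := by positivity
  nlinarith

/-! ### Reflection symmetry, intersection with the axis, and the classification. -/

/-- The reflection in the `x`-axis. -/
noncomputable def reflectAxis : (ℝ × ℝ) →L[ℝ] ℝ × ℝ :=
  (ContinuousLinearMap.fst ℝ ℝ ℝ).prod (-ContinuousLinearMap.snd ℝ ℝ ℝ)

lemma reflectAxis_apply (z : ℝ × ℝ) : reflectAxis z = (z.1, -z.2) := rfl

/-- For `u` even in `σ`, `u_x` is even and `u_σ` odd; hence a reflected flow line is a flow line run
backwards in time. -/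
lemma levelField_reflectAxis {u : ℝ × ℝ → ℝ} (hu : Differentiable ℝ u)
    (he : ∀ x σ, u (x, -σ) = u (x, σ)) (z : ℝ × ℝ) :
    levelField u (reflectAxis z) = -reflectAxis (levelField u z) := by
  have hcomp : u ∘ reflectAxis = u := funext fun z => by
    rw [Function.comp_apply, reflectAxis_apply, he]
  have h1 : ∀ v, fderiv ℝ u z v = fderiv ℝ u (reflectAxis z) (reflectAxis v) := fun v => by
    have h2 : HasFDerivAt (u ∘ reflectAxis) _ z :=
      (hu (reflectAxis z)).hasFDerivAt.comp z (reflectAxis.hasFDerivAt (x := z))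
    rw [hcomp] at h2
    rw [h2.fderiv]; rfl
  have hp : partialFst u (reflectAxis z) = partialFst u z := by
    rw [partialFst, partialFst, h1, reflectAxis_apply (1, 0), neg_zero]
  have hq : partialSnd u (reflectAxis z) = -partialSnd u z := by
    rw [partialSnd, partialSnd, h1, reflectAxis_apply (0, 1), ← map_neg, Prod.neg_mk, neg_zero,
      neg_neg]
  rw [levelField, levelField, gradSq, gradSq, hp, hq, reflectAxis_apply]
  ext <;> simp

lemma IsFlowLine.reflect {u : ℝ × ℝ → ℝ} (hu : Differentiable ℝ u)
    (he : ∀ x σ, u (x, -σ) = u (x, σ)) {γ : ℝ → ℝ × ℝ} (hγ : IsFlowLine u γ Set.univ) :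
    IsFlowLine u (fun t => reflectAxis (γ (-t))) Set.univ := fun t _ => by
  refine ⟨?_, ?_⟩
  · change u (reflectAxis (γ (-t))) = 0
    rw [reflectAxis_apply, he]; exact (hγ (-t) trivial).1
  · have h1 := (hγ (-t) trivial).2.scomp t (hasDerivAt_neg t)
    have h2 := (reflectAxis.hasFDerivAt (x := γ (-t))).comp_hasDerivAt t h1
    refine h2.congr_deriv ?_
    rw [levelField_reflectAxis hu he, neg_one_smul, map_neg]

/-- An orbit missing the axis would lie in `σ > 0`. The separating function then has constant sign
on `σ ≤ 0`, so the region of the opposite sign has its closure in `σ > 0`, and `u` is zero on the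
boundary. The maximum principle for `±u` makes `u` vanish there, yet near `γ 0` it takes both signs.
-/
lemma IsScaleField.exists_axis_of_pos {u : ℝ × ℝ → ℝ} {r : ℕ∞} (hf : IsScaleField r u)
    (hu : IsRegularLevel u) {γ : ℝ → ℝ × ℝ} (hγ : IsFlowLine u γ Set.univ)
    (h0 : 0 < (γ 0).2) : ∃ t, (γ t).2 = 0 := by
  by_contra! hne
  have hγc := IsRegularLevel.continuous_flowLine hγ
  have hpos : ∀ t, 0 < (γ t).2 := fun t => by
    by_contra! hle
    obtain ⟨s, hs⟩ := mem_range_of_exists_le_of_exists_ge (continuous_snd.comp hγc)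
      ⟨t, hle⟩ ⟨0, h0.le⟩
    exact hne s hs
  have hsub : Set.range γ ⊆ {z | u z = 0} := by rintro _ ⟨t, rfl⟩; exact (hγ t trivial).1
  have huc := hu.contDiff.continuous
  obtain ⟨v, hvc, hv0, hsign⟩ := exists_separating_function huc (hu.isClosed_range hγ)
    (hu.isClosed_diff_range hγ) Set.disjoint_sdiff_right (Set.union_sdiff_cancel hsub).symm
    (isPreconnected_range hγc) ⟨γ 0, 0, rfl⟩
  have hA : IsPreconnected {z : ℝ × ℝ | z.2 ≤ 0} := by
    have : {z : ℝ × ℝ | z.2 ≤ 0} = Set.univ ×ˢ Set.Iic 0 := by ext; simp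
    rw [this]
    exact isPreconnected_univ.prod isPreconnected_Iic
  have hvA : ∀ z : ℝ × ℝ, z.2 ≤ 0 → v z ≠ 0 := fun z hz h => by
    obtain ⟨t, rfl⟩ := (hv0 z).1 h
    exact absurd (hpos t) (not_lt.2 hz)
  have hz0 := (hγ 0 trivial).1
  -- With nonzero gradient, `γ 0` is neither a local minimum nor a local maximum, so both signs of
  -- `u` occur arbitrarily close to it.
  have hfd := hu.fderiv_ne_zero _ hz0
  have hneg : ∃ᶠ w in 𝓝 (γ 0), u w < 0 := fun h => hfd (IsLocalMin.fderiv_eq_zero (by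
    filter_upwards [h] with w hw
    rw [hz0]; exact not_lt.1 hw))
  have hpos' : ∃ᶠ w in 𝓝 (γ 0), 0 < u w := fun h => hfd (IsLocalMax.fderiv_eq_zero (by
    filter_upwards [h] with w hw
    rw [hz0]; exact not_lt.1 hw))
  have main : ∀ g : ℝ × ℝ → ℝ, Continuous g → (∀ z, g z = 0 → z ∈ Set.range γ) →
      (∀ z : ℝ × ℝ, z.2 ≤ 0 → 0 < g z) → ∀ z, g z < 0 → u z = 0 := by
    intro g hg hg0 hgA z hz
    have hWo : IsOpen {z | g z < 0} := isOpen_lt hg continuous_const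
    have hcl : closure {z | g z < 0} ⊆ {z | g z ≤ 0} := closure_lt_subset_le hg continuous_const
    have hp : ∀ z ∈ closure {z | g z < 0}, 0 < z.2 := fun z hz => by
      by_contra! h
      exact absurd (hgA z h) (not_lt.2 (hcl hz))
    have hb : ∀ z ∈ closure {z | g z < 0}, z ∉ {z | g z < 0} → u z = 0 := fun z hz hz' =>
      hsub (hg0 z (le_antisymm (hcl hz) (not_lt.1 hz')))
    have h1 := nonpos_of_heat huc hf.tendsto_zero hf.heat hWo hp hb z hz
    have h2 := nonpos_of_heat (u := fun z => -u z) huc.neg (by simpa using hf.tendsto_zero.neg)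
      (fun x σ hσ => by
        obtain ⟨d, hd1, hd2⟩ := hf.heat x σ hσ
        refine ⟨-d, by have := hd1.neg; rw [← mul_neg] at this; exact this, ?_⟩
        have : (deriv fun y => -u (y, σ)) = fun x => -deriv (fun y => u (y, σ)) x :=
          funext fun x => by simp
        rw [this]
        exact hd2.neg) hWo hp (fun z hz hz' => by rw [hb z hz hz', neg_zero]) z hz
    linarith
  have hK0 : γ 0 ∈ Set.range γ := ⟨0, rfl⟩
  have h00 : v (0, 0) ≠ 0 := hvA _ le_rfl
  have hconst : ∀ z : ℝ × ℝ, z.2 ≤ 0 → 0 < v z * v (0, 0) := fun z hz => by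
    by_contra! hle
    have hord := (hA.image (fun z => v z * v (0, 0)) (by fun_prop)).ordConnected
    have h2 : (0 : ℝ) < v (0, 0) * v (0, 0) := mul_self_pos.2 h00
    obtain ⟨w, hw, hw'⟩ := hord.out (x := v z * v (0, 0)) ⟨z, hz, rfl⟩
      (y := v (0, 0) * v (0, 0)) ⟨(0, 0), le_refl (0 : ℝ), rfl⟩ ⟨hle, h2.le⟩
    rcases mul_eq_zero.1 hw' with h | h
    · exact hvA w hw h
    · exact h00 h
  -- Multiplying by `v (0, 0)` normalizes the sign to be positive on the lower half plane.
  have key := main (fun z => v z * v (0, 0)) (by fun_prop)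
    (fun z hz => (hv0 z).1 ((mul_eq_zero.1 hz).resolve_right h00)) hconst
  rcases lt_or_gt_of_ne h00 with h | h
  · obtain ⟨w, hw1, hw2⟩ := (hpos'.and_eventually (hsign _ hK0)).exists
    exact hw1.ne' (key w (mul_neg_of_pos_of_neg (hw2.1 hw1) h))
  · obtain ⟨w, hw1, hw2⟩ := (hneg.and_eventually (hsign _ hK0)).exists
    exact hw1.ne (key w (mul_neg_of_neg_of_pos (hw2.2 hw1) h))

lemma IsScaleField.exists_axis {u : ℝ × ℝ → ℝ} {r : ℕ∞} (hf : IsScaleField r u)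
    (hu : IsRegularLevel u) {γ : ℝ → ℝ × ℝ} (hγ : IsFlowLine u γ Set.univ) :
    ∃ t, (γ t).2 = 0 := by
  rcases lt_trichotomy (γ 0).2 0 with h | h | h
  · have hd : Differentiable ℝ u := hu.contDiff.differentiable one_ne_zero
    obtain ⟨t, ht⟩ := hf.exists_axis_of_pos hu (hγ.reflect hd hf.even) (by
      rw [reflectAxis_apply]; simpa using h)
    refine ⟨-t, ?_⟩
    rw [reflectAxis_apply] at ht
    simpa using ht
  · exact ⟨0, h⟩
  · exact hf.exists_axis_of_pos hu hγ h

/-- The components of a regular level set of a scale field. -/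
theorem IsScaleField.component_cases {u : ℝ × ℝ → ℝ} {r : ℕ∞} (hf : IsScaleField r u)
    (hu : IsRegularLevel u) {z : ℝ × ℝ} (hz : u z = 0) {K : Set (ℝ × ℝ)}
    (hK : K = connectedComponentIn {z | u z = 0} z) :
    (IsSmoothClosedCurve r K ∧ IsSymmXAxis K ∧ {z ∈ K | z.2 = 0}.ncard = 2) ∨
      (IsSmoothLine r K ∧ IsSymmXAxis K ∧ {z ∈ K | z.2 = 0}.ncard = 1) := by
  have hd : Differentiable ℝ u := hu.contDiff.differentiable one_ne_zero
  obtain ⟨η, hη0, hη⟩ := hu.exists_flowLine hz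
  obtain ⟨t₀, ht₀⟩ := hf.exists_axis hu hη
  obtain ⟨γ, hγ, hγ0, hKγ⟩ : ∃ γ, IsFlowLine u γ Set.univ ∧ (γ 0).2 = 0 ∧ K = Set.range γ := by
    refine ⟨fun t => η (t + t₀), hη.comp_add_const t₀, by simpa using ht₀, ?_⟩
    rw [hK, ← hη0, hu.connectedComponentIn_eq_range hη 0]
    exact ((Equiv.addRight t₀).surjective.range_comp η).symm
  -- The reversed reflection is a flow line with the same value at time `0`, the starting point
  -- being on the axis.
  have hrefl : ∀ t, reflectAxis (γ t) = γ (-t) := fun t => by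
    have := hu.eq_of_eq hγ (hγ.reflect hd hf.even) (s := 0) (t := 0) (by
      rw [reflectAxis_apply, neg_zero]
      ext
      · rfl
      · simp [hγ0]) (-t)
    simpa using this.symm
  have haxis : ∀ t, (γ t).2 = 0 ↔ γ t = γ (-t) := fun t => by
    rw [← hrefl, reflectAxis_apply, Prod.ext_iff]
    simp only [true_and]
    constructor <;> intro h <;> linarith
  have hsymm : IsSymmXAxis K := by
    rw [hKγ]
    rintro x σ ⟨t, ht⟩
    refine ⟨-t, ?_⟩
    rw [← hrefl, ht, reflectAxis_apply]
  have hreg := isRegularParam_flowLine hf hu hγ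
  rcases hu.injective_or_periodic hγ with hinj | ⟨T, hT, hper⟩
  · refine Or.inr ⟨⟨γ, hreg, hu.isEmbedding_of_injective hγ hinj, hKγ.symm⟩, hsymm, ?_⟩
    rw [Set.ncard_eq_one]
    refine ⟨γ 0, ?_⟩
    ext w
    simp only [hKγ, Set.mem_ofPred_eq, Set.mem_singleton_iff]
    constructor
    · rintro ⟨⟨t, rfl⟩, ht⟩
      have := hinj ((haxis t).1 ht)
      rw [show t = 0 by linarith]
    · rintro rfl
      exact ⟨⟨0, rfl⟩, hγ0⟩
  · refine Or.inl ⟨⟨γ, T, hT, hreg, fun t => (hper _ _).2 ⟨1, by simp⟩, ?_, hKγ.symm⟩, hsymm, ?_⟩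
    · intro s hs t ht hst
      obtain ⟨n, hn⟩ := (hper s t).1 hst
      have h1 : n < 1 := by
        by_contra! h
        have : (1 : ℝ) ≤ n := by exact_mod_cast h
        nlinarith [hs.1, hs.2, ht.1, ht.2]
      have h2 : -1 < n := by
        by_contra! h
        have : (n : ℝ) ≤ -1 := by exact_mod_cast h
        nlinarith [hs.1, hs.2, ht.1, ht.2]
      have h3 : n = 0 := by omega
      rw [h3] at hn
      simp at hn
      linarith
    · rw [Set.ncard_eq_two]
      -- `γ(t) = γ(-t)` means `2t ∈ Tℤ`; modulo `T` this leaves `t = 0` and `t = T/2`, according to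
      -- the parity of `2t/T`.
      refine ⟨γ 0, γ (T / 2), fun h => ?_, ?_⟩
      · obtain ⟨n, hn⟩ := (hper _ _).1 h
        have h1 : (2 * n + 1 : ℝ) * T = 0 := by linarith
        have h2 : (2 * n + 1 : ℤ) = 0 := by
          exact_mod_cast (mul_eq_zero.1 h1).resolve_right hT.ne'
        omega
      · ext w
        simp only [hKγ, Set.mem_ofPred_eq, Set.mem_insert_iff, Set.mem_singleton_iff]
        constructor
        · rintro ⟨⟨t, rfl⟩, ht⟩
          obtain ⟨n, hn⟩ := (hper _ _).1 ((haxis t).1 ht)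
          rcases Int.even_or_odd' n with ⟨m, hm | hm⟩
          · exact Or.inl ((hper _ _).2 ⟨m, by rw [hm] at hn; push_cast at hn; linarith⟩)
          · exact Or.inr ((hper _ _).2 ⟨m, by rw [hm] at hn; push_cast at hn; linarith⟩)
        · rintro (rfl | rfl)
          · exact ⟨⟨0, rfl⟩, hγ0⟩
          · exact ⟨⟨T / 2, rfl⟩, (haxis _).2 ((hper _ _).2 ⟨1, by push_cast; ring⟩)⟩

/-! ### The zero contours. -/

/-- At a zero of `u = ∂ₓᵏΨ`, the two further quantities in the generic condition are `u_x` and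
`u_σ`, so excluding their joint vanishing says that zero is a regular value. -/
lemma isRegularLevel_scalePsiDx {f : ℝ → ℝ} {θ : KernelParity} {p : ℝ} {k : ℕ} {r : ℕ∞}
    (hr : 1 ≤ r) (hf : IsScaleField r fun z => scalePsiDx f θ p k z.1 z.2)
    (hgen : ∀ x σ : ℝ, ¬ (scalePsiDx f θ p k x σ = 0 ∧ scalePsiDx f θ p (k + 1) x σ = 0 ∧
      scalePsiDxDsigma f θ p k x σ = 0)) :
    IsRegularLevel fun z => scalePsiDx f θ p k z.1 z.2 := by
  have hc : ContDiff ℝ 1 fun z : ℝ × ℝ => scalePsiDx f θ p k z.1 z.2 :=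
    hf.contDiff.of_le (by exact_mod_cast hr)
  refine ⟨hc, fun z hz h0 => hgen z.1 z.2 ⟨hz, ?_, ?_⟩⟩
  all_goals
    have hd := (hc.differentiable one_ne_zero z).hasFDerivAt
    rw [h0] at hd
  · have h2 : HasDerivAt (fun y : ℝ => (y, z.2)) ((1 : ℝ), (0 : ℝ)) z.1 :=
      (hasDerivAt_id z.1).prodMk (hasDerivAt_const z.1 z.2)
    have h3 := (hd.comp_hasDerivAt z.1 h2).deriv
    rw [scalePsiDx, iteratedDeriv_succ]
    exact h3
  · have h2 : HasDerivAt (fun τ : ℝ => (z.1, τ)) ((0 : ℝ), (1 : ℝ)) z.2 :=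
      (hasDerivAt_const z.2 z.1).prodMk (hasDerivAt_id z.2)
    exact (hd.comp_hasDerivAt z.2 h2).deriv

theorem theorem3p2 (f : ℝ → ℝ) (θ : KernelParity) (p : ℝ) (hp : 0 ≤ p) (k : ℕ)
    (r : ℕ∞) (hr : 1 ≤ r)
    (hf : ∀ j : ℕ, (j : ℕ∞) ≤ r →
      ∃ m : ℕ, p + (k : ℝ) + (j : ℝ) < (m : ℝ) ∧ IsIntegrableSignal m f)
    (hgen : ∀ x σ : ℝ, ¬ (scalePsiDx f θ p k x σ = 0 ∧ scalePsiDx f θ p (k + 1) x σ = 0 ∧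
      scalePsiDxDsigma f θ p k x σ = 0)) :
    ∃ C D : Set (Set (ℝ × ℝ)),
      zeroContour f θ p k = ⋃₀ C ∪ ⋃₀ D ∧
      (∀ K ∈ C ∪ D, ∃ z ∈ zeroContour f θ p k,
        K = connectedComponentIn (zeroContour f θ p k) z) ∧
      (∀ K ∈ C, IsSmoothClosedCurve r K ∧ IsSymmXAxis K ∧ {z ∈ K | z.2 = 0}.ncard = 2) ∧
      (∀ K ∈ D, IsSmoothLine r K ∧ IsSymmXAxis K ∧ {z ∈ K | z.2 = 0}.ncard = 1) := by
  have hfield := isScaleField_scalePsiDx θ hp k hr hf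
  have hreg := isRegularLevel_scalePsiDx hr hfield hgen
  have hzc : zeroContour f θ p k = {z : ℝ × ℝ | scalePsiDx f θ p k z.1 z.2 = 0} := rfl
  let comp : Set (Set (ℝ × ℝ)) := {K | ∃ z ∈ zeroContour f θ p k,
    K = connectedComponentIn (zeroContour f θ p k) z}
  refine ⟨{K ∈ comp | IsSmoothClosedCurve r K ∧ IsSymmXAxis K ∧ {z ∈ K | z.2 = 0}.ncard = 2},
    {K ∈ comp | IsSmoothLine r K ∧ IsSymmXAxis K ∧ {z ∈ K | z.2 = 0}.ncard = 1}, ?_, ?_,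
    fun K hK => hK.2, fun K hK => hK.2⟩
  · apply Set.Subset.antisymm
    · intro z hz
      have hmem := mem_connectedComponentIn hz
      have hK : connectedComponentIn (zeroContour f θ p k) z ∈ comp := ⟨z, hz, rfl⟩
      rcases hfield.component_cases hreg hz rfl with h | h
      · exact Or.inl ⟨_, ⟨hK, h⟩, hmem⟩
      · exact Or.inr ⟨_, ⟨hK, h⟩, hmem⟩
    · rintro w (⟨K, ⟨⟨z, -, rfl⟩, -⟩, hw⟩ | ⟨K, ⟨⟨z, -, rfl⟩, -⟩, hw⟩)
      · exact connectedComponentIn_subset _ _ hw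
      · exact connectedComponentIn_subset _ _ hw
  · rintro K (hK | hK)
    · exact hK.1
    · exact hK.1
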